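/- Let $G$ be a group with a finite symmetric generating set $A$ (closed under formal inversion, no letter representing $1$) and Cayley graph $\Gamma$, and suppose $G$ is stackable over $A$: there are a maximal tree $T\subseteq\Gamma$ and a bounded flow function $\Phi$, assigning to every directed edge $e$ of $\Gamma$ a directed edge path $\Phi(e)$ with the same endpoints as $e$, such that $\Phi(e)=e$ if $e$ lies in $T$; the transitive closure of the relation "$e'<e$ iff $e'$ lies on $\Phi(e)$ and neither $e$ nor $e'$ lies in $T$" is a well-founded strict partial order; and the lengths of the paths $\Phi(e)$ are bounded. Let $R_\Phi$ be the closure of the set of words $\mathrm{label}(\Phi(e))\,\mathrm{label}(e)^{-1}$ under inversion, cyclic conjugation and passage to nonempty freely reduced representatives, let $X$ be the Cayley complex of $\langle A\mid R_\Phi\rangle$, and let $\rho$ be the length of the longest word in $R_\Phi$. Definitions. In a 2-complex $Y$ with base vertex $y$, the coarse distance $\tilde d_Y(y,p)$ is the path distance in $Y^{(1)}$ if $p$ is a vertex; it is $\frac12$ plus the smaller of the distances to the two endpoints if $p$ is interior to an edge; and if $p$ is interior to a 2-cell it is the maximum of the values on the open edges of its boundary, minus $\frac14$. A nondecreasing $f:\mathbb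 N[\frac14]\to\mathbb N[\frac14]$, where $\mathbb N[\frac14]=\{n/4: n\in\mathbb N\}$, is an intrinsic [extrinsic] tame filling function for $G$ over a finite presentation if every word $w$ representing $1$ has a van Kampen diagram $\Delta$ with basepoint $*$ and a continuous $\psi:\partial\Delta\times[0,1]\to\Delta$ with $\psi(p,0)=*$, $\psi(p,1)=p$, $\psi(*,t)=*$, and $\psi(p,t)\in\Delta^{(1)}$ for vertices $p$, such that for all $p$ and all $s<t$ one has $\tilde d_\Delta(*,\psi(p,s))\le f(\tilde d_\Delta(*,\psi(p,t)))$ [respectively $\tilde d_X(1,\pi_\Delta\psi(p,s))\le f(\tilde d_X(1,\pi_\Delta\psi(p,t)))$], where $\pi_\Delta:\Delta\to X$ is the label-preserving cellular map to the Cayley complex of the presentation with $\pi_\Delta(*)=1$. For $g\in G$ let $y_g$ be the label of the path without backtracking from $1$ to $g$ in $T$, and for a directed edge $e$ labelled $a$ from $g$ to $h=ga$ put $w_e=y_g a y_h^{-1}$. A family $(\Delta_e)$ of van Kampen diagrams for the words $w_e$ is recursively built from $\Phi$ if $\Delta_e$ is a line segment without 2-cells for $e$ in $T$, and for $e$ not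 in $T$ it is obtained as follows. Write $\mathrm{label}(\Phi(e))=x_g^{-1}zx_h$ with $y_g=y_qx_g$, $y_h=y_rx_h$, where $q,r\in G$ are the elements represented by these prefixes; glue the diagrams of the successive edges of the path from $q$ to $r$ labelled $z$, each to the next along their common boundary path labelled by a normal form (if $z$ is empty take a simple edge path labelled $y_q$); then attach one 2-cell with boundary label $x_g^{-1}zx_ha^{-1}$ along the boundary path labelled $z$. Theorem. $\langle A\mid R_\Phi\rangle$ is a finite presentation of $G$, and $G$ has finite-valued intrinsic and extrinsic tame filling functions over it. Explicitly, there is a family $(\Delta_e)$ recursively built from $\Phi$ such that, with $B(n)$ the ball of radius $n$ about $1$ in $\Gamma$ and $$k^i(n)=\max\{\ell(y_g): g\in B(n)\},\qquad k^e(n)=\max\{d_X(1,x): x \text{ a prefix of } y_g,\ g\in B(n)\},$$ $$k_r^i(n)=\max_e\ \max_{v\in\Delta_e^{(0)}}d_{\Delta_e}(*,v),\qquad k_r^e(n)=\max_e\ \max_{v\in\Delta_e^{(0)}}d_X(1,\pi_{\Delta_e}(v)),$$ the maxima over $e$ being over all directed edges $e$ outside $T$ with initial vertex in $B(n)$ (and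 $\max\emptyset=0$), all four functions are finite-valued, and $$\mu^i(n)=\max\{k^i(\lceil n\rceil+1)+1,\ n+1,\ k_r^i(\lceil n\rceil+\rho+1)+1\},$$ $$\mu^e(n)=\max\{k^e(\lceil n\rceil+1)+1,\ n+1,\ k_r^e(\lceil n\rceil+\rho+1)+1\}$$ are, respectively, an intrinsic and an extrinsic tame filling function for $G$ over $\langle A\mid R_\Phi\rangle$. -/

import Mathlib

open Set unitInterval

universe u v w u' v' w'

set_option linter.checkUnivs false

/-! ### Combinatorial 2-complexes -/

/-- The cyclic successor of an index. -/
def cyclicNext {n : ℕ} (k : Fin n) : Fin n :=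
  ⟨(k.1 + 1) % n, Nat.mod_lt _ k.pos⟩

/-- A combinatorial 2-complex: vertices `V`, directed edges `D` (an undirected edge is a pair
`{d, rev d}`), and 2-cells `F`, each attached along a nonempty closed edge path `bdry f`. -/
structure TwoComplex where
  V : Type u
  D : Type v
  F : Type w
  rev : D → D
  rev_rev : ∀ d, rev (rev d) = d
  rev_ne : ∀ d, rev d ≠ d
  src : D → V
  bdry : F → List D
  bdry_ne_nil : ∀ f, bdry f ≠ []
  bdry_closed : ∀ f (k : Fin (bdry f).length),
    src (rev ((bdry f).get k)) = src ((bdry f).get (cyclicNext k))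

namespace TwoComplex

variable (K : TwoComplex.{u, v, w})

/-- The terminal vertex of a directed edge. -/
def tgt (d : K.D) : K.V := K.src (K.rev d)

/-- `L` is a directed edge path from `x` to `y`. -/
def IsPath : K.V → List K.D → K.V → Prop
  | x, [], y => x = y
  | x, d :: L, y => K.src d = x ∧ IsPath (K.tgt d) L y

/-- The reverse of an edge path. -/
def revPath (L : List K.D) : List K.D := (L.map K.rev).reverse

/-- The path metric on the vertices of (a connected) `K`: least length of an edge path. -/
noncomputable def dist (x y : K.V) : ℕ := sInf {n | ∃ L, K.IsPath x L y ∧ L.length = n}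

/-- Points of the disjoint union of the closed cells. A closed 2-cell is the cone over its boundary
polygon: `face f k t r` lies at height `r` (`r = 0` the centre, `r = 1` the boundary) over the point
at parameter `t` of the `k`-th side. -/
inductive PrePoint
  | vert (x : K.V) : PrePoint
  | edge (d : K.D) (t : I) : PrePoint
  | face (f : K.F) (k : Fin (K.bdry f).length) (t r : I) : PrePoint

/-- The identifications that produce the complex from its closed cells. -/
inductive Glue : K.PrePoint → K.PrePoint → Prop
  | edge_zero (d : K.D) : Glue (.edge d 0) (.vert (K.src d))
  | edge_rev (d : K.D) (t : I) : Glue (.edge d t) (.edge (K.rev d) (σ t))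
  | face_boundary (f : K.F) (k : Fin (K.bdry f).length) (t : I) :
      Glue (.face f k t 1) (.edge ((K.bdry f).get k) t)
  | face_center (f : K.F) (k k' : Fin (K.bdry f).length) (t t' : I) :
      Glue (.face f k t 0) (.face f k' t' 0)
  | face_side (f : K.F) (k : Fin (K.bdry f).length) (r : I) :
      Glue (.face f k 1 r) (.face f (cyclicNext k) 0 r)

/-- The underlying space of the complex. -/
def Space : Type (max u v w) := Quot K.Glue

/-- The point of the space given by a point of a closed cell. -/
def pt (p : K.PrePoint) : K.Space := Quot.mk _ p

/-- The weak (CW) topology: a set is open iff its preimage in every closed cell is open. -/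
instance : TopologicalSpace K.Space :=
  (⨆ d : K.D, TopologicalSpace.coinduced (fun t : I => K.pt (.edge d t)) inferInstance) ⊔
  (⨆ s : (Σ f : K.F, Fin (K.bdry f).length), TopologicalSpace.coinduced
    (fun q : I × I => K.pt (.face s.1 s.2 q.1 q.2)) inferInstance)

/-- The 0-skeleton. -/
def vertexSet : Set K.Space := {p | ∃ x, p = K.pt (.vert x)}

/-- The 1-skeleton. -/
def oneSkeleton : Set K.Space := {p | (∃ x, p = K.pt (.vert x)) ∨ ∃ d t, p = K.pt (.edge d t)}

variable {K}

/-- The smaller one of the distances from `y` to the two ends of an edge. -/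
noncomputable def edgeMin (y : K.V) (d : K.D) : ℕ := min (K.dist y (K.src d)) (K.dist y (K.tgt d))

/-- Coarse distance to a point of a closed edge. -/
noncomputable def edgeCoarse (y : K.V) (d : K.D) (t : I) : ℚ :=
  open Classical in
  if t = 0 then (K.dist y (K.src d) : ℚ)
  else if t = 1 then (K.dist y (K.tgt d) : ℚ)
  else (edgeMin y d : ℚ) + 1 / 2

/-- Coarse distance to a point in the interior of a 2-cell: the maximum of the coarse distances to
the open edges in its boundary, minus `1/4`. -/
noncomputable def faceCoarse (y : K.V) (f : K.F) : ℚ :=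
  ((((K.bdry f).map (edgeMin y)).foldr max 0 : ℕ) : ℚ) + 1 / 2 - 1 / 4

/-- Coarse distance on points of closed cells. -/
noncomputable def preCoarse (y : K.V) : K.PrePoint → ℚ
  | .vert x => K.dist y x
  | .edge d t => edgeCoarse y d t
  | .face f k t r => open Classical in
      if r = 1 then edgeCoarse y ((K.bdry f).get k) t else faceCoarse y f

theorem edgeCoarse_rev (y : K.V) (d : K.D) (t : I) :
    edgeCoarse y (K.rev d) (σ t) = edgeCoarse y d t := by
  have h0 : σ t = 0 ↔ t = 1 := by
    constructor
    · intro h; rw [← unitInterval.symm_symm t, h, unitInterval.symm_zero]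
    · rintro rfl; exact unitInterval.symm_one
  have h1 : σ t = 1 ↔ t = 0 := by
    constructor
    · intro h; rw [← unitInterval.symm_symm t, h, unitInterval.symm_one]
    · rintro rfl; exact unitInterval.symm_zero
  have hm : edgeMin y (K.rev d) = edgeMin y d := by
    simp only [edgeMin, tgt, K.rev_rev]; exact min_comm _ _
  unfold edgeCoarse
  simp only [h0, h1, hm, tgt, K.rev_rev]
  by_cases a : t = 0
  · subst a; simp
  · by_cases b : t = 1 <;> simp [a, b]

/-- The coarse distance from the vertex `y` to a point of the complex. -/
noncomputable def coarseDist (y : K.V) : K.Space → ℚ :=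
  Quot.lift (preCoarse y) (by
    intro a b h
    cases h with
    | edge_zero d => simp [preCoarse, edgeCoarse]
    | edge_rev d t => exact (edgeCoarse_rev y d t).symm
    | face_boundary f k t => simp [preCoarse]
    | face_center f k k' t t' => simp [preCoarse]
    | face_side f k r =>
      have := K.bdry_closed f k
      simp only [preCoarse, edgeCoarse, tgt, this]
      simp)

/-- A cellular map taking `n`-cells to `n`-cells, compatible with orientations and attaching
paths. -/
structure CellMap (K : TwoComplex.{u, v, w}) (L : TwoComplex.{u', v', w'}) where
  onV : K.V → L.V
  onD : K.D → L.D
  onF : K.F → L.F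
  map_src : ∀ d, L.src (onD d) = onV (K.src d)
  map_rev : ∀ d, L.rev (onD d) = onD (K.rev d)
  map_bdry : ∀ f, L.bdry (onF f) = (K.bdry f).map onD

/-- Action of a cellular map on points of closed cells. -/
def CellMap.onPre {L : TwoComplex.{u', v', w'}} (m : CellMap K L) : K.PrePoint → L.PrePoint
  | .vert x => .vert (m.onV x)
  | .edge d t => .edge (m.onD d) t
  | .face f k t r => .face (m.onF f) (k.cast (by rw [m.map_bdry]; simp)) t r

/-- The map of spaces induced by a cellular map. -/
def CellMap.onSpace {L : TwoComplex.{u', v', w'}} (m : CellMap K L) : K.Space → L.Space :=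
  Quot.map m.onPre (by
    intro a b h
    cases h with
    | edge_zero d => simp only [onPre, ← m.map_src]; exact .edge_zero _
    | edge_rev d t => simp only [onPre, ← m.map_rev]; exact .edge_rev _ _
    | face_boundary f k t =>
      have e : m.onD ((K.bdry f).get k) =
          (L.bdry (m.onF f)).get (k.cast (by rw [m.map_bdry]; simp)) := by
        simp [m.map_bdry]
      simp only [onPre, e]; exact .face_boundary _ _ _
    | face_center f k k' t t' => exact .face_center _ _ _ _ _
    | face_side f k r =>
      have e : (cyclicNext k).cast (by rw [m.map_bdry]; simp) =
          cyclicNext (k.cast (by rw [m.map_bdry]; simp) : Fin (L.bdry (m.onF f)).length) := by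
        apply Fin.ext; simp [cyclicNext, m.map_bdry]
      simp only [onPre, e]; exact .face_side _ _ _)

/-- A 1-combing of the pair `(K, Z)` at the vertex `y`. -/
structure OneCombing (K : TwoComplex.{u, v, w}) (Z : Set K.Space) (y : K.V) where
  toFun : Z × I → K.Space
  continuous_toFun : Continuous toFun
  map_zero : ∀ p, toFun (p, 0) = K.pt (.vert y)
  map_one : ∀ p, toFun (p, 1) = p
  map_base : ∀ p : Z, (p : K.Space) = K.pt (.vert y) → ∀ t, toFun (p, t) = K.pt (.vert y)
  map_vertex : ∀ p : Z, (p : K.Space) ∈ K.vertexSet → ∀ t, toFun (p, t) ∈ K.oneSkeleton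

/-- `f`-tameness of a family of paths in `K`, with respect to the vertex `y`. -/
def IsTame {Z : Type*} (f : ℚ → ℚ) (y : K.V) (ψ : Z × I → K.Space) : Prop :=
  ∀ (p : Z) (s t : I), s < t → coarseDist y (ψ (p, s)) ≤ f (coarseDist y (ψ (p, t)))

end TwoComplex

/-! ### Generators, words, the Cayley complex -/

/-- A symmetric generating set of `G`: letters `A` with a formal inversion and an evaluation map
`rep` whose image generates `G`; no letter represents the identity. -/
structure SymGens (G : Type u) [Group G] (A : Type v) where
  inv : A → A
  inv_inv : ∀ a, inv (inv a) = a
  rep : A → G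
  rep_inv : ∀ a, rep (inv a) = (rep a)⁻¹
  rep_ne_one : ∀ a, rep a ≠ 1
  generates : Subgroup.closure (Set.range rep) = ⊤

namespace SymGens

variable {G : Type u} [Group G] {A : Type v} (S : SymGens G A)

/-- The element of `G` represented by a word. -/
def val (x : List A) : G := (x.map S.rep).prod

/-- The formal inverse of a word. -/
def invWord (x : List A) : List A := (x.map S.inv).reverse

/-- No letter of the word is followed by its formal inverse. -/
def IsReduced (x : List A) : Prop := x.IsChain (fun a b => b ≠ S.inv a)

/-- `x'` arises from `x` by cancelling one pair of adjacent inverse letters. -/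
def CancelStep (x x' : List A) : Prop :=
  ∃ y z a, x = y ++ a :: S.inv a :: z ∧ x' = y ++ z

/-- `(g, a)` is the directed edge labelled `a` from `g` to `g * rep a` in the Cayley graph; this is
the list of directed edges on the path from `g` labelled by a word. -/
def pathEdges : G → List A → List (G × A)
  | _, [] => []
  | g, a :: x => (g, a) :: pathEdges (g * S.rep a) x

/-- The same edge in the opposite direction. -/
def revEdge (e : G × A) : G × A := (e.1 * S.rep e.2, S.inv e.2)

theorem val_cons (a : A) (x : List A) : S.val (a :: x) = S.rep a * S.val x := by simp [val]

theorem length_pathEdges (g : G) (x : List A) : (S.pathEdges g x).length = x.length := by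
  induction x generalizing g with
  | nil => rfl
  | cons a x ih => simp [pathEdges, ih]

theorem getElem_pathEdges (g : G) (x : List A) (k : ℕ) (hk : k < (S.pathEdges g x).length) :
    (S.pathEdges g x)[k] =
      (g * S.val (x.take k), x[k]'(by rwa [length_pathEdges] at hk)) := by
  induction x generalizing g k with
  | nil => simp [pathEdges] at hk
  | cons a x ih =>
    cases k with
    | zero => simp [pathEdges, val]
    | succ k =>
      simp only [pathEdges, List.getElem_cons_succ, List.take_succ_cons, val_cons]
      rw [ih]; simp [mul_assoc]

theorem pathEdges_closed (g : G) (x : List A) (hx : S.val x = 1)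
    (k : Fin (S.pathEdges g x).length) :
    (S.revEdge ((S.pathEdges g x).get k)).1 = ((S.pathEdges g x).get (cyclicNext k)).1 := by
  obtain ⟨k, hk⟩ := k
  have hk' : k < x.length := by rwa [length_pathEdges] at hk
  have e : g * S.val (x.take k) * S.rep x[k] = g * S.val (x.take (k + 1)) := by
    rw [mul_assoc, List.take_succ_eq_append_getElem hk']
    simp only [val, List.map_append, List.prod_append, List.map_cons, List.map_nil,
      List.prod_singleton]
  simp only [cyclicNext, List.get_eq_getElem, getElem_pathEdges, revEdge, e, length_pathEdges]
  by_cases h : k + 1 = x.length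
  · rw [h, Nat.mod_self, List.take_length, hx]; simp [val]
  · rw [Nat.mod_eq_of_lt (by omega)]

/-- The Cayley 2-complex: its 1-skeleton is the Cayley graph, and there is a 2-cell for each closed
path `(g, r)` that is labelled by a relator `r ∈ R`. -/
def cayley (R : Set (List A)) : TwoComplex.{u, max u v, max u v} where
  V := G
  D := G × A
  F := {c : G × List A // c.2 ∈ R ∧ c.2 ≠ [] ∧ S.val c.2 = 1}
  rev := S.revEdge
  rev_rev e := by simp [revEdge, S.inv_inv, S.rep_inv]
  rev_ne e h := S.rep_ne_one e.2 (by simpa [revEdge] using congrArg Prod.fst h)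
  src e := e.1
  bdry c := S.pathEdges c.1.1 c.1.2
  bdry_ne_nil c h := by
    have := congrArg List.length h
    rw [length_pathEdges] at this
    exact c.2.2.1 (List.eq_nil_of_length_eq_zero this)
  bdry_closed c k := S.pathEdges_closed _ _ c.2.2.2 k

/-- `⟨A | R⟩` is a finite symmetric presentation of `G` (with `a * inv a = 1` understood): `R` is a
finite set of nonempty words, closed under inversion, cyclic conjugation and passage to nonempty
freely reduced representatives. -/
structure IsFinitePresentation (R : Set (List A)) : Prop where
  finite_letters : Finite A
  finite : R.Finite
  nil_notMem : [] ∉ R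
  inv_mem : ∀ r ∈ R, S.invWord r ∈ R
  rotate_mem : ∀ r ∈ R, ∀ n : ℕ, r.rotate n ∈ R
  reduce_mem : ∀ r ∈ R, ∀ r', Relation.ReflTransGen S.CancelStep r r' → S.IsReduced r' →
    r' ≠ [] → r' ∈ R
  presents : (FreeGroup.lift S.rep).ker = Subgroup.normalClosure
    ({x | ∃ r ∈ R, x = (r.map FreeGroup.of).prod} ∪
      {x | ∃ a, x = FreeGroup.of a * FreeGroup.of (S.inv a)})

/-! ### Van Kampen diagrams and tame filling functions -/

/-- `d'` follows `d` in the cyclic list `C`. -/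
def CyclicSucc {D : Type*} (C : List D) (d d' : D) : Prop := [d, d'] <:+: C ++ C.take 1

/-- A van Kampen diagram over `⟨A | R⟩` with boundary word `x`: a finite, planar, contractible
labelled 2-complex. Planarity and contractibility are expressed by requiring that attaching one
further 2-cell along the boundary circuit `outer` yields a cell structure on the sphere: the circuits
`outer` and `bdry f` (each running with its cell on the right, so that `outer` runs counterclockwise
around the diagram) traverse every directed edge exactly once altogether, the directed edges that
leave a vertex form a single cyclic sequence of corners, the complex is connected, and the Euler
characteristic `#V - #D / 2 + #F` is `1`. The component `proj` is the projection to the Cayley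
complex; it is determined by the other data. -/
structure VanKampenDiagram (R : Set (List A)) (x : List A) extends TwoComplex.{0, 0, 0} where
  finite_V : Finite V
  finite_D : Finite D
  finite_F : Finite F
  base : V
  label : D → A
  label_rev : ∀ d, label (rev d) = S.inv (label d)
  label_bdry : ∀ f, (bdry f).map label ∈ R
  outer : List D
  outer_path : toTwoComplex.IsPath base outer base
  label_outer : outer.map label = x
  outer_nodup : outer.Nodup
  bdry_nodup : ∀ f, (bdry f).Nodup
  mem_unique : ∀ d, (d ∈ outer ∧ ∀ f, d ∉ bdry f) ∨ (d ∉ outer ∧ ∃! f, d ∈ bdry f)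
  corners : ∀ d d', src d = src d' → Relation.EqvGen
    (fun d₁ d₂ => CyclicSucc outer (rev d₁) d₂ ∨ ∃ f, CyclicSucc (bdry f) (rev d₁) d₂) d d'
  connected : ∀ y, ∃ L, toTwoComplex.IsPath base L y
  euler : 2 * Nat.card V + 2 * Nat.card F = Nat.card D + 2
  proj : TwoComplex.CellMap toTwoComplex (S.cayley R)
  proj_base : proj.onV base = (1 : G)
  proj_label : ∀ d, (proj.onD d).2 = label d

namespace VanKampenDiagram

variable {S} {R : Set (List A)} {x : List A} (Δ : S.VanKampenDiagram R x)

/-- The boundary of the diagram. -/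
def boundary : Set Δ.Space :=
  {p | p = Δ.pt (.vert Δ.base) ∨ ∃ d ∈ Δ.outer, ∃ t, p = Δ.pt (.edge d t)}

/-- Intrinsic diameter. -/
noncomputable def intDiam : ℕ := sSup {m | ∃ y : Δ.V, m = Δ.dist Δ.base y}

/-- Extrinsic diameter. -/
noncomputable def extDiam : ℕ :=
  sSup {m | ∃ y : Δ.V, m = (S.cayley R).dist (1 : G) (Δ.proj.onV y)}

end VanKampenDiagram

/-- The set `ℕ[1/4]` of quarters of natural numbers, in which coarse distances take values. -/
def quarterNat : Set ℚ := {q | ∃ n : ℕ, q = n / 4}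

/-- `f` is (on `ℕ[1/4]`) an intrinsic tame filling function for `G` over `⟨A | R⟩`. -/
def IsIntrinsicTameFilling (R : Set (List A)) (f : ℚ → ℚ) : Prop :=
  MapsTo f quarterNat quarterNat ∧ MonotoneOn f quarterNat ∧
  ∀ x : List A, S.val x = 1 → ∃ (Δ : S.VanKampenDiagram R x)
    (ψ : TwoComplex.OneCombing Δ.toTwoComplex Δ.boundary Δ.base),
    TwoComplex.IsTame f Δ.base ψ.toFun

/-- `f` is (on `ℕ[1/4]`) an extrinsic tame filling function for `G` over `⟨A | R⟩`. -/
def IsExtrinsicTameFilling (R : Set (List A)) (f : ℚ → ℚ) : Prop :=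
  MapsTo f quarterNat quarterNat ∧ MonotoneOn f quarterNat ∧
  ∀ x : List A, S.val x = 1 → ∃ (Δ : S.VanKampenDiagram R x)
    (ψ : TwoComplex.OneCombing Δ.toTwoComplex Δ.boundary Δ.base),
    TwoComplex.IsTame (K := S.cayley R) f (1 : G) (Δ.proj.onSpace ∘ ψ.toFun)

/-! ### Stackable groups -/

/-- `T` (a set of directed edges) is a maximal tree in the Cayley graph. -/
structure IsMaximalTree (T : Set (G × A)) : Prop where
  rev_mem : ∀ e ∈ T, S.revEdge e ∈ T
  connected : ∀ g, ∃ x, (∀ e ∈ S.pathEdges 1 x, e ∈ T) ∧ S.val x = g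
  acyclic : ∀ g x, S.IsReduced x → (∀ e ∈ S.pathEdges g x, e ∈ T) → S.val x = 1 → x = []

/-- `Φ` is a bounded flow function for the tree `T`; the path `Φ(e)` starts at the initial vertex of
`e` and is given by its label. -/
structure IsBoundedFlow (T : Set (G × A)) (Φ : G × A → List A) : Prop where
  same_ends : ∀ e, e.1 * S.val (Φ e) = e.1 * S.rep e.2
  tree : ∀ e ∈ T, Φ e = [e.2]
  wellFounded : WellFounded (Relation.TransGen
    (fun e' e => e' ∈ S.pathEdges e.1 (Φ e) ∧ e ∉ T ∧ e' ∉ T))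
  bounded : ∃ k : ℕ, ∀ e, (Φ e).length ≤ k

/-- The relators of the presentation associated with `Φ`: the closure of the set of words
`label(Φ(e)) label(e)⁻¹` under inversion, cyclic conjugation and free reduction. -/
inductive FlowRel (Φ : G × A → List A) : List A → Prop
  | basic (e : G × A) : FlowRel Φ (Φ e ++ [S.inv e.2])
  | inv (r : List A) : FlowRel Φ r → FlowRel Φ (S.invWord r)
  | rotate (r : List A) (n : ℕ) : FlowRel Φ r → FlowRel Φ (r.rotate n)
  | reduce (r r' : List A) : FlowRel Φ r → Relation.ReflTransGen S.CancelStep r r' →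
      S.IsReduced r' → r' ≠ [] → FlowRel Φ r'

/-- The relator set of the presentation associated with `Φ`. -/
def flowRelators (Φ : G × A → List A) : Set (List A) := {r | S.FlowRel Φ r}

/-- The length of the longest relator. -/
noncomputable def maxRel (Φ : G × A → List A) : ℕ :=
  sSup {m | ∃ r ∈ S.flowRelators Φ, m = r.length}

/-- The normal form of `g`: the label of the path without backtracking from `1` to `g` in the
tree `T`. -/
noncomputable def nf (T : Set (G × A)) (g : G) : List A :=
  Classical.epsilon fun x => S.IsReduced x ∧ (∀ e ∈ S.pathEdges 1 x, e ∈ T) ∧ S.val x = g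

/-- The word `y_g a y_{ga}⁻¹` of the edge `(g, a)`. -/
noncomputable def edgeWord (T : Set (G × A)) (e : G × A) : List A :=
  S.nf T e.1 ++ [e.2] ++ S.invWord (S.nf T (e.1 * S.rep e.2))

variable (T : Set (G × A)) (Φ : G × A → List A)

/-- A choice, for every directed edge `e`, of a van Kampen diagram with boundary word
`y_g a y_{ga}⁻¹`. -/
abbrev NDiagrams := ∀ e : G × A, S.VanKampenDiagram (S.flowRelators Φ) (S.edgeWord T e)

variable {T Φ}

/-- The diagram of the edge `e` from `g` to `h` is obtained as follows from the diagrams of other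
edges. Write `label(Φ(e)) = x_g⁻¹ z x_h` with `y_g = y_q x_g` and `y_h = y_r x_h`. The diagrams of the
successive edges of the path labelled `z` from `q` to `r` are glued, each one to the next, along the
normal forms of the vertices on that path (their images are `P 0, P 1, …`; if `z` is empty, one starts
from the edge path `P 0` labelled `y_q`). Then one 2-cell `c`, with boundary label `x_g⁻¹ z x_h a⁻¹`,
is attached along `z`; its remaining boundary `x_g`, `a`, `x_h` (`Xg`, `α`, `Xh`) is new. As every
directed edge of a diagram lies on exactly one of the circuits `outer`, `bdry f`, the conditions below
determine the resulting diagram up to isomorphism. -/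
def IsBuiltAt (E : S.NDiagrams T Φ) (e : G × A) : Prop :=
  ∃ yq xg yr xh z : List A,
    S.nf T e.1 = yq ++ xg ∧ S.nf T (e.1 * S.rep e.2) = yr ++ xh ∧
    Φ e = S.invWord xg ++ z ++ xh ∧
    let edg : Fin z.length → G × A := fun i => (S.val yq * S.val (z.take i), z.get i)
    ∃ (ι : ∀ i, TwoComplex.CellMap (E (edg i)).toTwoComplex (E e).toTwoComplex)
      (P : ℕ → List (E e).D) (ζ : Fin z.length → (E e).D)
      (Xg Xh : List (E e).D) (α : (E e).D) (c : (E e).F),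
      (∀ i, (ι i).onV (E (edg i)).base = (E e).base) ∧
      (∀ i d, (E e).label ((ι i).onD d) = (E (edg i)).label d) ∧
      (∀ i ≤ z.length, (P i).map (E e).label = S.nf T (S.val yq * S.val (z.take i))) ∧
      (∀ i, (E (edg i)).outer.map (ι i).onD = P i ++ [ζ i] ++ (E e).revPath (P (i + 1))) ∧
      (E e).outer = P 0 ++ Xg ++ [α] ++ (E e).revPath (P z.length ++ Xh) ∧
      Xg.map (E e).label = xg ∧ Xh.map (E e).label = xh ∧
      (E e).bdry c ~r (E e).revPath Xg ++ List.ofFn ζ ++ Xh ++ [(E e).rev α] ∧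
      (∀ i f, (ι i).onF f ≠ c) ∧
      (∀ f, f ≠ c → ∃! s : (Σ i, (E (edg i)).F), (ι s.1).onF s.2 = f)

/-- The diagrams are built recursively from the flow function: the diagram of an edge of the tree has
no 2-cells (hence is a line segment), that of any other edge is built from those of the edges on its
flow path. -/
def IsRecursivelyBuilt (E : S.NDiagrams T Φ) : Prop :=
  ∀ e, (e ∈ T → IsEmpty (E e).F) ∧ (e ∉ T → S.IsBuiltAt E e)

variable (T Φ)

/-- Path distance from the identity in the Cayley graph. -/
noncomputable def normX (g : G) : ℕ := (S.cayley (S.flowRelators Φ)).dist (1 : G) g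

/-- Lengths of the normal forms of elements of the ball of radius `n`. -/
def nfLengths (n : ℕ) : Set ℕ := {m | ∃ g, S.normX Φ g ≤ n ∧ m = (S.nf T g).length}

/-- Distances from the identity to prefixes of normal forms of elements of the ball. -/
def nfDists (n : ℕ) : Set ℕ :=
  {m | ∃ g x, S.normX Φ g ≤ n ∧ x <+: S.nf T g ∧ m = S.normX Φ (S.val x)}

variable {T Φ}

/-- Intrinsic diameters of the diagrams of the non-tree edges that start in the ball. -/
def intDiams (E : S.NDiagrams T Φ) (n : ℕ) : Set ℕ :=
  {m | ∃ e ∉ T, S.normX Φ e.1 ≤ n ∧ m = (E e).intDiam}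

/-- Extrinsic diameters of the diagrams of the non-tree edges that start in the ball. -/
def extDiams (E : S.NDiagrams T Φ) (n : ℕ) : Set ℕ :=
  {m | ∃ e ∉ T, S.normX Φ e.1 ≤ n ∧ m = (E e).extDiam}

/-- The explicit intrinsic tame filling function. -/
noncomputable def muInt (E : S.NDiagrams T Φ) (n : ℚ) : ℚ :=
  max (max (((sSup (S.nfLengths T Φ (⌈n⌉₊ + 1)) : ℕ) : ℚ) + 1) (n + 1))
    (((sSup (S.intDiams E (⌈n⌉₊ + S.maxRel Φ + 1)) : ℕ) : ℚ) + 1)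

/-- The explicit extrinsic tame filling function. -/
noncomputable def muExt (E : S.NDiagrams T Φ) (n : ℚ) : ℚ :=
  max (max (((sSup (S.nfDists T Φ (⌈n⌉₊ + 1)) : ℕ) : ℚ) + 1) (n + 1))
    (((sSup (S.extDiams E (⌈n⌉₊ + S.maxRel Φ + 1)) : ℕ) : ℚ) + 1)

end SymGens

/-! Replacing an edge outside the tree by its flow path, over and over, leads into the tree after
finitely many steps. This induction is used three times. In the group presented by `flowRelators` it
gives $y_g a = y_{ga}$ for every edge (`evalWord_edge`); so each word equals the normal form of its
value, and the relators, which have bounded length, present $G$. It yields the diagrams $\Delta_e$: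
the diagrams of the edges of $\Phi(e)$ are put in a row, and one 2-cell is attached
(`exists_bricks`). And it combs the edge $e$ inside $\Delta_e$ (`exists_isCombing`): follow the
combing of $\Phi(e)$, then cross the last 2-cell.

Forming quotients of diagrams is avoided. A diagram comes with a history (`Run`) that leads to it
from a segment labelled by a normal form: attach spurs and 2-cells, move a marked vertex down the
spanning tree. To glue $\Delta_e$ to another diagram along a normal form, its history is replayed
there (`Run.simulate`). Planarity and contractibility then have to be checked only for one spur and
one 2-cell (`IsOuter.push`, `IsOuter.cell`).

A word $x$ that represents $1$ is filled by the row of the diagrams $\Delta_e$ along $x$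
(`exists_filling`). At vertices all edge combings are unit speed walks along tree paths, so they fit
together to a 1-combing of the boundary (`exists_oneCombing`).

Tameness rests on the alternative `Precedes`, for $p$ before $p'$ on a combing path. Either both are
on a tree path, and then $p$ lies on the normal form of a vertex close to $p'$. Or $p'$ is interior
to the last 2-cell, or to the edge $e$, of a copy of some $\Delta_e$ that also contains $p$, and
then $p'$ is close to the initial vertex of $e$. If $n$ is the coarse distance of $p'$, the vertex
in question has distance at most $\lceil n\rceil$ from $1$ (`Near.dist_le`), and $p$ is bounded by
the corresponding maximum over the ball of radius $\lceil n\rceil$, plus $\frac12$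
(`Precedes.coarseDist_le`). One argument serves both versions: distances are measured after a
cellular map, which is the identity or the projection to $X$. -/

namespace SymGens

variable {G : Type u} [Group G] {A : Type v} (S : SymGens G A)

/-! ### Words and paths in the Cayley graph -/

@[simp] theorem val_nil : S.val [] = 1 := by simp [val]

@[simp] theorem val_append (x y : List A) : S.val (x ++ y) = S.val x * S.val y := by simp [val]

@[simp] theorem val_singleton (a : A) : S.val [a] = S.rep a := by simp [val]

@[simp] theorem invWord_nil : S.invWord [] = [] := rfl

@[simp] theorem invWord_cons (a : A) (x : List A) :
    S.invWord (a :: x) = S.invWord x ++ [S.inv a] := by simp [invWord]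

@[simp] theorem val_invWord (x : List A) : S.val (S.invWord x) = (S.val x)⁻¹ := by
  induction x with
  | nil => simp
  | cons a x ih => simp [val_cons, ih, S.rep_inv]

theorem pathEdges_append (g : G) (x y : List A) :
    S.pathEdges g (x ++ y) = S.pathEdges g x ++ S.pathEdges (g * S.val x) y := by
  induction x generalizing g with
  | nil => simp [pathEdges]
  | cons a x ih => simp [pathEdges, ih, val_cons, mul_assoc]

theorem mem_pathEdges_get (g : G) (x : List A) (i : Fin x.length) :
    (g * S.val (x.take i), x.get i) ∈ S.pathEdges g x := by
  have hi : i.1 < (S.pathEdges g x).length := by rw [length_pathEdges]; exact i.2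
  have := S.getElem_pathEdges g x i hi
  rw [List.get_eq_getElem, ← this]
  exact List.getElem_mem hi

/-! ### Normal forms -/

variable {S} {T : Set (G × A)}

theorem invWord_edges_mem (hT : S.IsMaximalTree T) (g : G) (x : List A)
    (hx : ∀ e ∈ S.pathEdges g x, e ∈ T) :
    ∀ e ∈ S.pathEdges (g * S.val x) (S.invWord x), e ∈ T := by
  induction x generalizing g with
  | nil => simp [pathEdges]
  | cons a x ih =>
    intro e he
    rw [invWord_cons, pathEdges_append, List.mem_append, val_cons, ← mul_assoc] at he
    rcases he with he | he
    · exact ih _ (fun e he => hx e (by simp [pathEdges, he])) e he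
    · simp only [val_invWord, mul_inv_cancel_right, pathEdges, List.mem_singleton] at he
      rw [he]
      exact hT.rev_mem (g, a) (hx _ (by simp [pathEdges]))

theorem isReduced_invWord {x : List A} (hx : S.IsReduced x) : S.IsReduced (S.invWord x) := by
  unfold IsReduced invWord at *
  rw [List.isChain_reverse, List.isChain_map]
  refine hx.imp fun a b h h' => h ?_
  simp only [S.inv_inv] at h'
  exact h'.symm

/-- Reduce from the right: a new first letter either cancels against the reduced remainder or is
prepended to it. Only edges of the given path survive. -/
theorem exists_reduced (g : G) (x : List A)
    (hx : ∀ e ∈ S.pathEdges g x, e ∈ T) :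
    ∃ y, S.IsReduced y ∧ (∀ e ∈ S.pathEdges g y, e ∈ T) ∧ S.val y = S.val x := by
  induction x generalizing g with
  | nil => exact ⟨[], List.isChain_nil, by simp [pathEdges], rfl⟩
  | cons a x ih =>
    have ha : (g, a) ∈ T := hx _ (by simp [pathEdges])
    obtain ⟨y, hy, hyT, hyv⟩ := ih (g * S.rep a) (fun e he => hx e (by simp [pathEdges, he]))
    by_cases h : ∃ z, y = S.inv a :: z
    · obtain ⟨z, rfl⟩ := h
      refine ⟨z, (List.isChain_cons.1 hy).2, fun e he => hyT e ?_, ?_⟩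
      · simp [pathEdges, S.rep_inv, he]
      · rw [val_cons, ← hyv, val_cons, S.rep_inv]; simp
    · refine ⟨a :: y, List.isChain_cons.2 ⟨?_, hy⟩, ?_, by rw [val_cons, val_cons, hyv]⟩
      · rintro b hb rfl
        cases y with
        | nil => simp at hb
        | cons c z => simp only [List.head?_cons, Option.mem_some_iff] at hb; exact h ⟨z, by rw [hb]⟩
      · intro e he
        simp only [pathEdges, List.mem_cons] at he
        rcases he with rfl | he
        exacts [ha, hyT e he]

/-- Where the two words first differ, the inverse of one remainder followed by the other is a
nonempty reduced closed path in the tree, contrary to acyclicity. -/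
theorem reduced_unique (hT : S.IsMaximalTree T) (g : G) (x y : List A)
    (hx : S.IsReduced x) (hy : S.IsReduced y)
    (hxT : ∀ e ∈ S.pathEdges g x, e ∈ T) (hyT : ∀ e ∈ S.pathEdges g y, e ∈ T)
    (h : S.val x = S.val y) : x = y := by
  induction x generalizing g y with
  | nil => exact (hT.acyclic g y hy hyT (by rw [← h, val_nil])).symm
  | cons a x ih =>
    cases y with
    | nil => exact hT.acyclic g _ hx hxT (by rw [h, val_nil])
    | cons b y =>
      by_cases hab : a = b
      · subst hab
        rw [ih (g * S.rep a) y (List.isChain_cons.1 hx).2 (List.isChain_cons.1 hy).2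
          (fun e he => hxT e (by simp [pathEdges, he])) (fun e he => hyT e (by simp [pathEdges, he]))
          (by simpa [val_cons] using h)]
      · have := hT.acyclic (g * S.val (a :: x)) (S.invWord (a :: x) ++ b :: y) ?_ ?_ ?_
        · simp at this
        · unfold IsReduced
          rw [List.isChain_append]
          refine ⟨isReduced_invWord hx, hy, ?_⟩
          intro c hc d hd hcd
          simp only [invWord_cons, List.getLast?_append, List.getLast?_singleton, Option.some_or,
            Option.mem_some_iff, List.head?_cons] at hc hd
          subst hc hd
          exact hab (by rw [hcd, S.inv_inv])
        · intro e he
          rw [pathEdges_append, List.mem_append] at he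
          rcases he with he | he
          · exact invWord_edges_mem hT g _ hxT e he
          · rw [val_invWord, mul_inv_cancel_right] at he; exact hyT e he
        · rw [val_append, val_invWord, h]; simp

theorem nf_spec (hT : S.IsMaximalTree T) (g : G) :
    S.IsReduced (S.nf T g) ∧ (∀ e ∈ S.pathEdges 1 (S.nf T g), e ∈ T) ∧ S.val (S.nf T g) = g := by
  unfold nf
  apply Classical.epsilon_spec (p := fun x => S.IsReduced x ∧ (∀ e ∈ S.pathEdges 1 x, e ∈ T) ∧
    S.val x = g)
  obtain ⟨x, hx, hv⟩ := hT.connected g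
  obtain ⟨y, h1, h2, h3⟩ := exists_reduced 1 x hx
  exact ⟨y, h1, h2, h3.trans hv⟩

theorem val_nf (hT : S.IsMaximalTree T) (g : G) : S.val (S.nf T g) = g := (nf_spec hT g).2.2

theorem nf_eq (hT : S.IsMaximalTree T) {x : List A} (hx : S.IsReduced x)
    (hxT : ∀ e ∈ S.pathEdges 1 x, e ∈ T) : S.nf T (S.val x) = x :=
  reduced_unique hT 1 _ _ (nf_spec hT _).1 hx (nf_spec hT _).2.1 hxT (val_nf hT _)

theorem nf_one (hT : S.IsMaximalTree T) : S.nf T 1 = [] := by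
  have := nf_eq hT (S := S) (x := []) List.isChain_nil (by simp [pathEdges])
  simpa using this

/-- Normal forms are prefix closed. This is why they can label the paths of a rooted spanning tree
in a diagram. -/
theorem nf_prefix (hT : S.IsMaximalTree T) {g : G} {x : List A} (h : x <+: S.nf T g) :
    S.nf T (S.val x) = x := by
  obtain ⟨y, hy⟩ := h
  obtain ⟨h1, h2, -⟩ := nf_spec hT g
  rw [← hy] at h1 h2
  refine nf_eq hT (List.IsChain.left_of_append h1) fun e he => h2 e ?_
  rw [pathEdges_append]; simp [he]

/-- If $y_g$ ends in the inverse of $a$, deleting that letter gives the normal form of $ga$;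
otherwise $y_g a$ is reduced. -/
theorem nf_edge (hT : S.IsMaximalTree T) {e : G × A} (he : e ∈ T) :
    S.nf T (e.1 * S.rep e.2) = S.nf T e.1 ++ [e.2] ∨
      S.nf T e.1 = S.nf T (e.1 * S.rep e.2) ++ [S.inv e.2] := by
  obtain ⟨g, a⟩ := e
  obtain ⟨h1, h2, h3⟩ := nf_spec hT g
  by_cases h : ∃ L, S.nf T g = L ++ [S.inv a]
  · right
    obtain ⟨L, hL⟩ := h
    have hv : S.val L = g * S.rep a := by
      rw [← h3, hL]; simp [S.rep_inv]
    have := nf_prefix hT (S := S) (g := g) (x := L) ⟨_, hL.symm⟩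
    rw [hv] at this
    simp only [this, hL]
  · left
    have := nf_eq hT (S := S) (x := S.nf T g ++ [a]) ?_ ?_
    · simpa [h3] using this
    · unfold IsReduced
      rw [List.isChain_append]
      refine ⟨h1, List.isChain_singleton _, ?_⟩
      intro c hc d hd hcd
      simp only [List.head?_cons, Option.mem_some_iff] at hd
      subst hd
      rw [Option.mem_def, List.getLast?_eq_some_iff] at hc
      obtain ⟨L, hL⟩ := hc
      exact h ⟨L, by rw [hL, hcd, S.inv_inv]⟩
    · intro e he'
      rw [pathEdges_append, List.mem_append] at he'
      rcases he' with he' | he'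
      · exact h2 e he'
      · simp only [pathEdges, h3, one_mul, List.mem_singleton] at he'
        rw [he']; exact he

/-! ### The relators of a flow function -/

variable {Φ : G × A → List A}

theorem val_flow (hΦ : S.IsBoundedFlow T Φ) (e : G × A) : S.val (Φ e) = S.rep e.2 :=
  mul_left_cancel (hΦ.same_ends e)

theorem flow_ne_nil (hΦ : S.IsBoundedFlow T Φ) (e : G × A) : Φ e ≠ [] := fun h =>
  S.rep_ne_one e.2 (by rw [← val_flow hΦ e, h, val_nil])

theorem CancelStep.val_eq {x x' : List A} (h : S.CancelStep x x') : S.val x' = S.val x := by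
  obtain ⟨y, z, a, rfl, rfl⟩ := h
  simp [val_cons, S.rep_inv]

theorem CancelStep.length_le {x x' : List A} (h : S.CancelStep x x') : x'.length ≤ x.length := by
  obtain ⟨y, z, a, rfl, rfl⟩ := h
  simp only [List.length_append, List.length_cons]; omega

theorem flowRel_val (hΦ : S.IsBoundedFlow T Φ) {r : List A} (h : S.FlowRel Φ r) :
    S.val r = 1 := by
  induction h with
  | basic e => simp [val_flow hΦ, S.rep_inv]
  | inv r _ ih => simp [ih]
  | rotate r n _ ih =>
    have hr : S.val (r.take (n % r.length)) * S.val (r.drop (n % r.length)) = 1 := by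
      rw [← val_append, List.take_append_drop, ih]
    rw [List.rotate_eq_drop_append_take_mod, val_append]
    exact mul_eq_one_comm.1 hr
  | reduce r r' _ hs h1 h2 ih =>
    rw [← ih]
    clear ih h1 h2
    induction hs with
    | refl => rfl
    | tail _ h ih => rw [h.val_eq, ih]

theorem flowRel_ne_nil {r : List A} (h : S.FlowRel Φ r) : r ≠ [] := by
  induction h with
  | basic e => simp
  | inv r _ ih => simpa [invWord] using ih
  | rotate r n _ ih => simpa using ih
  | reduce r r' _ _ _ h _ => exact h

/-- None of the closure operations makes a word longer. Over a finite alphabet this leaves finitely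
many relators. -/
theorem flowRel_length {k : ℕ} (hk : ∀ e, (Φ e).length ≤ k) {r : List A} (h : S.FlowRel Φ r) :
    r.length ≤ k + 1 := by
  induction h with
  | basic e => simpa using hk e
  | inv r _ ih => simpa [invWord] using ih
  | rotate r n _ ih => simpa using ih
  | reduce r r' _ hs h1 h2 ih =>
    refine le_trans ?_ ih
    clear ih h1 h2
    induction hs with
    | refl => rfl
    | tail _ h ih => exact h.length_le.trans ih

theorem finite_words_le [Finite A] (n : ℕ) : {x : List A | x.length ≤ n}.Finite :=
  List.finite_length_le A n

/-- The edges on the flow path of an edge outside the tree form a well-founded relation. -/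
theorem wellFounded_flow (hΦ : S.IsBoundedFlow T Φ) :
    WellFounded (fun e' e => e' ∈ S.pathEdges e.1 (Φ e) ∧ e ∉ T) := by
  -- Tree edges have no predecessors in this relation, so admitting them on flow paths does no harm
  -- to well-foundedness.
  have hacc : ∀ e ∈ T, Acc (fun e' e => e' ∈ S.pathEdges e.1 (Φ e) ∧ e ∉ T) e :=
    fun e he => ⟨_, fun e' h => absurd he h.2⟩
  refine ⟨fun e => ?_⟩
  induction e using hΦ.wellFounded.induction with
  | _ e ih =>
    refine ⟨_, fun e' h => ?_⟩
    by_cases he' : e' ∈ T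
    · exact hacc e' he'
    · exact ih e' (.single ⟨h.1, h.2, he'⟩)

/-- The normal closure of the relators, including the formal inverses. -/
def relatorClosure (S : SymGens G A) (R : Set (List A)) : Subgroup (FreeGroup A) :=
  Subgroup.normalClosure ({x | ∃ r ∈ R, x = (r.map FreeGroup.of).prod} ∪
      {x | ∃ a, x = FreeGroup.of a * FreeGroup.of (S.inv a)})

instance (R : Set (List A)) : (S.relatorClosure R).Normal := Subgroup.normalClosure_normal

/-- The image of a word in the presented group. -/
def evalWord (S : SymGens G A) (R : Set (List A)) (x : List A) :
    FreeGroup A ⧸ S.relatorClosure R := QuotientGroup.mk' _ (x.map FreeGroup.of).prod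

theorem evalWord_append (R : Set (List A)) (x y : List A) :
    S.evalWord R (x ++ y) = S.evalWord R x * S.evalWord R y := by simp [evalWord]

theorem evalWord_cons (R : Set (List A)) (a : A) (x : List A) :
    S.evalWord R (a :: x) = S.evalWord R [a] * S.evalWord R x := by simp [evalWord]

theorem evalWord_inv (R : Set (List A)) (a : A) :
    S.evalWord R [S.inv a] = (S.evalWord R [a])⁻¹ := by
  rw [eq_comm, inv_eq_iff_mul_eq_one, ← evalWord_append]
  simp only [evalWord, QuotientGroup.mk'_apply, QuotientGroup.eq_one_iff]
  exact Subgroup.subset_normalClosure (Or.inr ⟨a, by simp⟩)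

theorem evalWord_rel {R : Set (List A)} {r : List A} (h : r ∈ R) : S.evalWord R r = 1 := by
  simp only [evalWord, QuotientGroup.mk'_apply, QuotientGroup.eq_one_iff]
  exact Subgroup.subset_normalClosure (Or.inl ⟨r, h, rfl⟩)

theorem evalWord_flow (e : G × A) :
    S.evalWord (S.flowRelators Φ) (Φ e) = S.evalWord (S.flowRelators Φ) [e.2] := by
  have := evalWord_rel (S := S) (R := S.flowRelators Φ) (FlowRel.basic e)
  rwa [evalWord_append, evalWord_inv, mul_inv_eq_one] at this

/-- The relations $y_g a = y_{ga}$ telescope along a path. -/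
theorem evalWord_path {R : Set (List A)} (g : G) (x : List A)
    (h : ∀ e ∈ S.pathEdges g x, S.evalWord R (S.nf T e.1 ++ [e.2]) =
      S.evalWord R (S.nf T (e.1 * S.rep e.2))) :
    S.evalWord R (S.nf T g ++ x) = S.evalWord R (S.nf T (g * S.val x)) := by
  induction x generalizing g with
  | nil => simp
  | cons a x ih =>
    have h1 := h (g, a) (by simp [pathEdges])
    have h2 := ih (g * S.rep a) (fun e he => h e (by simp [pathEdges, he]))
    rw [evalWord_append, evalWord_cons, ← mul_assoc, ← evalWord_append, h1, ← evalWord_append, h2,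
      val_cons, mul_assoc]

/-- For a tree edge this is free cancellation. For any other edge the relator of $e$ replaces $a$ by
the label of $\Phi(e)$, and the induction hypothesis is telescoped along that path. -/
theorem evalWord_edge (hT : S.IsMaximalTree T) (hΦ : S.IsBoundedFlow T Φ) (e : G × A) :
    S.evalWord (S.flowRelators Φ) (S.nf T e.1 ++ [e.2]) =
      S.evalWord (S.flowRelators Φ) (S.nf T (e.1 * S.rep e.2)) := by
  induction e using (wellFounded_flow hΦ).induction with
  | _ e ih =>
    by_cases he : e ∈ T
    · rcases nf_edge hT he with h | h
      · rw [h]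
      · rw [h, evalWord_append, evalWord_append, evalWord_inv, inv_mul_cancel_right]
    · have := evalWord_path (R := S.flowRelators Φ) (T := T) e.1 (Φ e) (fun e' h => ih e' ⟨h, he⟩)
      rwa [evalWord_append, evalWord_flow, ← evalWord_append, val_flow hΦ] at this

/-- Words over $A$ suffice, as the relators `a * inv a` turn the inverse of a generator into a
letter. -/
theorem exists_evalWord (R : Set (List A)) (x : FreeGroup A) :
    ∃ y, (QuotientGroup.mk' (S.relatorClosure R)) x = S.evalWord R y := by
  induction x using FreeGroup.induction_on with
  | C1 => exact ⟨[], by simp [evalWord]⟩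
  | of a => exact ⟨[a], by simp [evalWord]⟩
  | inv_of a _ => exact ⟨[S.inv a], by rw [evalWord_inv]; simp [evalWord]⟩
  | mul x y hx hy =>
    obtain ⟨x', hx⟩ := hx
    obtain ⟨y', hy⟩ := hy
    exact ⟨x' ++ y', by rw [map_mul, hx, hy, evalWord_append]⟩

theorem lift_word (x : List A) : FreeGroup.lift S.rep ((x.map FreeGroup.of).prod) = S.val x := by
  induction x with
  | nil => simp
  | cons a x ih => rw [List.map_cons, List.prod_cons, map_mul, ih, val_cons]; simp

theorem relatorClosure_le (hΦ : S.IsBoundedFlow T Φ) :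
    S.relatorClosure (S.flowRelators Φ) ≤ (FreeGroup.lift S.rep).ker := by
  refine Subgroup.normalClosure_le_normal ?_
  rintro x (⟨r, hr, rfl⟩ | ⟨a, rfl⟩)
  · exact (lift_word r).trans (flowRel_val hΦ hr)
  · simp [MonoidHom.mem_ker, S.rep_inv]

theorem isFinitePresentation [Finite A] (hT : S.IsMaximalTree T) (hΦ : S.IsBoundedFlow T Φ) :
    S.IsFinitePresentation (S.flowRelators Φ) where
  finite_letters := inferInstance
  finite := by
    obtain ⟨k, hk⟩ := hΦ.bounded
    exact (finite_words_le (k + 1)).subset fun r hr => flowRel_length hk hr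
  nil_notMem h := flowRel_ne_nil h rfl
  inv_mem r h := .inv r h
  rotate_mem r h n := .rotate r n h
  reduce_mem r h r' h1 h2 h3 := .reduce r r' h h1 h2 h3
  presents := by
    refine le_antisymm (fun x hx => ?_) (relatorClosure_le hΦ)
    obtain ⟨y, hy⟩ := exists_evalWord (S := S) (S.flowRelators Φ) x
    have h1 : FreeGroup.lift S.rep x = S.val y := by
      have : x⁻¹ * (y.map FreeGroup.of).prod ∈ S.relatorClosure (S.flowRelators Φ) :=
        QuotientGroup.eq.1 hy
      have := relatorClosure_le hΦ this
      rw [MonoidHom.mem_ker, map_mul, map_inv, lift_word, inv_mul_eq_one] at this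
      exact this
    -- Along $y$ the empty normal form of $1$ is carried to the normal form of the value of $y$,
    -- which is again $1$.
    have h2 := evalWord_path (R := S.flowRelators Φ) (T := T) (1 : G) y
      (fun e _ => evalWord_edge hT hΦ e)
    rw [MonoidHom.mem_ker] at hx
    rw [one_mul, ← h1, hx, nf_one hT, List.nil_append, ← hy] at h2
    exact (QuotientGroup.eq_one_iff x).1 (h2.trans (map_one (QuotientGroup.mk' _)))

end SymGens

/-! ### Adjacent pairs in cyclic lists -/

theorem List.pair_infix_append {D : Type*} {x y : D} {L M : List D} :
    [x, y] <:+: L ++ M ↔ [x, y] <:+: L ∨ [x, y] <:+: M ∨ L.getLast? = some x ∧ M.head? = some y := by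
  induction L with
  | nil => simp
  | cons a L ih =>
    rw [List.cons_append, List.infix_cons_iff, ih, List.infix_cons_iff]
    cases L with
    | nil =>
      cases M with
      | nil => simp
      | cons b M => simp [List.cons_prefix_cons]; tauto
    | cons c L => simp [List.cons_prefix_cons]; tauto

namespace SymGens

theorem cyclicSucc_iff {D : Type*} {C : List D} {x y : D} :
    CyclicSucc C x y ↔ [x, y] <:+: C ∨ C.getLast? = some x ∧ C.head? = some y := by
  unfold CyclicSucc
  rw [List.pair_infix_append]
  cases C with
  | nil => simp
  | cons c C =>
    have : ¬ [x, y] <:+: [c] := fun h => by simpa using h.length_le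
    simp [this]

theorem cyclicSucc_get {D : Type*} {C : List D} (k : Fin C.length) :
    CyclicSucc C (C.get k) (C.get (cyclicNext k)) := by
  rw [cyclicSucc_iff]
  obtain ⟨k, hk⟩ := k
  simp only [cyclicNext, List.get_eq_getElem]
  by_cases h : k + 1 = C.length
  · right
    refine ⟨?_, ?_⟩
    · rw [List.getLast?_eq_getElem?, (by omega : C.length - 1 = k)]; simp
    · rw [List.head?_eq_getElem?]
      simp only [h, Nat.mod_self]
      rw [List.getElem?_eq_getElem]
  · left
    refine ⟨C.take k, C.drop (k + 2), ?_⟩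
    have h2 : (k + 1) % C.length = k + 1 := Nat.mod_eq_of_lt (by omega)
    simp only [h2]
    have h3 : C.drop k = C[k] :: C[k + 1] :: C.drop (k + 2) := by
      rw [List.drop_eq_getElem_cons hk, List.drop_eq_getElem_cons (by omega : k + 1 < C.length)]
    conv_rhs => rw [← List.take_append_drop k C, h3]
    simp

theorem CyclicSucc.map {D D' : Type*} {C : List D} {x y : D} (j : D → D') (h : CyclicSucc C x y) :
    CyclicSucc (C.map j) (j x) (j y) := by
  obtain ⟨s, t, h⟩ := h
  exact ⟨s.map j, t.map j, by simpa using congrArg (List.map j) h⟩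

end SymGens

namespace TwoComplex

/-! ### Edge paths -/

section Paths

variable {K : TwoComplex.{u, v, w}} {L : TwoComplex.{u', v', w'}}

theorem isPath_append {x y : K.V} {P Q : List K.D} :
    K.IsPath x (P ++ Q) y ↔ ∃ z, K.IsPath x P z ∧ K.IsPath z Q y := by
  induction P generalizing x with
  | nil => simp [IsPath]
  | cons d P ih => simp [IsPath, ih, and_assoc]

theorem tgt_rev (d : K.D) : K.tgt (K.rev d) = K.src d := by simp [tgt, K.rev_rev]

theorem isPath_singleton {x y : K.V} {d : K.D} :
    K.IsPath x [d] y ↔ K.src d = x ∧ K.tgt d = y := by simp [IsPath]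

@[simp] theorem revPath_append (P Q : List K.D) :
    K.revPath (P ++ Q) = K.revPath Q ++ K.revPath P := by simp [revPath]

@[simp] theorem revPath_nil : K.revPath [] = [] := rfl

@[simp] theorem revPath_singleton (d : K.D) : K.revPath [d] = [K.rev d] := rfl

theorem IsPath.rev {x y : K.V} {P : List K.D} (h : K.IsPath x P y) : K.IsPath y (K.revPath P) x := by
  induction P generalizing x with
  | nil => exact h.symm
  | cons d P ih =>
    rw [← List.singleton_append, revPath_append, isPath_append]
    exact ⟨_, ih h.2, by rw [revPath_singleton, isPath_singleton, tgt_rev]; exact ⟨rfl, h.1⟩⟩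

theorem IsPath.unique {x y z : K.V} {P : List K.D} (h : K.IsPath x P y) (h' : K.IsPath x P z) :
    y = z := by
  induction P generalizing x with
  | nil => exact h.symm.trans h'
  | cons d P ih => exact ih h.2 h'.2

theorem CellMap.map_tgt (m : CellMap K L) (d : K.D) : L.tgt (m.onD d) = m.onV (K.tgt d) := by
  rw [tgt, m.map_rev, m.map_src]; rfl

theorem IsPath.map {x y : K.V} {P : List K.D} (m : CellMap K L) (h : K.IsPath x P y) :
    L.IsPath (m.onV x) (P.map m.onD) (m.onV y) := by
  induction P generalizing x with
  | nil => exact congrArg m.onV h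
  | cons d P ih =>
    refine ⟨by rw [m.map_src, h.1], ?_⟩
    rw [m.map_tgt]; exact ih h.2

theorem CellMap.map_revPath (m : CellMap K L) (P : List K.D) :
    L.revPath (P.map m.onD) = (K.revPath P).map m.onD := by
  simp [revPath, m.map_rev]

theorem IsPath.pair {x y : K.V} {P : List K.D} (h : K.IsPath x P y) {d d' : K.D}
    (hd : [d, d'] <:+: P) : K.tgt d = K.src d' := by
  obtain ⟨s, t, rfl⟩ := hd
  obtain ⟨z, h1, -⟩ := isPath_append.1 h
  obtain ⟨z', -, h2⟩ := isPath_append.1 h1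
  exact h2.2.1.symm

theorem IsPath.cyclicSucc {x : K.V} {P : List K.D} (h : K.IsPath x P x) {d d' : K.D}
    (hd : SymGens.CyclicSucc P d d') : K.tgt d = K.src d' := by
  cases P with
  | nil => simp [SymGens.CyclicSucc] at hd
  | cons e P =>
    refine IsPath.pair (x := x) (y := K.tgt e) (P := (e :: P) ++ [e]) ?_ hd
    exact isPath_append.2 ⟨x, h, h.1, rfl⟩

theorem isPath_of_chain (d : K.D) (P : List K.D)
    (h : ∀ d₁ d₂, [d₁, d₂] <:+: d :: P → K.tgt d₁ = K.src d₂) :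
    K.IsPath (K.src d) (d :: P) (K.tgt ((d :: P).getLast (by simp))) := by
  induction P generalizing d with
  | nil => exact ⟨rfl, rfl⟩
  | cons e P ih =>
    refine ⟨rfl, ?_⟩
    rw [h d e ⟨[], P, rfl⟩, List.getLast_cons (by simp)]
    exact ih e fun d₁ d₂ hd => h d₁ d₂ (List.infix_cons hd)

theorem isPath_bdry (f : K.F) : ∃ x, K.IsPath x (K.bdry f) x := by
  have hne := K.bdry_ne_nil f
  have hc := K.bdry_closed f
  revert hc hne
  generalize K.bdry f = P
  intro hne hc
  cases P with
  | nil => exact absurd rfl hne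
  | cons d P =>
    refine ⟨K.src d, ?_⟩
    have h1 := isPath_of_chain (K := K) d P ?_
    · convert h1
      have := hc ⟨P.length, by simp⟩
      simp only [cyclicNext, List.get_eq_getElem, List.length_cons, Nat.mod_self,
        List.getElem_cons_zero] at this
      rw [← this, List.getLast_eq_getElem]
      rfl
    · rintro d₁ d₂ ⟨s, t, hst⟩
      have hl : s.length + 1 < (d :: P).length := by rw [← hst]; simp
      have := hc ⟨s.length, by omega⟩
      simp only [cyclicNext, List.get_eq_getElem, Nat.mod_eq_of_lt hl] at this
      simp only [← hst] at this
      show K.src (K.rev d₁) = _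
      simpa using this

/-- The identity map. -/
def CellMap.id (K : TwoComplex.{u, v, w}) : CellMap K K where
  onV x := x
  onD d := d
  onF f := f
  map_src _ := rfl
  map_rev _ := rfl
  map_bdry f := by simp

end Paths

/-! ### Attaching an edge or a 2-cell -/

/-- Attach an edge with ends `s` and `t`, after changing the vertex set along `i`. -/
abbrev addEdge (K : TwoComplex.{u, v, w}) {V' : Type u} (i : K.V → V') (s t : V') :
    TwoComplex.{u, v, w} where
  V := V'
  D := K.D ⊕ Bool
  F := K.F
  rev := Sum.map K.rev not
  rev_rev d := by cases d <;> simp [K.rev_rev]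
  rev_ne d := by cases d <;> simp [K.rev_ne]
  src := Sum.elim (fun d => i (K.src d)) (fun b => if b then t else s)
  bdry f := (K.bdry f).map Sum.inl
  bdry_ne_nil f := by simpa using K.bdry_ne_nil f
  bdry_closed f k := by
    have := K.bdry_closed f (k.cast (by simp))
    simp only [List.get_eq_getElem, cyclicNext, List.length_map, List.getElem_map, Sum.map_inl,
      Sum.elim_inl] at this ⊢
    exact congrArg i this

/-- The inclusion into the complex with an edge attached. -/
def inAddEdge (K : TwoComplex.{u, v, w}) {V' : Type u} (i : K.V → V') (s t : V') :
    CellMap K (K.addEdge i s t) where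
  onV := i
  onD := Sum.inl
  onF f := f
  map_src _ := rfl
  map_rev _ := rfl
  map_bdry _ := rfl

/-- Attach a 2-cell along a closed path. -/
abbrev addFace (K : TwoComplex.{u, v, w}) (P : List K.D) (hne : P ≠ []) {x : K.V}
    (hP : K.IsPath x P x) : TwoComplex.{u, v, w} where
  V := K.V
  D := K.D
  F := Option K.F
  rev := K.rev
  rev_rev := K.rev_rev
  rev_ne := K.rev_ne
  src := K.src
  bdry o := o.elim P K.bdry
  bdry_ne_nil o := by
    cases o
    exacts [hne, K.bdry_ne_nil _]
  bdry_closed o k := by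
    cases o
    · exact hP.cyclicSucc (SymGens.cyclicSucc_get k)
    · exact K.bdry_closed _ k

/-- The inclusion into the complex with a 2-cell attached. -/
def inAddFace (K : TwoComplex.{u, v, w}) (P : List K.D) (hne : P ≠ []) {x : K.V}
    (hP : K.IsPath x P x) : CellMap K (K.addFace P hne hP) where
  onV x := x
  onD d := d
  onF := some
  map_src _ := rfl
  map_rev _ := rfl
  map_bdry f := (List.map_id' (K.bdry f)).symm

end TwoComplex

/-! ### Labelled diagrams with a spanning tree of normal forms -/

namespace SymGens

variable {G : Type u} [Group G] {A : Type v}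

/-- A finite connected labelled 2-complex over the Cayley complex, with a spanning tree in which the
path `tp x` from the base vertex to `x` is labelled by a normal form. -/
structure Dgm (S : SymGens G A) (R : Set (List A)) (T : Set (G × A)) extends
    TwoComplex.{0, 0, 0} where
  finite_V : Finite V
  finite_D : Finite D
  finite_F : Finite F
  base : V
  label : D → A
  label_rev : ∀ d, label (rev d) = S.inv (label d)
  label_bdry : ∀ f, (bdry f).map label ∈ R
  pr : V → G
  pr_base : pr base = 1
  pr_tgt : ∀ d, pr (toTwoComplex.tgt d) = pr (src d) * S.rep (label d)
  tp : V → List D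
  tp_path : ∀ x, toTwoComplex.IsPath base (tp x) x
  tp_label : ∀ x, (tp x).map label = S.nf T (pr x)
  tp_concat : ∀ x L d, tp x = L ++ [d] → tp (src d) = L

/-- `outer` is a boundary circuit that turns the complex into a planar, contractible one. -/
structure Dgm.IsOuter {S : SymGens G A} {R : Set (List A)} {T : Set (G × A)} (Δ : S.Dgm R T)
    (outer : List Δ.D) : Prop where
  path : Δ.IsPath Δ.base outer Δ.base
  ne_nil : Δ.D → outer ≠ []
  nodup : outer.Nodup
  bdry_nodup : ∀ f, (Δ.bdry f).Nodup
  mem_unique : ∀ d, (d ∈ outer ∧ ∀ f, d ∉ Δ.bdry f) ∨ (d ∉ outer ∧ ∃! f, d ∈ Δ.bdry f)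
  corners : ∀ d d', Δ.src d = Δ.src d' → Relation.EqvGen
    (fun d₁ d₂ => CyclicSucc outer (Δ.rev d₁) d₂ ∨ ∃ f, CyclicSucc (Δ.bdry f) (Δ.rev d₁) d₂) d d'
  euler : 2 * Nat.card Δ.V + 2 * Nat.card Δ.F = Nat.card Δ.D + 2

namespace Dgm

variable {S : SymGens G A} {R : Set (List A)} {T : Set (G × A)} (Δ : S.Dgm R T)

theorem path_label {x y : Δ.V} {P : List Δ.D} (h : Δ.IsPath x P y) :
    S.pathEdges (Δ.pr x) (P.map Δ.label) = P.map (fun d => (Δ.pr (Δ.src d), Δ.label d)) ∧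
      Δ.pr y = Δ.pr x * S.val (P.map Δ.label) := by
  induction P generalizing x with
  | nil => obtain rfl : x = y := h; simp [pathEdges]
  | cons d P ih =>
    obtain ⟨rfl, h⟩ := h
    obtain ⟨h1, h2⟩ := ih h
    rw [Δ.pr_tgt] at h1 h2
    simp [pathEdges, h1, h2, val_cons, mul_assoc]

/-- The projection to the Cayley complex. -/
def proj : TwoComplex.CellMap Δ.toTwoComplex (S.cayley R) where
  onV := Δ.pr
  onD d := (Δ.pr (Δ.src d), Δ.label d)
  onF f := ⟨(Δ.pr (Δ.src ((Δ.bdry f).head (Δ.bdry_ne_nil f))), (Δ.bdry f).map Δ.label),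
    Δ.label_bdry f, by simpa using Δ.bdry_ne_nil f, by
      obtain ⟨x, hx⟩ := TwoComplex.isPath_bdry f
      simpa using (Δ.path_label hx).2⟩
  map_src _ := rfl
  map_rev d := by
    show S.revEdge _ = _
    simp only [revEdge, Δ.label_rev, ← Δ.pr_tgt]; rfl
  map_bdry f := by
    obtain ⟨x, hx⟩ := TwoComplex.isPath_bdry f
    have h := (Δ.path_label hx).1
    show S.pathEdges _ _ = _
    have : Δ.src ((Δ.bdry f).head (Δ.bdry_ne_nil f)) = x := by
      revert hx
      generalize_proofs h1
      revert h1
      cases Δ.bdry f with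
      | nil => simp
      | cons d P => exact fun _ h => h.1
    rw [this]
    exact h

/-- The van Kampen diagram given by a boundary circuit. -/
def toVanKampen {outer : List Δ.D} (h : Δ.IsOuter outer) {x : List A}
    (hx : outer.map Δ.label = x) : S.VanKampenDiagram R x where
  toTwoComplex := Δ.toTwoComplex
  finite_V := Δ.finite_V
  finite_D := Δ.finite_D
  finite_F := Δ.finite_F
  base := Δ.base
  label := Δ.label
  label_rev := Δ.label_rev
  label_bdry := Δ.label_bdry
  outer := outer
  outer_path := h.path
  label_outer := hx
  outer_nodup := h.nodup
  bdry_nodup := h.bdry_nodup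
  mem_unique := h.mem_unique
  corners := h.corners
  connected y := ⟨_, Δ.tp_path y⟩
  euler := h.euler
  proj := Δ.proj
  proj_base := Δ.pr_base
  proj_label _ := rfl

end Dgm

/-- A cellular map that preserves base vertices, labels and tree paths. -/
structure LMap {S : SymGens G A} {R : Set (List A)} {T : Set (G × A)} (Δ Δ' : S.Dgm R T) extends
    TwoComplex.CellMap Δ.toTwoComplex Δ'.toTwoComplex where
  map_base : onV Δ.base = Δ'.base
  map_label : ∀ d, Δ'.label (onD d) = Δ.label d
  map_tp : ∀ x, Δ'.tp (onV x) = (Δ.tp x).map onD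

namespace LMap

variable {S : SymGens G A} {R : Set (List A)} {T : Set (G × A)} {Δ Δ' Δ'' : S.Dgm R T}

/-- The identity. -/
def id (Δ : S.Dgm R T) : LMap Δ Δ where
  toCellMap := TwoComplex.CellMap.id _
  map_base := rfl
  map_label _ := rfl
  map_tp _ := by simp [TwoComplex.CellMap.id]

/-- Composition. -/
def comp (g : LMap Δ' Δ'') (f : LMap Δ Δ') : LMap Δ Δ'' where
  onV x := g.onV (f.onV x)
  onD d := g.onD (f.onD d)
  onF c := g.onF (f.onF c)
  map_src d := by rw [g.map_src, f.map_src]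
  map_rev d := by rw [g.map_rev, f.map_rev]
  map_bdry c := by rw [g.map_bdry, f.map_bdry]; simp
  map_base := by rw [f.map_base, g.map_base]
  map_label d := by rw [g.map_label, f.map_label]
  map_tp x := by rw [g.map_tp, f.map_tp]; simp

theorem comp_assoc {Δ''' : S.Dgm R T} (h : LMap Δ'' Δ''') (g : LMap Δ' Δ'') (f : LMap Δ Δ') :
    h.comp (g.comp f) = (h.comp g).comp f := rfl

/-- The group element at a vertex is the value of the label of its tree path, and such maps preserve
tree paths and labels. -/
theorem map_pr (f : LMap Δ Δ') (x : Δ.V) : Δ'.pr (f.onV x) = Δ.pr x := by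
  have h1 := (Δ'.path_label (Δ'.tp_path (f.onV x))).2
  have h2 := (Δ.path_label (Δ.tp_path x)).2
  rw [h1, h2, Δ.pr_base, Δ'.pr_base, f.map_tp]
  simp [Function.comp_def, f.map_label]

end LMap

end SymGens

namespace SymGens

/-- Permits cutting the boundary circuit open at the vertex where something is attached. -/
theorem cyclicSucc_append_comm {D : Type*} {L M : List D} {x y : D} :
    CyclicSucc (L ++ M) x y ↔ CyclicSucc (M ++ L) x y := by
  rcases L.eq_nil_or_concat with rfl | ⟨L, l, rfl⟩
  · simp
  rcases M.eq_nil_or_concat with rfl | ⟨M, m, rfl⟩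
  · simp
  simp only [cyclicSucc_iff, List.pair_infix_append, List.concat_eq_append]
  simp only [List.getLast?_append, List.head?_append]
  simp
  tauto

theorem eqvGen_map {α β : Type*} {r : α → α → Prop} {r' : β → β → Prop} (j : α → β)
    (h : ∀ a b, r a b → Relation.EqvGen r' (j a) (j b)) {a b : α} (hab : Relation.EqvGen r a b) :
    Relation.EqvGen r' (j a) (j b) := by
  induction hab with
  | rel a b hr => exact h a b hr
  | refl a => exact .refl _
  | symm a b _ ih => exact .symm _ _ ih
  | trans a b c _ _ ih ih' => exact .trans _ _ _ ih ih'

variable {G : Type u} [Group G] {A : Type v} {S : SymGens G A} {R : Set (List A)} {T : Set (G × A)}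

namespace Dgm

variable (Δ : S.Dgm R T)

theorem tp_spec {x : Δ.V} {L : List Δ.D} {d : Δ.D} (h : Δ.tp x = L ++ [d]) :
    Δ.tp (Δ.src d) = L ∧ Δ.tgt d = x := by
  refine ⟨Δ.tp_concat x L d h, ?_⟩
  have := Δ.tp_path x
  rw [h, TwoComplex.isPath_append] at this
  obtain ⟨z, -, h2⟩ := this
  exact h2.2

theorem tp_base (hT : S.IsMaximalTree T) : Δ.tp Δ.base = [] := by
  have := Δ.tp_label Δ.base
  rw [Δ.pr_base, nf_one hT] at this
  simpa using this

theorem isPath_inl {V' : Type} (i : Δ.V → V') (s t : V') {x y : Δ.V} {P : List Δ.D}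
    (h : Δ.IsPath x P y) : (Δ.addEdge i s t).IsPath (i x) (P.map Sum.inl) (i y) :=
  h.map (Δ.inAddEdge i s t)

/-! ### Attaching a spur -/

/-- Attach an edge labelled `a` with a new end vertex to the vertex `x`. -/
abbrev push (x : Δ.V) (a : A) (h : S.nf T (Δ.pr x * S.rep a) = S.nf T (Δ.pr x) ++ [a]) :
    S.Dgm R T where
  toTwoComplex := Δ.addEdge (V' := Option Δ.V) some (some x) none
  finite_V := by have := Δ.finite_V; exact inferInstanceAs (Finite (Option Δ.V))
  finite_D := by have := Δ.finite_D; exact inferInstanceAs (Finite (Δ.D ⊕ Bool))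
  finite_F := Δ.finite_F
  base := some Δ.base
  label := Sum.elim Δ.label (fun b => if b then S.inv a else a)
  label_rev d := by
    rcases d with d | _ | _
    · exact Δ.label_rev d
    · rfl
    · exact (S.inv_inv a).symm
  label_bdry f := by
    show ((Δ.bdry f).map Sum.inl).map _ ∈ R
    rw [List.map_map]
    exact Δ.label_bdry f
  pr o := o.elim (Δ.pr x * S.rep a) Δ.pr
  pr_base := Δ.pr_base
  pr_tgt d := by
    rcases d with d | _ | _
    · exact Δ.pr_tgt d
    · rfl
    · show Δ.pr x = Δ.pr x * S.rep a * S.rep (S.inv a)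
      simp [S.rep_inv]
  tp o := o.elim ((Δ.tp x).map Sum.inl ++ [Sum.inr false]) (fun y => (Δ.tp y).map Sum.inl)
  tp_path o := by
    cases o with
    | none =>
      refine TwoComplex.isPath_append.2 ⟨some x, Δ.isPath_inl _ _ _ (Δ.tp_path x), rfl, rfl⟩
    | some y => exact Δ.isPath_inl _ _ _ (Δ.tp_path y)
  tp_label o := by
    cases o with
    | none =>
      simp only [Option.elim_none, List.map_append, List.map_map, h, ← Δ.tp_label]
      rfl
    | some y =>
      simp only [Option.elim_some, List.map_map, ← Δ.tp_label]
      rfl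
  tp_concat o L d hd := by
    cases o with
    | none =>
      obtain ⟨h1, h2⟩ := List.append_inj' hd rfl
      obtain rfl : Sum.inr false = d := by simpa using h2
      exact h1
    | some y =>
      obtain ⟨L', M', h1, rfl, h2⟩ := List.map_eq_append_iff.1 hd
      obtain ⟨d', rfl, rfl⟩ := List.map_eq_singleton_iff.1 h2
      simpa using congrArg (List.map Sum.inl) (Δ.tp_concat y _ _ h1)

/-- The inclusion into the complex with a spur. -/
def inPush (x : Δ.V) (a : A) (h) : LMap Δ (Δ.push x a h) where
  toCellMap := Δ.inAddEdge some (some x) none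
  map_base := rfl
  map_label _ := rfl
  map_tp _ := rfl

variable {Δ}

/-- Extension of a map over a spur. -/
def pushMap {x : Δ.V} {a : A} (h) {K : S.Dgm R T} (f : LMap Δ K) (y : K.V) (d : K.D)
    (hy : K.tp y = K.tp (f.onV x) ++ [d]) (hd : K.label d = a) : LMap (Δ.push x a h) K where
  onV o := o.elim y f.onV
  onD := Sum.elim f.onD (fun b => if b then K.rev d else d)
  onF := f.onF
  map_src e := by
    rcases e with e | _ | _
    · exact f.map_src e
    · show K.src d = f.onV x
      have h1 := K.tp_path (K.src d)
      rw [(K.tp_spec hy).1] at h1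
      exact h1.unique (K.tp_path _)
    · exact (K.tp_spec hy).2
  map_rev e := by
    rcases e with e | _ | _
    · exact f.map_rev e
    · rfl
    · exact K.rev_rev d
  map_bdry c := by
    rw [f.map_bdry]
    show _ = ((Δ.bdry c).map Sum.inl).map _
    simp [Function.comp_def]
  map_base := f.map_base
  map_label e := by
    rcases e with e | _ | _
    · exact f.map_label e
    · exact hd
    · exact (K.label_rev d).trans (congrArg S.inv hd)
  map_tp o := by
    cases o with
    | none =>
      show K.tp y = ((Δ.tp x).map Sum.inl ++ [Sum.inr false]).map _
      rw [hy, f.map_tp]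
      simp [Function.comp_def]
    | some z =>
      show K.tp _ = ((Δ.tp z).map Sum.inl).map _
      simp [Function.comp_def, f.map_tp]

/-- The circuit runs out along the spur and back. The new edge divides one corner at $x$ into two,
its far end has only one outgoing edge, and one more vertex balances two more directed edges in the
Euler relation. -/
theorem IsOuter.push {x : Δ.V} {a : A} (h) {X Y : List Δ.D} (ho : Δ.IsOuter (X ++ Y))
    (hX : Δ.IsPath Δ.base X x) :
    (Δ.push x a h).IsOuter (X.map Sum.inl ++ [Sum.inr false, Sum.inr true] ++ Y.map Sum.inl) where
  path := by
    obtain ⟨z, h1, h2⟩ := TwoComplex.isPath_append.1 ho.path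
    obtain rfl := hX.unique h1
    exact TwoComplex.isPath_append.2 ⟨some x, TwoComplex.isPath_append.2
      ⟨some x, Δ.isPath_inl _ _ _ h1, rfl, rfl, rfl⟩, Δ.isPath_inl _ _ _ h2⟩
  ne_nil _ := by simp
  nodup := by
    have h1 := ho.nodup.map (Sum.inl_injective (β := Bool))
    have h2 : (X.map (Sum.inl (β := Bool)) ++ [Sum.inr false, Sum.inr true] ++
        Y.map Sum.inl).Perm ([Sum.inr false, Sum.inr true] ++ (X ++ Y).map Sum.inl) := by
      rw [List.map_append, ← List.append_assoc]
      exact List.perm_append_comm.append_right _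
    refine h2.nodup_iff.2 ?_
    rw [List.nodup_append']
    exact ⟨by simp, h1, by simp [List.Disjoint]⟩
  bdry_nodup f := (ho.bdry_nodup f).map Sum.inl_injective
  mem_unique d := by
    have hb : ∀ (f : Δ.F) (d : Δ.D), (Sum.inl d : Δ.D ⊕ Bool) ∈ (Δ.push x a h).bdry f ↔
        d ∈ Δ.bdry f := fun f d => List.mem_map_of_injective Sum.inl_injective
    have hb' : ∀ (f : Δ.F) (b : Bool), (Sum.inr b : Δ.D ⊕ Bool) ∉ (Δ.push x a h).bdry f := by
      intro f b hf
      obtain ⟨_, -, h⟩ := List.mem_map.1 hf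
      cases h
    rcases d with d | b
    · rcases ho.mem_unique d with ⟨h1, h2⟩ | ⟨h1, f, h2, h3⟩
      · exact Or.inl ⟨by simpa using h1, fun f hf => h2 f ((hb f d).1 hf)⟩
      · exact Or.inr ⟨by simpa using h1, f, (hb f d).2 h2, fun f' hf => h3 f' ((hb f' d).1 hf)⟩
    · exact Or.inl ⟨by cases b <;> simp, fun f => hb' f b⟩
  corners := by
    set r' := fun d₁ d₂ : (Δ.push x a h).D => CyclicSucc (X.map Sum.inl ++
      [Sum.inr false, Sum.inr true] ++ Y.map Sum.inl) ((Δ.push x a h).rev d₁) d₂ ∨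
      ∃ f, CyclicSucc ((Δ.push x a h).bdry f) ((Δ.push x a h).rev d₁) d₂ with hr'
    -- With the spur rotated to the end, the rest of the circuit is the old one, cut at $x$. The
    -- only adjacency lost is the one from its last edge to its first, and `hlink` restores it
    -- through the spur.
    have hnew : ∀ {p q : Δ.D ⊕ Bool},
        CyclicSucc ((Y ++ X).map Sum.inl ++ [Sum.inr false, Sum.inr true]) p q →
        r' ((Δ.push x a h).rev p) q := by
      intro p q hpq
      left
      rw [(Δ.push x a h).rev_rev, cyclicSucc_append_comm, ← List.append_assoc, ← List.map_append]
      exact hpq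
    have hlast : ∀ p, (Y ++ X).getLast? = some p →
        r' (Sum.inl (Δ.rev p)) (Sum.inr false) := by
      intro p hp
      refine hnew (p := Sum.inl p) (cyclicSucc_iff.2 (Or.inl ?_))
      rw [List.pair_infix_append]
      exact Or.inr (Or.inr ⟨by simp only [List.getLast?_map, hp]; rfl, rfl⟩)
    have hlink : ∀ d₁ d₂, (CyclicSucc (X ++ Y) (Δ.rev d₁) d₂ ∨
        ∃ f, CyclicSucc (Δ.bdry f) (Δ.rev d₁) d₂) →
        Relation.EqvGen r' (Sum.inl d₁) (Sum.inl d₂) := by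
      rintro d₁ d₂ (hd | ⟨f, hd⟩)
      · rw [cyclicSucc_append_comm, cyclicSucc_iff] at hd
        rcases hd with ⟨s, t, hd⟩ | ⟨h1, h2⟩
        · refine .rel _ _ ?_
          have := hnew (p := Sum.inl (Δ.rev d₁)) (q := Sum.inl d₂) (cyclicSucc_iff.2 (Or.inl
            (List.pair_infix_append.2 (Or.inl ⟨s.map Sum.inl, t.map Sum.inl, by simp [← hd]⟩))))
          simpa [Dgm.push, TwoComplex.addEdge, Δ.rev_rev] using this
        · have e1 := hlast _ h1
          rw [Δ.rev_rev] at e1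
          refine .trans _ (Sum.inr false) _ (.rel _ _ e1) (.rel _ _ ?_)
          refine hnew (p := Sum.inr true) (cyclicSucc_iff.2 (Or.inr ⟨by simp, ?_⟩))
          rw [List.head?_append, List.head?_map, h2]; rfl
      · exact .rel _ _ (Or.inr ⟨f, hd.map Sum.inl⟩)
    have hinl : ∀ d, Δ.src d = x → Relation.EqvGen r' (Sum.inl d) (Sum.inr false) := by
      intro d hd
      obtain ⟨z, h1, h2⟩ := TwoComplex.isPath_append.1 ho.path
      obtain rfl := hX.unique h1
      have h3 : Δ.IsPath x (Y ++ X) x := TwoComplex.isPath_append.2 ⟨_, h2, h1⟩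
      -- An empty circuit at a vertex that has edges would leave the new edge in a cycle of corners
      -- of its own; `ne_nil` excludes this.
      rcases (Y ++ X).eq_nil_or_concat with hn | ⟨M, m, hm⟩
      · exact absurd (by simpa [and_comm] using hn) (ho.ne_nil d)
      · rw [List.concat_eq_append] at hm
        have e1 := hlast m (by rw [hm]; simp)
        rw [hm, TwoComplex.isPath_append] at h3
        obtain ⟨_, -, -, h5⟩ := h3
        exact .trans _ _ _ (eqvGen_map _ hlink (ho.corners d (Δ.rev m) (hd.trans h5.symm)))
          (.rel _ _ e1)
    rintro (d | _ | _) (d' | _ | _) hdd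
    · exact eqvGen_map _ hlink (ho.corners d d' (Option.some_injective _ hdd))
    · exact hinl d (Option.some_injective _ hdd)
    · cases hdd
    · exact .symm _ _ (hinl d' (Option.some_injective _ hdd).symm)
    · exact .refl _
    · cases hdd
    · cases hdd
    · cases hdd
    · exact .refl _
  euler := by
    have := ho.euler
    have := Δ.finite_V
    have := Δ.finite_D
    have e1 : Nat.card (Δ.push x a h).V = Nat.card Δ.V + 1 := Finite.card_option
    have e2 : Nat.card (Δ.push x a h).D = Nat.card Δ.D + 2 := by
      show Nat.card (Δ.D ⊕ Bool) = _
      rw [Nat.card_sum]; simp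
    have e3 : Nat.card (Δ.push x a h).F = Nat.card Δ.F := rfl
    omega

/-! ### Attaching a 2-cell -/

section Cell

theorem isPath_cell {x y : Δ.V} {Z : List Δ.D} (hZ : Δ.IsPath x Z y) :
    (Δ.addEdge (V' := Δ.V) id x y).IsPath x (Z.map Sum.inl ++ [Sum.inr true]) x :=
  TwoComplex.isPath_append.2 ⟨y, Δ.isPath_inl id x y hZ, rfl, rfl⟩

/-- Attach an edge labelled `a` and a 2-cell along the path `Z`. -/
abbrev cell {x y : Δ.V} {Z : List Δ.D} (hZ : Δ.IsPath x Z y) (a : A)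
    (hr : Z.map Δ.label ++ [S.inv a] ∈ R) (hy : Δ.pr y = Δ.pr x * S.rep a) : S.Dgm R T where
  toTwoComplex := (Δ.addEdge (V' := Δ.V) id x y).addFace (Z.map Sum.inl ++ [Sum.inr true])
    (by simp) (isPath_cell hZ)
  finite_V := Δ.finite_V
  finite_D := by have := Δ.finite_D; exact inferInstanceAs (Finite (Δ.D ⊕ Bool))
  finite_F := by have := Δ.finite_F; exact inferInstanceAs (Finite (Option Δ.F))
  base := Δ.base
  label := Sum.elim Δ.label (fun b => if b then S.inv a else a)
  label_rev d := by
    rcases d with d | _ | _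
    · exact Δ.label_rev d
    · rfl
    · exact (S.inv_inv a).symm
  label_bdry f := by
    cases f with
    | none =>
      show (Z.map Sum.inl ++ [Sum.inr true]).map _ ∈ R
      simpa [Function.comp_def] using hr
    | some f =>
      show ((Δ.bdry f).map Sum.inl).map _ ∈ R
      rw [List.map_map]
      exact Δ.label_bdry f
  pr := Δ.pr
  pr_base := Δ.pr_base
  pr_tgt d := by
    rcases d with d | _ | _
    · exact Δ.pr_tgt d
    · exact hy
    · show Δ.pr x = Δ.pr y * S.rep (S.inv a)
      simp [S.rep_inv, hy]
  tp y := (Δ.tp y).map Sum.inl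
  tp_path z := by
    have : (Δ.addEdge (V' := Δ.V) id x y).IsPath Δ.base ((Δ.tp z).map Sum.inl) z :=
      Δ.isPath_inl id x y (Δ.tp_path z)
    have h := this.map (TwoComplex.inAddFace _ (Z.map Sum.inl ++ [Sum.inr true]) (by simp)
      (isPath_cell hZ))
    rwa [show (TwoComplex.inAddFace _ (Z.map Sum.inl ++ [Sum.inr true]) (by simp)
      (isPath_cell hZ)).onD = fun d => d from rfl, List.map_id'] at h
  tp_label z := by
    rw [List.map_map, ← Δ.tp_label]
    rfl
  tp_concat z L d hd := by
    obtain ⟨L', M', h1, rfl, h2⟩ := List.map_eq_append_iff.1 hd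
    obtain ⟨d', rfl, rfl⟩ := List.map_eq_singleton_iff.1 h2
    simpa using congrArg (List.map Sum.inl) (Δ.tp_concat z _ _ h1)

variable {x y : Δ.V} {Z : List Δ.D} (hZ : Δ.IsPath x Z y) (a : A)
    (hr : Z.map Δ.label ++ [S.inv a] ∈ R) (hy : Δ.pr y = Δ.pr x * S.rep a)

/-- The inclusion into the complex with a new 2-cell. -/
def inCell : LMap Δ (Δ.cell hZ a hr hy) where
  onV x := x
  onD := Sum.inl
  onF := some
  map_src _ := rfl
  map_rev _ := rfl
  map_bdry _ := rfl
  map_base := rfl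
  map_label _ := rfl
  map_tp _ := rfl

/-- Extension of a map over a new 2-cell. -/
def cellMap {K : S.Dgm R T} (f : LMap Δ K) (d : K.D) (c : K.F) (hd : K.label d = a)
    (hx : K.src d = f.onV x) (hy' : K.tgt d = f.onV y)
    (hc : K.bdry c = Z.map f.onD ++ [K.rev d]) : LMap (Δ.cell hZ a hr hy) K where
  onV := f.onV
  onD := Sum.elim f.onD (fun b => if b then K.rev d else d)
  onF o := o.elim c f.onF
  map_src e := by
    rcases e with e | _ | _
    · exact f.map_src e
    · exact hx
    · exact hy'
  map_rev e := by
    rcases e with e | _ | _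
    · exact f.map_rev e
    · rfl
    · exact K.rev_rev d
  map_bdry o := by
    cases o with
    | none =>
      show K.bdry c = (Z.map Sum.inl ++ [Sum.inr true]).map _
      simp [hc, Function.comp_def]
    | some c' =>
      show K.bdry (f.onF c') = ((Δ.bdry c').map Sum.inl).map _
      simp [Function.comp_def, f.map_bdry]
  map_base := f.map_base
  map_label e := by
    rcases e with e | _ | _
    · exact f.map_label e
    · exact hd
    · exact (K.label_rev d).trans (congrArg S.inv hd)
  map_tp z := by
    show K.tp _ = ((Δ.tp z).map Sum.inl).map _
    simp [Function.comp_def, f.map_tp]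

/-- The edges of $Z$ pass from the outer circuit to that of the new cell, and each of these circuits
receives one direction of the new edge. The corner links lost at the two ends of $Z$ are recovered
through the new edge; one more cell balances two more directed edges in the Euler relation. -/
theorem IsOuter.cell {X Y : List Δ.D} (ho : Δ.IsOuter (X ++ Z ++ Y)) (hne : Z ≠ [])
    (hX : Δ.IsPath Δ.base X x) :
    (Δ.cell hZ a hr hy).IsOuter (X.map Sum.inl ++ [Sum.inr false] ++ Y.map Sum.inl) where
  path := by
    obtain ⟨z, h1, h2⟩ := TwoComplex.isPath_append.1 ho.path
    obtain ⟨z', h3, h4⟩ := TwoComplex.isPath_append.1 h1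
    obtain rfl := hX.unique h3
    obtain rfl := hZ.unique h4
    have g1 := h3.map (inCell hZ a hr hy).toCellMap
    have g2 := h2.map (inCell hZ a hr hy).toCellMap
    exact TwoComplex.isPath_append.2 ⟨y, TwoComplex.isPath_append.2 ⟨x, g1, rfl, rfl⟩, g2⟩
  ne_nil _ := by simp
  nodup := by
    have h1 : (X ++ Y).Nodup := by
      refine ho.nodup.sublist ?_
      rw [List.append_assoc]
      exact (List.Sublist.refl X).append (List.sublist_append_right Z Y)
    replace h1 := h1.map (Sum.inl_injective (β := Bool))
    have h2 : (X.map (Sum.inl (β := Bool)) ++ [Sum.inr false] ++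
        Y.map Sum.inl).Perm ([Sum.inr false] ++ (X ++ Y).map Sum.inl) := by
      rw [List.map_append, ← List.append_assoc]
      exact List.perm_append_comm.append_right _
    refine h2.nodup_iff.2 ?_
    rw [List.nodup_append']
    exact ⟨by simp, h1, by simp [List.Disjoint]⟩
  bdry_nodup f := by
    cases f with
    | none =>
      have : Z.Nodup := by
        refine ho.nodup.sublist ?_
        rw [List.append_assoc]
        exact (List.sublist_append_left Z Y).trans (List.sublist_append_right _ _)
      show (Z.map Sum.inl ++ [Sum.inr true]).Nodup
      rw [List.nodup_append']
      exact ⟨this.map Sum.inl_injective, by simp, by simp [List.Disjoint]⟩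
    | some f => exact (ho.bdry_nodup f).map Sum.inl_injective
  mem_unique d := by
    have hb : ∀ (f : Δ.F) (d : Δ.D), (Sum.inl d : Δ.D ⊕ Bool) ∈ (Δ.cell hZ a hr hy).bdry (some f) ↔
        d ∈ Δ.bdry f := fun f d => List.mem_map_of_injective Sum.inl_injective
    have hb' : ∀ (f : Δ.F) (b : Bool),
        (Sum.inr b : Δ.D ⊕ Bool) ∉ (Δ.cell hZ a hr hy).bdry (some f) := by
      intro f b hf
      obtain ⟨_, -, h⟩ := List.mem_map.1 hf
      cases h
    have hn : ∀ d : Δ.D, (Sum.inl d : Δ.D ⊕ Bool) ∈ (Δ.cell hZ a hr hy).bdry none ↔ d ∈ Z := by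
      intro d
      show (Sum.inl d : Δ.D ⊕ Bool) ∈ Z.map Sum.inl ++ [Sum.inr true] ↔ _
      simp
    have hn' : ∀ b : Bool, (Sum.inr b : Δ.D ⊕ Bool) ∈ (Δ.cell hZ a hr hy).bdry none ↔ b = true := by
      intro b
      show (Sum.inr b : Δ.D ⊕ Bool) ∈ Z.map Sum.inl ++ [Sum.inr true] ↔ _
      simp
    rcases d with d | b
    · have hm : (Sum.inl d : Δ.D ⊕ Bool) ∈ X.map Sum.inl ++ [Sum.inr false] ++ Y.map Sum.inl ↔
          d ∈ X ∨ d ∈ Y := by simp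
      rcases ho.mem_unique d with ⟨h1, h2⟩ | ⟨h1, f, h2, h3⟩
      · by_cases hdZ : d ∈ Z
        · refine Or.inr ⟨?_, none, (hn d).2 hdZ, ?_⟩
          · have := ho.nodup
            rw [hm]
            rw [List.nodup_append', List.nodup_append'] at this
            rintro (h | h)
            · exact this.1.2.2 h hdZ
            · exact this.2.2 (List.mem_append_right _ hdZ) h
          · rintro (_ | f) hf
            · rfl
            · exact absurd ((hb f d).1 hf) (h2 f)
        · refine Or.inl ⟨hm.2 (by simpa [hdZ] using h1), ?_⟩
          rintro (_ | f) hf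
          · exact hdZ ((hn d).1 hf)
          · exact h2 f ((hb f d).1 hf)
      · simp only [List.mem_append, not_or] at h1
        refine Or.inr ⟨by rw [hm]; tauto, some f, (hb f d).2 h2, ?_⟩
        rintro (_ | f') hf
        · exact absurd ((hn d).1 hf) h1.1.2
        · exact congrArg some (h3 f' ((hb f' d).1 hf))
    · cases b
      · refine Or.inl ⟨by simp, ?_⟩
        rintro (_ | f) hf
        · exact absurd ((hn' _).1 hf) (by simp)
        · exact hb' f _ hf
      · refine Or.inr ⟨by simp, none, (hn' _).2 rfl, ?_⟩
        rintro (_ | f) hf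
        · rfl
        · exact absurd hf (hb' f _)
  corners := by
    set Δ' := Δ.cell hZ a hr hy with hΔ'
    set r' := fun d₁ d₂ : Δ'.D => CyclicSucc (X.map Sum.inl ++
      [Sum.inr false] ++ Y.map Sum.inl) (Δ'.rev d₁) d₂ ∨
      ∃ f, CyclicSucc (Δ'.bdry f) (Δ'.rev d₁) d₂ with hr'
    have hnew : ∀ {p q : Δ.D ⊕ Bool},
        CyclicSucc ((Y ++ X).map Sum.inl ++ [Sum.inr false]) p q → r' (Δ'.rev p) q := by
      intro p q hpq
      left
      rw [Δ'.rev_rev, cyclicSucc_append_comm, ← List.append_assoc, ← List.map_append]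
      exact hpq
    have hface : ∀ {p q : Δ.D ⊕ Bool},
        CyclicSucc (Z.map Sum.inl ++ [Sum.inr true]) p q → r' (Δ'.rev p) q := by
      intro p q hpq
      right
      rw [Δ'.rev_rev]
      exact ⟨none, hpq⟩
    have hlast : ∀ p, Z.getLast? = some p → r' (Sum.inl (Δ.rev p)) (Sum.inr true) := by
      intro p hp
      refine hface (p := Sum.inl p) (cyclicSucc_iff.2 (Or.inl ?_))
      rw [List.pair_infix_append]
      exact Or.inr (Or.inr ⟨by simp only [List.getLast?_map, hp]; rfl, rfl⟩)
    have hhead : ∀ q, Z.head? = some q → r' (Sum.inr false) (Sum.inl q) := by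
      intro q hq
      refine hface (p := Sum.inr true) (cyclicSucc_iff.2 (Or.inr ⟨by simp, ?_⟩))
      rw [List.head?_append, List.head?_map, hq]; rfl
    have hinl : ∀ (p q : Δ.D) (W : List (Δ.D ⊕ Bool)), [p, q] <:+: Z ∨ [p, q] <:+: Y ++ X →
        r' (Sum.inl (Δ.rev p)) (Sum.inl q) := by
      rintro p q W (⟨s, t, h⟩ | ⟨s, t, h⟩)
      · exact hface (p := Sum.inl p) (cyclicSucc_iff.2 (Or.inl
            (List.pair_infix_append.2 (Or.inl ⟨s.map Sum.inl, t.map Sum.inl, by simp [← h]⟩))))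
      · exact hnew (p := Sum.inl p) (cyclicSucc_iff.2 (Or.inl
            (List.pair_infix_append.2 (Or.inl ⟨s.map Sum.inl, t.map Sum.inl, by simp [← h]⟩))))
    have hlink : ∀ d₁ d₂, (CyclicSucc (X ++ Z ++ Y) (Δ.rev d₁) d₂ ∨
        ∃ f, CyclicSucc (Δ.bdry f) (Δ.rev d₁) d₂) →
        Relation.EqvGen r' (Sum.inl d₁) (Sum.inl d₂) := by
      rintro d₁ d₂ (hd | ⟨f, hd⟩)
      · have hrr : Δ.rev (Δ.rev d₁) = d₁ := Δ.rev_rev d₁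
        rw [cyclicSucc_append_comm, ← List.append_assoc, cyclicSucc_iff,
          List.pair_infix_append] at hd
        rcases hd with (h | h | ⟨h1, h2⟩) | ⟨h1, h2⟩
        · exact hrr ▸ .rel _ _ (hinl _ _ [] (Or.inr h))
        · exact hrr ▸ .rel _ _ (hinl _ _ [] (Or.inl h))
        · refine .trans _ (Sum.inr false) _ (.rel _ _ ?_) (.rel _ _ (hhead _ h2))
          have := hnew (p := Sum.inl (Δ.rev d₁)) (q := Sum.inr false) (cyclicSucc_iff.2 (Or.inl
            (List.pair_infix_append.2 (Or.inr (Or.inr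
              ⟨by simp only [List.getLast?_map, h1]; rfl, rfl⟩)))))
          exact hrr ▸ this
        · have h1' : Z.getLast? = some (Δ.rev d₁) := by
            rw [List.getLast?_append] at h1
            rcases Z.eq_nil_or_concat with hn | ⟨M, m, hm⟩
            · exact absurd hn hne
            · rw [hm, List.concat_eq_append] at h1 ⊢
              simpa using h1
          refine .trans _ (Sum.inr true) _ (hrr ▸ .rel _ _ (hlast _ h1')) ?_
          rw [List.head?_append] at h2
          -- If $Z$ was the whole circuit, the new edge is a loop that forms the outer circuit alone
          -- and is its own successor.
          cases hYX : Y ++ X with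
          | nil =>
            rw [hYX] at h2
            refine .trans _ (Sum.inr false) _ (.rel _ _ ?_) (.rel _ _ (hhead _ (by simpa using h2)))
            refine hnew (p := Sum.inr false) (cyclicSucc_iff.2 (Or.inr ⟨by simp, ?_⟩))
            rw [hYX]; rfl
          | cons b W =>
            rw [hYX] at h2
            refine .rel _ _ (hnew (p := Sum.inr false) (cyclicSucc_iff.2 (Or.inr ⟨by simp, ?_⟩)))
            rw [hYX]; simpa using h2
      · exact .rel _ _ (Or.inr ⟨some f, hd.map Sum.inl⟩)
    -- No vertex is new, and both directions of the new edge are linked to an end of $Z$, so the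
    -- corners at each vertex inherit their connectedness. This needs $Z$ to be nonempty.
    have hrep : ∀ d : Δ'.D, ∃ d₀ : Δ.D, Δ.src d₀ = Δ'.src d ∧
        Relation.EqvGen r' d (Sum.inl d₀) := by
      rintro (d | _ | _)
      · exact ⟨d, rfl, .refl _⟩
      · cases Z with
        | nil => exact absurd rfl hne
        | cons z Z => exact ⟨z, hZ.1, .rel _ _ (hhead z rfl)⟩
      · rcases Z.eq_nil_or_concat with hn | ⟨M, m, hm⟩
        · exact absurd hn hne
        · rw [List.concat_eq_append] at hm
          refine ⟨Δ.rev m, ?_, .symm _ _ (.rel _ _ (hlast m (by rw [hm]; simp)))⟩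
          rw [hm, TwoComplex.isPath_append] at hZ
          obtain ⟨_, -, -, h⟩ := hZ
          exact h
    intro d d' hdd
    obtain ⟨e, he, he'⟩ := hrep d
    obtain ⟨f, hf, hf'⟩ := hrep d'
    exact .trans _ _ _ he' (.trans _ _ _ (eqvGen_map _ hlink
      (ho.corners e f (he.trans (hdd.trans hf.symm)))) (.symm _ _ hf'))
  euler := by
    have := ho.euler
    have := Δ.finite_F
    have := Δ.finite_D
    have e1 : Nat.card (Δ.cell hZ a hr hy).F = Nat.card Δ.F + 1 := Finite.card_option
    have e2 : Nat.card (Δ.cell hZ a hr hy).D = Nat.card Δ.D + 2 := by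
      show Nat.card (Δ.D ⊕ Bool) = _
      rw [Nat.card_sum]; simp
    have e3 : Nat.card (Δ.cell hZ a hr hy).V = Nat.card Δ.V := rfl
    omega

end Cell

end Dgm

end SymGens

/-! ### Construction histories and their replay -/

namespace SymGens

variable {G : Type u} [Group G] {A : Type v} {S : SymGens G A} {R : Set (List A)} {T : Set (G × A)}

/-- A diagram under construction: the boundary circuit runs along `pre`, `done` and back along the
tree path to the vertex `top`. -/
structure State (S : SymGens G A) (R : Set (List A)) (T : Set (G × A)) where
  dgm : S.Dgm R T
  pre : List dgm.D
  done : List dgm.D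
  top : dgm.V
  outer : dgm.IsOuter (pre ++ done ++ dgm.revPath (dgm.tp top))

namespace State

theorem path (X : State S R T) : X.dgm.IsPath X.dgm.base (X.pre ++ X.done) X.top := by
  obtain ⟨z, h1, h2⟩ := TwoComplex.isPath_append.1 X.outer.path
  have h3 := h2.rev
  have : X.dgm.revPath (X.dgm.revPath (X.dgm.tp X.top)) = X.dgm.tp X.top := by
    simp [TwoComplex.revPath, Function.comp_def, X.dgm.rev_rev]
  rw [this] at h3
  rwa [h3.unique (X.dgm.tp_path X.top)] at h1

/-- Attach a spur at the top. -/
abbrev push (X : State S R T) (a : A)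
    (h : S.nf T (X.dgm.pr X.top * S.rep a) = S.nf T (X.dgm.pr X.top) ++ [a]) : State S R T where
  dgm := X.dgm.push X.top a h
  pre := X.pre.map Sum.inl
  done := X.done.map Sum.inl ++ [Sum.inr false]
  top := none
  outer := by
    have := X.outer.push h X.path
    convert this using 1
    simp [TwoComplex.revPath, Function.comp_def]

/-- Move the top one step down the tree. -/
abbrev pop (X : State S R T) {L : List X.dgm.D} {d : X.dgm.D} (h : X.dgm.tp X.top = L ++ [d]) :
    State S R T where
  dgm := X.dgm
  pre := X.pre
  done := X.done ++ [X.dgm.rev d]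
  top := X.dgm.src d
  -- The circuit stays the same; the first edge of its return path is merely counted as part of
  -- `done`.
  outer := by
    have := X.outer
    rw [h] at this
    rw [(X.dgm.tp_spec h).1]
    simpa using this

/-- Attach a 2-cell along the last edges of the boundary path. -/
abbrev cell (X : State S R T) {D Z : List X.dgm.D} (hD : X.done = D ++ Z) (hne : Z ≠ [])
    {x : X.dgm.V} (hZ : X.dgm.IsPath x Z X.top) (a : A) (hr : Z.map X.dgm.label ++ [S.inv a] ∈ R)
    (hy : X.dgm.pr X.top = X.dgm.pr x * S.rep a) : State S R T where
  dgm := X.dgm.cell hZ a hr hy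
  pre := X.pre.map Sum.inl
  done := D.map Sum.inl ++ [Sum.inr false]
  top := X.top
  outer := by
    have h1 := X.outer
    have h2 := X.path
    rw [hD, ← List.append_assoc] at h1 h2
    obtain ⟨z, h3, h4⟩ := TwoComplex.isPath_append.1 h2
    have hz : z = x := by
      cases Z with
      | nil => exact absurd rfl hne
      | cons d Z => exact h4.1.symm.trans hZ.1
    rw [hz] at h3
    have := h1.cell hZ a hr hy hne h3
    convert this using 1
    simp [TwoComplex.revPath, Function.comp_def]

/-- Forget which part of the boundary path has been added last. -/
abbrev reset (X : State S R T) : State S R T where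
  dgm := X.dgm
  pre := X.pre ++ X.done
  done := []
  top := X.top
  outer := by simpa using X.outer

/-- The diagram with one vertex. -/
def point (S : SymGens G A) (R : Set (List A)) (T : Set (G × A)) (h : S.nf T 1 = []) :
    State S R T where
  dgm :=
    { V := Unit, D := Empty, F := Empty
      rev := nofun, rev_rev := nofun, rev_ne := nofun, src := nofun, bdry := nofun
      bdry_ne_nil := nofun, bdry_closed := nofun
      finite_V := inferInstance, finite_D := inferInstance, finite_F := inferInstance
      base := (), label := nofun, label_rev := nofun, label_bdry := nofun
      pr := fun _ => 1, pr_base := rfl, pr_tgt := nofun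
      tp := fun _ => [], tp_path := fun _ => rfl, tp_label := fun _ => h.symm
      tp_concat := fun _ _ d => nomatch d }
  pre := []
  done := []
  top := ()
  outer :=
    { path := rfl, ne_nil := nofun, nodup := List.nodup_nil, bdry_nodup := nofun
      mem_unique := nofun, corners := nofun, euler := by simp }

end State

/-- `Run X X' j`: the state `X'` arises from `X` by attaching spurs and 2-cells and by moving the top
down, and `j` is the inclusion. -/
inductive Run : ∀ X X' : State S R T, LMap X.dgm X'.dgm → Prop
  | refl (X) : Run X X (LMap.id _)
  | push {X X' j} (a h) : Run X X' j → Run X (X'.push a h) ((X'.dgm.inPush _ _ h).comp j)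
  | pop {X X' j L d} (h : X'.dgm.tp X'.top = L ++ [d]) : Run X X' j → Run X (X'.pop h) j
  | cell {X X' j D Z} (hD : X'.done = D ++ Z) (hne : Z ≠ []) {x} (hZ : X'.dgm.IsPath x Z X'.top)
      (a hr hy) : Run X X' j →
      Run X (X'.cell hD hne hZ a hr hy) ((Dgm.inCell hZ a hr hy).comp j)

theorem Run.trans {X X' X'' : State S R T} {j : LMap X.dgm X'.dgm} {j' : LMap X'.dgm X''.dgm}
    (h : Run X X' j) (h' : Run X' X'' j') : Run X X'' (j'.comp j) := by
  induction h' with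
  | refl => exact h
  | push a hp _ ih => exact ih.push a hp
  | pop hp _ ih => exact ih.pop hp
  | cell hD hne hZ a hr hy _ ih => exact ih.cell hD hne hZ a hr hy

theorem Run.injective_onF {X X' : State S R T} {j : LMap X.dgm X'.dgm} (h : Run X X' j) :
    Function.Injective j.onF := by
  induction h with
  | refl => exact Function.injective_id
  | push _ _ _ ih => exact ih
  | pop _ _ ih => exact ih
  | cell _ _ _ _ _ _ _ ih => exact (Option.some_injective _).comp ih

theorem Run.pre_eq {X X' : State S R T} {j : LMap X.dgm X'.dgm} (h : Run X X' j) :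
    X'.pre = X.pre.map j.onD := by
  induction h with
  | refl => exact (List.map_id' _).symm
  | push _ _ _ ih => simp [ih, LMap.comp, Dgm.inPush, TwoComplex.inAddEdge]
  | pop _ _ ih => exact ih
  | cell _ _ _ _ _ _ _ ih => simp [ih, LMap.comp, Dgm.inCell]

/-- The same construction can be carried out from another state to which the first one is mapped. -/
theorem Run.simulate {X X' : State S R T} {j : LMap X.dgm X'.dgm} (h : Run X X' j)
    {Y : State S R T} (f : LMap X.dgm Y.dgm) (C : List Y.dgm.D) (htop : f.onV X.top = Y.top)
    (hdone : Y.done = C ++ X.done.map f.onD) (hf : Function.Injective f.onF) :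
    ∃ (Y' : State S R T) (i : LMap Y.dgm Y'.dgm) (f' : LMap X'.dgm Y'.dgm),
      Run Y Y' i ∧ f'.comp j = i.comp f ∧ f'.onV X'.top = Y'.top ∧
      Y'.done = C.map i.onD ++ X'.done.map f'.onD ∧
      Function.Injective f'.onF ∧ (∀ y', (∃ x', f'.onF x' = y') ∨ ∃ y, i.onF y = y') ∧
      ∀ x' y, f'.onF x' = i.onF y → ∃ x, f.onF x = y := by
  -- A run uses only the top, its tree path and the edges in `done`, never `pre`. The map transports
  -- all of these, so each move can be repeated in the target without touching the earlier edges
  -- `C`. The conclusions on 2-cells express that the result is the union of the target and a copy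
  -- of the run, which share only what they shared at the start.
  induction h with
  | refl =>
    exact ⟨Y, LMap.id _, f, .refl _, rfl, htop, by simpa [LMap.id, TwoComplex.CellMap.id] using hdone,
      hf, fun y' => Or.inr ⟨y', rfl⟩, fun x' y h => ⟨x', h⟩⟩
  | @push X' j a h _ ih =>
    obtain ⟨Y', i, f', h1, h2, h3, h4, h5, h6, h7⟩ := ih
    have hY : S.nf T (Y'.dgm.pr Y'.top * S.rep a) = S.nf T (Y'.dgm.pr Y'.top) ++ [a] := by
      rw [← h3, f'.map_pr, h]
    let g := (Y'.dgm.inPush Y'.top a hY).comp f'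
    have hg : (Y'.push a hY).dgm.tp none = (Y'.push a hY).dgm.tp (g.onV X'.top) ++ [Sum.inr false] := by
      show _ = (Y'.push a hY).dgm.tp (some (f'.onV X'.top)) ++ _
      rw [h3]
      rfl
    refine ⟨Y'.push a hY, _, Dgm.pushMap h g none (Sum.inr false) hg rfl, h1.push a hY, ?_, rfl, ?_,
      h5, h6, h7⟩
    · rw [← LMap.comp_assoc, ← h2]; rfl
    · simp only [h4]
      simp [LMap.comp, Dgm.inPush, TwoComplex.inAddEdge, Dgm.pushMap, g, Function.comp_def]
  | @pop X' j L d h _ ih =>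
    obtain ⟨Y', i, f', h1, h2, h3, h4, h5, h6, h7⟩ := ih
    -- Maps take tree paths to tree paths, so the descent can be copied even below the vertex at
    -- which the replay started.
    have hY : Y'.dgm.tp Y'.top = L.map f'.onD ++ [f'.onD d] := by
      rw [← h3, f'.map_tp, h]; simp
    refine ⟨Y'.pop hY, i, f', h1.pop hY, h2, (f'.map_src d).symm, ?_, h5, h6, h7⟩
    simp [h4, f'.map_rev]
  | @cell X' j D Z hD hne x hZ a hr hy _ ih =>
    obtain ⟨Y', i, f', h1, h2, h3, h4, h5, h6, h7⟩ := ih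
    have hD' : Y'.done = (C.map i.onD ++ D.map f'.onD) ++ Z.map f'.onD := by
      rw [h4, hD]; simp
    have hZ' : Y'.dgm.IsPath (f'.onV x) (Z.map f'.onD) Y'.top := by
      rw [← h3]; exact hZ.map _
    have hr' : (Z.map f'.onD).map Y'.dgm.label ++ [S.inv a] ∈ R := by
      rw [List.map_map]
      simpa [Function.comp_def, f'.map_label] using hr
    have hy' : Y'.dgm.pr Y'.top = Y'.dgm.pr (f'.onV x) * S.rep a := by
      rw [← h3, f'.map_pr, f'.map_pr, hy]
    let g := (Dgm.inCell hZ' a hr' hy').comp f'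
    have hc : (Y'.dgm.cell hZ' a hr' hy').bdry none = Z.map g.onD ++
        [(Y'.dgm.cell hZ' a hr' hy').rev (Sum.inr false)] := by
      simp [g, LMap.comp, Dgm.inCell, Function.comp_def]
    refine ⟨Y'.cell hD' (by simpa using hne) hZ' a hr' hy', _,
      Dgm.cellMap hZ a hr hy g (Sum.inr false) none rfl rfl h3.symm hc,
      h1.cell hD' _ hZ' a hr' hy', ?_, h3, ?_, ?_, ?_, ?_⟩
    · rw [← LMap.comp_assoc, ← h2]; rfl
    · simp [g, LMap.comp, Dgm.inCell, Dgm.cellMap, Function.comp_def]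
    · rintro (_ | x₁) (_ | x₂) h
      · rfl
      · cases h
      · cases h
      · exact congrArg some (h5 (Option.some_injective _ h))
    · rintro (_ | y)
      · exact Or.inl ⟨none, rfl⟩
      · rcases h6 y with ⟨x', rfl⟩ | ⟨y', rfl⟩
        · exact Or.inl ⟨some x', rfl⟩
        · exact Or.inr ⟨y', rfl⟩
    · rintro (_ | x') y h
      · cases h
      · exact h7 x' y (Option.some_injective _ h)

/-- A segment labelled by a normal form, which maps to every diagram. -/
structure IsLine (X : State S R T) (g : G) : Prop where
  pr_top : X.dgm.pr X.top = g
  pre : X.pre = X.dgm.tp X.top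
  done : X.done = []
  isEmpty : IsEmpty X.dgm.F
  exists_map : ∀ (K : S.Dgm R T) (y : K.V), K.pr y = g → ∃ f : LMap X.dgm K, f.onV X.top = y

theorem exists_line (hT : S.IsMaximalTree T) (R : Set (List A)) (g : G) :
    ∃ X : State S R T, IsLine X g := by
  suffices h : ∀ x : List A, S.nf T (S.val x) = x → ∃ X : State S R T, IsLine X (S.val x) by
    simpa [val_nf hT] using h (S.nf T g) (by rw [val_nf hT])
  intro x
  induction x using List.reverseRecOn with
  | nil =>
    intro _
    refine ⟨State.point S R T (nf_one hT), by simp [State.point], rfl, rfl,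
      inferInstanceAs (IsEmpty Empty), fun K y hy => ?_⟩
    have h1 : K.tp y = [] := by
      have := K.tp_label y
      rw [hy, val_nil, nf_one hT] at this
      simpa using this
    have h2 : K.base = y := by
      have := K.tp_path y
      rwa [h1] at this
    exact ⟨⟨⟨fun _ => K.base, nofun, nofun, nofun, nofun, nofun⟩, rfl, nofun,
      fun _ => K.tp_base hT⟩, h2⟩
  | append_singleton x a ih =>
    intro hx
    have hx' : S.nf T (S.val x) = x := nf_prefix hT (g := S.val (x ++ [a])) (by rw [hx]; simp)
    obtain ⟨X, h1, h2, h3, h4, h5⟩ := ih hx'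
    have hv : S.val (x ++ [a]) = S.val x * S.rep a := by simp
    have h : S.nf T (X.dgm.pr X.top * S.rep a) = S.nf T (X.dgm.pr X.top) ++ [a] := by
      rw [h1, ← hv, hx, hx']
    refine ⟨(X.push a h).reset, ?_, ?_, rfl, h4, fun K y hy => ?_⟩
    · show X.dgm.pr X.top * S.rep a = _
      rw [h1, hv]
    · simp [h2, h3]
    -- The tree path to $y$ in $K$ is labelled by the same normal form as the segment, so its last
    -- edge is the required image of the last edge of the segment.
    · have hl := K.tp_label y
      rw [hy, hx] at hl
      obtain ⟨L, M, hy2, hL, hM⟩ := List.map_eq_append_iff.1 hl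
      obtain ⟨d, rfl, hd⟩ := List.map_eq_singleton_iff.1 hM
      obtain ⟨h6, h7⟩ := K.tp_spec hy2
      have h8 : K.pr (K.src d) = S.val x := by
        have := K.pr_tgt d
        rw [h7, hy, hd, hv] at this
        exact mul_right_cancel this.symm
      obtain ⟨f, hf⟩ := h5 K (K.src d) h8
      exact ⟨Dgm.pushMap h f y d (by rw [hf, h6, hy2]) hd, rfl⟩

end SymGens

/-! ### Bricks: diagrams of edges, and rows of such diagrams -/

namespace SymGens

variable {G : Type u} [Group G] {A : Type v} {S : SymGens G A} {R : Set (List A)} {T : Set (G × A)}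

/-- A construction, starting from a segment, of a diagram for the edge `e`. -/
structure Brick (S : SymGens G A) (R : Set (List A)) (T : Set (G × A)) (e : G × A) where
  line : State S R T
  isLine : IsLine line e.1
  st : State S R T
  incl : LMap line.dgm st.dgm
  run : Run line st incl
  edge : st.dgm.D
  done : st.done = [edge]
  label_edge : st.dgm.label edge = e.2
  pr_top : st.dgm.pr st.top = e.1 * S.rep e.2

namespace Brick

variable {e : G × A} (b : Brick S R T e)

/-- The initial vertex of the edge of a brick. -/
def bot : b.st.dgm.V := b.incl.onV b.line.top

theorem pre_eq : b.st.pre = b.st.dgm.tp b.bot := by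
  rw [b.run.pre_eq, b.isLine.pre, bot, b.incl.map_tp]

theorem pr_bot : b.st.dgm.pr b.bot = e.1 := by
  rw [bot, b.incl.map_pr, b.isLine.pr_top]

theorem src_tgt : b.st.dgm.src b.edge = b.bot ∧ b.st.dgm.tgt b.edge = b.st.top := by
  have h := b.st.path
  rw [b.done, b.pre_eq, TwoComplex.isPath_append] at h
  obtain ⟨z, h1, h2, h3⟩ := h
  exact ⟨h2.trans (h1.unique (b.st.dgm.tp_path _)), h3⟩

end Brick

theorem Dgm.map_label_revPath (Δ : S.Dgm R T) (P : List Δ.D) :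
    (Δ.revPath P).map Δ.label = S.invWord (P.map Δ.label) := by
  simp [TwoComplex.revPath, invWord, Function.comp_def, Δ.label_rev]

theorem Brick.word {e : G × A} (b : Brick S R T e) :
    (b.st.pre ++ b.st.done ++ b.st.dgm.revPath (b.st.dgm.tp b.st.top)).map b.st.dgm.label =
      S.edgeWord T e := by
  rw [b.pre_eq, b.done, List.map_append, List.map_append, Dgm.map_label_revPath, Dgm.tp_label,
    Dgm.tp_label, b.pr_bot, b.pr_top, List.map_singleton, b.label_edge, edgeWord]

/-- The van Kampen diagram of a brick. -/
noncomputable def Brick.diagram {e : G × A} (b : Brick S R T e) : S.VanKampenDiagram R (S.edgeWord T e) :=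
  b.st.dgm.toVanKampen b.st.outer b.word

theorem exists_extend {n k : ℕ} {P : Fin n → Sort*} (hk : k < n) (κ : ∀ i : Fin n, i.1 < k → P i)
    (x : P ⟨k, hk⟩) : ∃ κ' : ∀ i : Fin n, i.1 < k + 1 → P i,
      (∀ i (h : i.1 < k) h', κ' i h' = κ i h) ∧ ∀ h', κ' ⟨k, hk⟩ h' = x :=
  ⟨fun i h => if h' : i.1 < k then κ i h' else
    (show (⟨k, hk⟩ : Fin n) = i by ext; simp only; omega) ▸ x,
    fun i h h' => by simp [h], fun h' => by simp⟩

/-- The edges of the path from `g` labelled by `z`. -/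
abbrev stepEdge (S : SymGens G A) (g : G) (z : List A) (i : Fin z.length) : G × A :=
  (g * S.val (z.take i), z.get i)

/-- Bricks put together along the path labelled by `z`. -/
structure IsChain (g : G) (z : List A) (B : ∀ i, Brick S R T (S.stepEdge g z i)) (k : ℕ)
    {L X : State S R T} (j : LMap L.dgm X.dgm)
    (κ : ∀ i : Fin z.length, i.1 < k → LMap (B i).st.dgm X.dgm) (q : ℕ → X.dgm.V) : Prop where
  run : Run L X j
  start : q 0 = j.onV L.top
  top : q k = X.top
  bot : ∀ i h, (κ i h).onV (B i).bot = q i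
  map_top : ∀ i h, (κ i h).onV (B i).st.top = q (i + 1)
  pr : ∀ i ≤ k, X.dgm.pr (q i) = g * S.val (z.take i)
  length_done : X.done.length = k
  done : ∀ i h, X.done[i.1]? = some ((κ i h).onD (B i).edge)
  face : ∀ f, ∃ i h c, (κ i h).onF c = f
  unique : ∀ i h c i' h' c', (κ i h).onF c = (κ i' h').onF c' →
    (⟨i, c⟩ : Σ i, (B i).st.dgm.F) = ⟨i', c'⟩

/-- The history of each brick starts with the segment labelled by the normal form of its initial
vertex. That segment maps to the tree path of the current top, and replaying the history from there
glues the brick along this path. As a segment has no 2-cells, different bricks contribute different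
ones. -/
theorem exists_chain (g : G) (z : List A) (B : ∀ i, Brick S R T (S.stepEdge g z i))
    {L : State S R T} (hL : IsLine L g) (k : ℕ) (hk : k ≤ z.length) :
    ∃ (X : State S R T) (j : LMap L.dgm X.dgm)
      (κ : ∀ i : Fin z.length, i.1 < k → LMap (B i).st.dgm X.dgm) (q : ℕ → X.dgm.V),
      IsChain g z B k j κ q := by
  induction k with
  | zero =>
    refine ⟨L, LMap.id _, fun i h => absurd h (by omega), fun _ => L.top, .refl L, rfl, rfl,
      fun i h => absurd h (by omega), fun i h => absurd h (by omega), fun i h => ?_, by simp [hL.done],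
      fun i h => absurd h (by omega), fun f => (hL.isEmpty.false f).elim,
      fun i h => absurd h (by omega)⟩
    obtain rfl : i = 0 := by omega
    simp [hL.pr_top]
  | succ k ih =>
    obtain ⟨X, j, κ, q, hX⟩ := ih (by omega)
    have hk' : k < z.length := hk
    set b := B ⟨k, hk'⟩ with hb
    have hpr : X.dgm.pr X.top = (S.stepEdge g z ⟨k, hk'⟩).1 := by
      rw [← hX.top, hX.pr k le_rfl]
    obtain ⟨f, hf⟩ := b.isLine.exists_map X.dgm X.top hpr
    have hE := b.isLine.isEmpty
    obtain ⟨Y, i, f', h1, h2, h3, h4, h5, h6, h7⟩ := b.run.simulate f X.done hf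
      (by simp [b.isLine.done]) (fun c => (hE.false c).elim)
    obtain ⟨κ', hκ, hκ'⟩ := exists_extend (P := fun i => LMap (B i).st.dgm Y.dgm) hk'
      (fun m hm => i.comp (κ m hm)) f'
    have hbot : f'.onV b.bot = i.onV X.top := by
      have : (f'.comp b.incl).onV b.line.top = (i.comp f).onV b.line.top := by rw [h2]
      rw [← hf]; exact this
    have hcase : ∀ m : Fin z.length, m.1 < k + 1 → m.1 < k ∨ m = ⟨k, hk'⟩ := fun m hm => by
      rcases Nat.lt_succ_iff_lt_or_eq.1 hm with h | h
      exacts [Or.inl h, Or.inr (Fin.ext h)]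
    -- The vertices up to index `k` are kept and the new top has index `k + 1`; later values do not
    -- matter.
    refine ⟨Y, i.comp j, κ', fun m => if m ≤ k then i.onV (q m) else Y.top, hX.run.trans h1, ?_, ?_,
      ?_, ?_, ?_, ?_, ?_, ?_, ?_⟩
    · simp [hX.start, LMap.comp]
    · simp
    · intro m hm
      rcases hcase m hm with h | rfl
      · rw [hκ m h, if_pos h.le, ← hX.bot m h]; rfl
      · rw [hκ', if_pos le_rfl, hX.top, ← hbot]
    · intro m hm
      rcases hcase m hm with h | rfl
      · rw [hκ m h, if_pos (by omega), ← hX.map_top m h]; rfl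
      · rw [hκ', if_neg (by simp), h3]
    · intro m hm
      by_cases h : m ≤ k
      · rw [if_pos h, i.map_pr, hX.pr m h]
      · rw [if_neg h, ← h3, f'.map_pr, b.pr_top, (by omega : m = k + 1),
          List.take_succ_eq_append_getElem hk', val_append, val_singleton, mul_assoc]
        rfl
    · simp [h4, hX.length_done, b.done]
    · intro m hm
      rcases hcase m hm with h | rfl
      · rw [hκ m h, h4, List.getElem?_append_left (by simp [hX.length_done, h]), List.getElem?_map,
          hX.done m h]
        rfl
      · rw [hκ', h4, List.getElem?_append_right (by simp [hX.length_done])]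
        simp [hX.length_done, b.done]
        rfl
    · intro y
      rcases h6 y with ⟨x, hx⟩ | ⟨x, hx⟩
      · exact ⟨⟨k, hk'⟩, Nat.lt_succ_self k, x, by rw [hκ', hx]⟩
      · obtain ⟨m, hm, c, hc⟩ := hX.face x
        exact ⟨m, hm.trans (Nat.lt_succ_self k), c, by rw [hκ m hm, ← hx, ← hc]; rfl⟩
    · have hd : ∀ x y, f'.onF x ≠ i.onF y := fun x y h => by
        obtain ⟨c, -⟩ := h7 x y h
        exact hE.false c
      intro m hm c m' hm' c' h
      rcases hcase m hm with h8 | rfl <;> rcases hcase m' hm' with h9 | rfl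
      · rw [hκ m h8, hκ m' h9] at h
        exact hX.unique _ _ _ _ _ _ (h1.injective_onF h)
      · rw [hκ m h8, hκ'] at h
        exact absurd h.symm (hd _ _)
      · rw [hκ m' h9, hκ'] at h
        exact absurd h (hd _ _)
      · rw [hκ'] at h
        rw [h5 h]

namespace IsChain

variable {g : G} {z : List A} {B : ∀ i, Brick S R T (S.stepEdge g z i)}
    {L X : State S R T} {j : LMap L.dgm X.dgm}
    {κ : ∀ i : Fin z.length, i.1 < z.length → LMap (B i).st.dgm X.dgm} {q : ℕ → X.dgm.V}

theorem done_eq (h : IsChain g z B z.length j κ q) :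
    X.done = List.ofFn fun i => (κ i i.2).onD (B i).edge := by
  refine List.ext_getElem? fun m => ?_
  by_cases hm : m < z.length
  · rw [h.done ⟨m, hm⟩ hm, List.getElem?_ofFn, dif_pos hm]
  · rw [List.getElem?_eq_none (by rw [h.length_done]; omega),
      List.getElem?_eq_none (by rw [List.length_ofFn]; omega)]

theorem label_done (h : IsChain g z B z.length j κ q) : X.done.map X.dgm.label = z := by
  rw [h.done_eq, List.map_ofFn]
  refine List.ext_getElem (by simp) fun m h1 h2 => ?_
  simp only [List.getElem_ofFn, Function.comp_apply, LMap.map_label, Brick.label_edge]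
  rfl

theorem pre_eq (hL : IsLine L g) (h : IsChain g z B z.length j κ q) :
    X.pre = X.dgm.tp (q 0) := by
  rw [h.run.pre_eq, hL.pre, h.start, j.map_tp]

theorem isPath_done (hL : IsLine L g) (h : IsChain g z B z.length j κ q) :
    X.dgm.IsPath (q 0) X.done X.top := by
  have h1 := X.path
  rw [h.pre_eq hL, TwoComplex.isPath_append] at h1
  obtain ⟨y, h2, h3⟩ := h1
  rwa [h2.unique (X.dgm.tp_path _)] at h3

end IsChain

/-- The brick of a tree edge is a segment. -/
def Brick.IsFlat {e : G × A} (b : Brick S R T e) : Prop :=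
  IsEmpty b.st.dgm.F ∧ (b.st.dgm.tp b.st.top = b.st.dgm.tp b.bot ++ [b.edge] ∨
    b.st.dgm.tp b.bot = b.st.dgm.tp b.st.top ++ [b.st.dgm.rev b.edge])

/-- A brick that arises from a chain of bricks along `z` by attaching one 2-cell. -/
def Brick.IsBuiltFrom {e : G × A} (b : Brick S R T e) {g : G} {z : List A}
    (B : ∀ i, Brick S R T (S.stepEdge g z i)) : Prop :=
  ∃ (κ : ∀ i, LMap (B i).st.dgm b.st.dgm) (q : ℕ → b.st.dgm.V) (c : b.st.dgm.F),
    q 0 = b.bot ∧ q z.length = b.st.top ∧ (∀ i ≤ z.length, b.st.dgm.pr (q i) = g * S.val (z.take i)) ∧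
    (∀ i, (κ i).onV (B i).bot = q i) ∧ (∀ i, (κ i).onV (B i).st.top = q (i + 1)) ∧
    b.st.dgm.bdry c = (List.ofFn fun i => (κ i).onD (B i).edge) ++ [b.st.dgm.rev b.edge] ∧
    (∀ i f, (κ i).onF f ≠ c) ∧
    ∀ f, f ≠ c → ∃! s : (Σ i, (B i).st.dgm.F), (κ s.1).onF s.2 = f

/-- A tree edge lengthens the normal form by a letter, which is a spur at the end of the segment, or
shortens it, which moves the top one edge down. -/
theorem exists_flat_brick (hT : S.IsMaximalTree T) (R : Set (List A)) {e : G × A} (he : e ∈ T) :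
    ∃ b : Brick S R T e, b.IsFlat := by
  obtain ⟨L, hL⟩ := exists_line hT R e.1
  rcases nf_edge hT he with h | h
  · have h' : S.nf T (L.dgm.pr L.top * S.rep e.2) = S.nf T (L.dgm.pr L.top) ++ [e.2] := by
      rw [hL.pr_top, h]
    refine ⟨⟨L, hL, L.push e.2 h', _, (Run.refl L).push e.2 h', Sum.inr false, ?_, rfl, ?_⟩,
      hL.isEmpty, Or.inl rfl⟩
    · simp [hL.done]
    · show L.dgm.pr L.top * _ = _
      rw [hL.pr_top]
  · have h1 := L.dgm.tp_label L.top
    rw [hL.pr_top, h] at h1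
    obtain ⟨M, M', h2, -, h3⟩ := List.map_eq_append_iff.1 h1
    obtain ⟨d, rfl, hd⟩ := List.map_eq_singleton_iff.1 h3
    have h4 := L.dgm.pr_tgt d
    rw [(L.dgm.tp_spec h2).2, hL.pr_top, hd, S.rep_inv] at h4
    refine ⟨⟨L, hL, L.pop h2, _, (Run.refl L).pop h2, L.dgm.rev d, ?_, ?_, ?_⟩, hL.isEmpty,
      Or.inr ?_⟩
    · simp [hL.done]
    · rw [L.dgm.label_rev, hd, S.inv_inv]
    · rw [h4]; simp
    · show L.dgm.tp L.top = L.dgm.tp (L.dgm.src d) ++ [L.dgm.rev (L.dgm.rev d)]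
      rw [(L.dgm.tp_spec h2).1, L.dgm.rev_rev, h2]

/-- In the row of bricks `done` is exactly the path labelled $z$, and the closing 2-cell is attached
along all of it. -/
theorem exists_built_brick (hT : S.IsMaximalTree T) {e : G × A} {g : G} {z : List A} (hg : g = e.1)
    (hz : z ++ [S.inv e.2] ∈ R) (hne : z ≠ []) (hv : S.val z = S.rep e.2)
    (B : ∀ i, Brick S R T (S.stepEdge g z i)) : ∃ b : Brick S R T e, b.IsBuiltFrom B := by
  subst hg
  obtain ⟨L, hL⟩ := exists_line hT R e.1
  obtain ⟨X, j, κ, q, h⟩ := exists_chain e.1 z B hL z.length le_rfl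
  have hlab := h.label_done
  have hr : X.done.map X.dgm.label ++ [S.inv e.2] ∈ R := by rwa [hlab]
  have hp0 : X.dgm.pr (q 0) = e.1 := by rw [h.pr 0 (Nat.zero_le _)]; simp
  have htop : X.dgm.pr X.top = e.1 * S.rep e.2 := by
    rw [← h.top, h.pr _ le_rfl, List.take_length, hv]
  have hy : X.dgm.pr X.top = X.dgm.pr (q 0) * S.rep e.2 := by rw [htop, hp0]
  have hne' : X.done ≠ [] := fun h0 => hne (by rw [← hlab, h0]; rfl)
  have hD : X.done = [] ++ X.done := rfl
  have hZ := h.isPath_done hL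
  refine ⟨⟨L, hL, X.cell hD hne' hZ e.2 hr hy, _, h.run.cell hD hne' hZ e.2 hr hy,
    Sum.inr false, rfl, rfl, htop⟩, fun i => (Dgm.inCell hZ e.2 hr hy).comp (κ i i.2), q, none,
    h.start, h.top, h.pr, fun i => h.bot i i.2, fun i => h.map_top i i.2, ?_, ?_, ?_⟩
  · have h1 := congrArg (List.map (Sum.inl (β := Bool))) h.done_eq
    rw [List.map_ofFn] at h1
    exact congrArg (· ++ [Sum.inr true]) h1
  · intro i f hf
    cases hf
  · rintro (_ | f) hf
    · exact absurd rfl hf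
    · obtain ⟨i, hi, c, hc⟩ := h.face f
      refine ⟨⟨i, c⟩, congrArg some hc, ?_⟩
      rintro ⟨i', c'⟩ hc'
      exact h.unique _ _ _ _ _ _ ((Option.some_injective _ hc').trans hc.symm)

/-- The initial vertex is written as the value of its normal form, to agree with the edges in
`IsBuiltAt`. -/
theorem stepEdge_mem {Φ : G × A → List A} (hT : S.IsMaximalTree T) (e : G × A)
    (i : Fin (Φ e).length) :
    S.stepEdge (S.val (S.nf T e.1)) (Φ e) i ∈ S.pathEdges e.1 (Φ e) := by
  rw [stepEdge, val_nf hT]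
  exact mem_pathEdges_get S e.1 (Φ e) i

/-- A coherent family of bricks, built recursively from the flow function. -/
theorem exists_bricks (hT : S.IsMaximalTree T) {Φ : G × A → List A} (hΦ : S.IsBoundedFlow T Φ) :
    ∃ B : ∀ e, Brick S (S.flowRelators Φ) T e, ∀ e, (e ∈ T → (B e).IsFlat) ∧
      (e ∉ T → (B e).IsBuiltFrom fun i => B (S.stepEdge (S.val (S.nf T e.1)) (Φ e) i)) := by
  have key : ∀ e (ih : ∀ e', (e' ∈ S.pathEdges e.1 (Φ e) ∧ e ∉ T) →
      Brick S (S.flowRelators Φ) T e'), ∃ b : Brick S (S.flowRelators Φ) T e,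
      (e ∈ T → b.IsFlat) ∧ ∀ h : e ∉ T, b.IsBuiltFrom
        fun i => ih (S.stepEdge (S.val (S.nf T e.1)) (Φ e) i) ⟨stepEdge_mem hT e i, h⟩ := by
    intro e ih
    by_cases he : e ∈ T
    · obtain ⟨b, hb⟩ := exists_flat_brick hT (S.flowRelators Φ) he
      exact ⟨b, fun _ => hb, fun h => absurd he h⟩
    · obtain ⟨b, hb⟩ := exists_built_brick hT (e := e) (val_nf hT e.1) (FlowRel.basic e)
        (flow_ne_nil hΦ e) (val_flow hΦ e)
        (fun i => ih (S.stepEdge (S.val (S.nf T e.1)) (Φ e) i) ⟨stepEdge_mem hT e i, he⟩)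
      exact ⟨b, fun h => absurd h he, fun _ => hb⟩
  -- The brick at `e` is chosen as a function of the bricks at smaller edges; recursion then makes
  -- the whole family coherent.
  choose F hF using key
  refine ⟨(wellFounded_flow hΦ).fix F, fun e => ?_⟩
  have h := hF e fun e' _ => (wellFounded_flow hΦ).fix F e'
  rw [← (wellFounded_flow hΦ).fix_eq F e] at h
  exact h

end SymGens

/-! ### Bricks satisfy the prescribed recursion -/

namespace SymGens

variable {G : Type u} [Group G] {A : Type v} {S : SymGens G A} {T : Set (G × A)}
  {Φ : G × A → List A}

theorem LMap.map_outer {R : Set (List A)} {e : G × A} (b : Brick S R T e) {K : S.Dgm R T}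
    (κ : LMap b.st.dgm K) :
    (b.st.pre ++ b.st.done ++ b.st.dgm.revPath (b.st.dgm.tp b.st.top)).map κ.onD =
      K.tp (κ.onV b.bot) ++ [κ.onD b.edge] ++ K.revPath (K.tp (κ.onV b.st.top)) := by
  rw [b.pre_eq, b.done, List.map_append, List.map_append, κ.map_tp, κ.map_tp,
    TwoComplex.CellMap.map_revPath]
  rfl

theorem isRecursivelyBuilt (hΦ : S.IsBoundedFlow T Φ)
    (B : ∀ e, Brick S (S.flowRelators Φ) T e)
    (hB : ∀ e, (e ∈ T → (B e).IsFlat) ∧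
      (e ∉ T → (B e).IsBuiltFrom fun i => B (S.stepEdge (S.val (S.nf T e.1)) (Φ e) i))) :
    S.IsRecursivelyBuilt (fun e => (B e).diagram) := by
  intro e
  refine ⟨fun he => ((hB e).1 he).1, fun he => ?_⟩
  obtain ⟨κ, q, c, h1, h2, h3, h4, h5, h6, h7, h8⟩ := (hB e).2 he
  have hE : e.1 * S.val (Φ e) = e.1 * S.rep e.2 := by rw [val_flow hΦ]
  -- The decomposition of the flow path is free; with $x_g$ and $x_h$ empty, $z$ is all of $\Phi(e)$
  -- and the new edge is the only new boundary.
  refine ⟨S.nf T e.1, [], S.nf T (e.1 * S.rep e.2), [], Φ e, by simp, by simp, by simp, ?_⟩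
  refine ⟨fun i => (κ i).toCellMap, fun i => (B e).st.dgm.tp (q i), fun i => (κ i).onD (B _).edge,
    [], [], (B e).edge, c, fun i => (κ i).map_base, fun i => (κ i).map_label, ?_, ?_, ?_, rfl, rfl,
    ?_, h7, h8⟩
  · intro i hi
    rw [← h3 i hi]
    exact (B e).st.dgm.tp_label (q i)
  · intro i
    simp only [← h4, ← h5]
    exact (κ i).map_outer (B _)
  · have h9 : (B e).st.pre ++ (B e).st.done ++ (B e).st.dgm.revPath ((B e).st.dgm.tp (B e).st.top) =
        (B e).st.dgm.tp (q 0) ++ [] ++ [(B e).edge] ++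
          (B e).st.dgm.revPath ((B e).st.dgm.tp (q (Φ e).length) ++ []) := by
      rw [(B e).pre_eq, (B e).done, h1, h2, List.append_nil, List.append_nil]
    exact h9
  · simp only [TwoComplex.revPath_nil, List.nil_append, List.append_nil]
    rw [show (B e).diagram.bdry c = _ from h6]
    exact List.IsRotated.refl _

end SymGens

namespace TwoComplex

section Topology

variable {K : TwoComplex.{u, v, w}} {L : TwoComplex.{u', v', w'}}

/-! ### Points and continuous maps -/

theorem pt_edge_zero (d : K.D) : K.pt (.edge d 0) = K.pt (.vert (K.src d)) :=
  Quot.sound (.edge_zero d)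

theorem pt_edge_rev (d : K.D) (t : I) : K.pt (.edge (K.rev d) (σ t)) = K.pt (.edge d t) :=
  (Quot.sound (.edge_rev d t)).symm

theorem pt_edge_rev' (d : K.D) (t : I) : K.pt (.edge (K.rev d) t) = K.pt (.edge d (σ t)) := by
  rw [← pt_edge_rev d (σ t), symm_symm]

theorem pt_edge_one (d : K.D) : K.pt (.edge d 1) = K.pt (.vert (K.tgt d)) := by
  rw [← pt_edge_rev, symm_one, pt_edge_zero]; rfl

theorem pt_face_one (f : K.F) (k : Fin (K.bdry f).length) (t : I) :
    K.pt (.face f k t 1) = K.pt (.edge ((K.bdry f).get k) t) := Quot.sound (.face_boundary f k t)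

theorem pt_face_zero (f : K.F) (k k' : Fin (K.bdry f).length) (t t' : I) :
    K.pt (.face f k t 0) = K.pt (.face f k' t' 0) := Quot.sound (.face_center f k k' t t')

theorem pt_face_side (f : K.F) (k : Fin (K.bdry f).length) (r : I) :
    K.pt (.face f k 1 r) = K.pt (.face f (cyclicNext k) 0 r) := Quot.sound (.face_side f k r)

theorem continuous_edge (d : K.D) : Continuous fun t : I => K.pt (.edge d t) :=
  continuous_iff_coinduced_le.2 (le_sup_of_le_left (le_iSup
    (fun d : K.D => TopologicalSpace.coinduced (fun t : I => K.pt (.edge d t)) inferInstance) d))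

theorem continuous_face (f : K.F) (k : Fin (K.bdry f).length) :
    Continuous fun q : I × I => K.pt (.face f k q.1 q.2) :=
  continuous_iff_coinduced_le.2 (le_sup_of_le_right (le_iSup
    (fun s : (Σ f : K.F, Fin (K.bdry f).length) => TopologicalSpace.coinduced
      (fun q : I × I => K.pt (.face s.1 s.2 q.1 q.2)) inferInstance) ⟨f, k⟩))

theorem continuous_of_cells {Y : Type*} [TopologicalSpace Y] {g : K.Space → Y}
    (he : ∀ d, Continuous fun t : I => g (K.pt (.edge d t)))
    (hf : ∀ f k, Continuous fun q : I × I => g (K.pt (.face f k q.1 q.2))) : Continuous g := by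
  refine continuous_sup_dom.2 ⟨continuous_iSup_dom.2 ?_, continuous_iSup_dom.2 ?_⟩
  · exact fun d => continuous_coinduced_dom.2 (he d)
  · rintro ⟨f, k⟩
    exact continuous_coinduced_dom.2 (hf f k)

theorem CellMap.onSpace_vert (m : CellMap K L) (x : K.V) :
    m.onSpace (K.pt (.vert x)) = L.pt (.vert (m.onV x)) := rfl

theorem CellMap.onSpace_edge (m : CellMap K L) (d : K.D) (t : I) :
    m.onSpace (K.pt (.edge d t)) = L.pt (.edge (m.onD d) t) := rfl

theorem CellMap.onSpace_face (m : CellMap K L) (f : K.F) (k : Fin (K.bdry f).length) (t r : I) :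
    m.onSpace (K.pt (.face f k t r)) =
      L.pt (.face (m.onF f) (k.cast (by rw [m.map_bdry]; simp)) t r) := rfl

theorem CellMap.continuous_onSpace (m : CellMap K L) : Continuous m.onSpace :=
  continuous_of_cells (fun d => continuous_edge (m.onD d)) fun _ _ => continuous_face _ _

/-- Cases on the cell that contains a point. -/
theorem Space.cases {P : K.Space → Prop} (p : K.Space) (hv : ∀ x, P (K.pt (.vert x)))
    (he : ∀ d t, P (K.pt (.edge d t))) (hf : ∀ f k t r, P (K.pt (.face f k t r))) : P p := by
  induction p using Quot.ind with
  | mk p => cases p with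
    | vert x => exact hv x
    | edge d t => exact he d t
    | face f k t r => exact hf f k t r

/-! ### Separation of the points of the 1-skeleton -/

/-- Radial extension of a function on the 1-skeleton. -/
def skelExt (g : K.V → ℝ) (h : K.D → I → ℝ) (h0 : ∀ d, h d 0 = g (K.src d))
    (hr : ∀ d t, h d t = h (K.rev d) (σ t)) : K.Space → ℝ :=
  Quot.lift (fun p => match p with
    | .vert x => g x
    | .edge d t => h d t
    | .face f k t r => r * h ((K.bdry f).get k) t) (by
    intro a b hab
    cases hab with
    | edge_zero d => exact h0 d
    | edge_rev d t => exact hr d t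
    | face_boundary f k t => simp
    | face_center f k k' t t' => simp
    | face_side f k r =>
      have := K.bdry_closed f k
      simp only
      rw [hr, symm_one, h0, h0, this])

theorem continuous_skelExt {g : K.V → ℝ} {h : K.D → I → ℝ} (h0) (hr)
    (hc : ∀ d, Continuous (h d)) : Continuous (skelExt g h h0 hr) :=
  continuous_of_cells hc fun _ _ =>
    (continuous_subtype_val.comp continuous_snd).mul ((hc _).comp continuous_fst)

open Classical in
/-- The barycentric coordinate of a vertex. -/
noncomputable def vertCoord (x : K.V) : K.Space → ℝ :=
  skelExt (fun y => if y = x then 1 else 0)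
    (fun d t => (1 - t) * (if K.src d = x then 1 else 0) + t * (if K.tgt d = x then 1 else 0))
    (fun d => by simp)
    (fun d t => by
      simp only [coe_symm_eq, tgt, K.rev_rev]
      by_cases h1 : K.src d = x <;> by_cases h2 : K.src (K.rev d) = x <;>
        simp only [h1, h2, if_true, if_false] <;> ring)

open Classical in
/-- A function that is positive precisely on the interior of an edge, within the 1-skeleton. -/
noncomputable def edgeCoord (e : K.D) : K.Space → ℝ :=
  skelExt (fun _ => 0)
    -- An asymmetric weight: the coordinates of an edge and of its reverse add up to $t(1-t)$, and
    -- the first divided by this sum is $t$.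
    (fun d t => (t : ℝ) ^ 2 * (1 - t) * (if d = e then 1 else 0) +
      (1 - (t : ℝ)) ^ 2 * t * (if K.rev d = e then 1 else 0))
    (fun d => by simp)
    (fun d t => by simp only [coe_symm_eq, K.rev_rev]; ring)

theorem continuous_vertCoord (x : K.V) : Continuous (vertCoord x) :=
  continuous_skelExt _ _ fun d => by fun_prop

theorem continuous_edgeCoord (e : K.D) : Continuous (edgeCoord e) :=
  continuous_skelExt _ _ fun d => by fun_prop

theorem vertCoord_vert (x y : K.V) : vertCoord x (K.pt (.vert y)) = open Classical in
    if y = x then 1 else 0 := rfl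

theorem edgeCoord_vert (e : K.D) (y : K.V) : edgeCoord e (K.pt (.vert y)) = 0 := rfl

theorem edgeCoord_edge (e d : K.D) (t : I) : edgeCoord e (K.pt (.edge d t)) = open Classical in
    (t : ℝ) ^ 2 * (1 - t) * (if d = e then 1 else 0) +
      (1 - (t : ℝ)) ^ 2 * t * (if K.rev d = e then 1 else 0) := rfl

theorem edgeCoord_self (d : K.D) (t : I) :
    edgeCoord d (K.pt (.edge d t)) = (t : ℝ) ^ 2 * (1 - t) := by
  simp [edgeCoord_edge, K.rev_ne]

theorem edgeCoord_rev_self (d : K.D) (t : I) :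
    edgeCoord (K.rev d) (K.pt (.edge d t)) = (1 - (t : ℝ)) ^ 2 * t := by
  simp [edgeCoord_edge, (K.rev_ne d).symm]

theorem coe_pos_of_ne_zero {t : I} (h : t ≠ 0) : (0 : ℝ) < t := unitInterval.pos_iff_ne_zero.2 h

theorem coe_lt_one_of_ne_one {t : I} (h : t ≠ 1) : (t : ℝ) < 1 := unitInterval.lt_one_iff_ne_one.2 h

theorem vert_injective {x y : K.V} (h : K.pt (.vert x) = K.pt (.vert y)) : x = y := by
  by_contra hxy
  have := congrArg (vertCoord x) h
  simp [vertCoord_vert, Ne.symm hxy] at this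

theorem edgeCoord_pos {d : K.D} {t : I} (h0 : t ≠ 0) (h1 : t ≠ 1) :
    0 < edgeCoord d (K.pt (.edge d t)) := by
  rw [edgeCoord_self]
  have := coe_pos_of_ne_zero h0
  have := sub_pos.2 (coe_lt_one_of_ne_one h1)
  positivity

/-- Two parametrized points of edges with equal edge coordinates agree, if one of them is
interior. -/
theorem edge_eq_of_edgeCoord {d d' : K.D} {t t' : I} (h0 : t ≠ 0) (h1 : t ≠ 1)
    (h : ∀ e, edgeCoord e (K.pt (.edge d t)) = edgeCoord e (K.pt (.edge d' t'))) :
    (d' = d ∧ t' = t) ∨ (d' = K.rev d ∧ t' = σ t) := by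
  have key : ∀ s : I, (∀ e, edgeCoord e (K.pt (.edge d t)) = edgeCoord e (K.pt (.edge d s))) →
      s = t := by
    intro s hs
    have e1 := hs d
    have e2 := hs (K.rev d)
    rw [edgeCoord_self, edgeCoord_self] at e1
    rw [edgeCoord_rev_self, edgeCoord_rev_self] at e2
    have a := coe_pos_of_ne_zero h0
    have b := sub_pos.2 (coe_lt_one_of_ne_one h1)
    have e3 : (s : ℝ) * (1 - s) = t * (1 - t) := by linear_combination -e1 - e2
    have e4 : (s : ℝ) * (t * (1 - t)) = t * (t * (1 - t)) := by
      linear_combination -e1 - s * e3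
    exact Subtype.ext (mul_right_cancel₀ (mul_pos a b).ne' e4)
  by_cases hd : d' = d
  · subst hd
    exact Or.inl ⟨rfl, key _ h⟩
  · by_cases hd' : K.rev d' = d
    · subst hd'
      refine Or.inr ⟨(K.rev_rev d').symm, ?_⟩
      rw [← key (σ t') (fun e => by rw [pt_edge_rev]; exact h e), symm_symm]
    · have := edgeCoord_pos (d := d) h0 h1
      rw [h d, edgeCoord_edge, if_neg hd, if_neg hd'] at this
      simp at this

theorem edge_eq_edge {d d' : K.D} {t t' : I} (h0 : t ≠ 0) (h1 : t ≠ 1)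
    (h : K.pt (.edge d t) = K.pt (.edge d' t')) :
    (d' = d ∧ t' = t) ∨ (d' = K.rev d ∧ t' = σ t) :=
  edge_eq_of_edgeCoord h0 h1 fun _ => by rw [h]

theorem edge_ne_vert {d : K.D} {t : I} (h0 : t ≠ 0) (h1 : t ≠ 1) (x : K.V) :
    K.pt (.edge d t) ≠ K.pt (.vert x) := fun h => by
  have := edgeCoord_pos (d := d) h0 h1
  rw [h, edgeCoord_vert] at this
  exact this.false

theorem oneSkeleton_cases {p : K.Space} (hp : p ∈ K.oneSkeleton) :
    (∃ x, p = K.pt (.vert x)) ∨ ∃ d t, t ≠ 0 ∧ t ≠ 1 ∧ p = K.pt (.edge d t) := by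
  rcases hp with h | ⟨d, t, rfl⟩
  · exact Or.inl h
  · by_cases h0 : t = 0
    · exact Or.inl ⟨_, by rw [h0, pt_edge_zero]⟩
    · by_cases h1 : t = 1
      · exact Or.inl ⟨_, by rw [h1, pt_edge_one]⟩
      · exact Or.inr ⟨d, t, h0, h1, rfl⟩

/-- Vertex and edge coordinates are continuous and separate the points of the 1-skeleton. The
Hausdorff property will exhibit the boundary of a diagram as a quotient of finitely many intervals.
-/
theorem t2Space_of_subset {Z : Set K.Space} (hZ : Z ⊆ K.oneSkeleton) : T2Space Z := by
  let F : Z → (K.V → ℝ) × (K.D → ℝ) := fun p => (fun x => vertCoord x p, fun e => edgeCoord e p)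
  have hF : Continuous F :=
    (continuous_pi fun x => (continuous_vertCoord x).comp continuous_subtype_val).prodMk
      (continuous_pi fun e => (continuous_edgeCoord e).comp continuous_subtype_val)
  refine T2Space.of_injective_continuous (f := F) ?_ hF
  rintro ⟨p, hp⟩ ⟨q, hq⟩ h
  have hV : ∀ x, vertCoord x p = vertCoord x q := fun x => congrFun (congrArg Prod.fst h) x
  have hD : ∀ e, edgeCoord e p = edgeCoord e q := fun e => congrFun (congrArg Prod.snd h) e
  refine Subtype.ext ?_
  rcases oneSkeleton_cases (hZ hp) with ⟨x, rfl⟩ | ⟨d, t, h0, h1, rfl⟩ <;>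
    rcases oneSkeleton_cases (hZ hq) with ⟨y, rfl⟩ | ⟨d', t', h0', h1', rfl⟩
  · have := hV x
    by_contra hxy
    have hne : y ≠ x := fun h => hxy (congrArg (fun z => K.pt (.vert z)) h.symm)
    simp [vertCoord_vert, hne] at this
  · have := edgeCoord_pos (d := d') h0' h1'
    rw [← hD, edgeCoord_vert] at this
    exact (lt_irrefl _ this).elim
  · have := edgeCoord_pos (d := d) h0 h1
    rw [hD, edgeCoord_vert] at this
    exact (lt_irrefl _ this).elim
  · rcases edge_eq_of_edgeCoord h0 h1 hD with ⟨rfl, rfl⟩ | ⟨rfl, rfl⟩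
    · rfl
    · exact (pt_edge_rev d t).symm

/-! ### Walking along an edge path at unit speed -/

/-- The nearest point of the unit interval. -/
noncomputable abbrev clamp (s : ℝ) : I := projIcc 0 1 zero_le_one s

theorem clamp_of_nonpos {s : ℝ} (h : s ≤ 0) : clamp s = 0 := projIcc_of_le_left _ h

theorem clamp_of_one_le {s : ℝ} (h : 1 ≤ s) : clamp s = 1 := projIcc_of_right_le _ h

theorem clamp_coe (t : I) : clamp t = t := projIcc_val _ t

@[fun_prop]
theorem continuous_clamp : Continuous clamp := continuous_projIcc

theorem clamp_ne {s : ℝ} (h0 : 0 < s) (h1 : s < 1) : clamp s ≠ 0 ∧ clamp s ≠ 1 := by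
  have h : clamp s = ⟨s, h0.le, h1.le⟩ := projIcc_of_mem _ ⟨h0.le, h1.le⟩
  rw [h]
  exact ⟨fun h => h0.ne' (congrArg Subtype.val h), fun h => h1.ne (congrArg Subtype.val h)⟩

variable (K) in
/-- The position at time `s` on the edge path that starts at `x`. -/
noncomputable def walk : K.V → List K.D → ℝ → K.Space
  | x, [], _ => K.pt (.vert x)
  | _, d :: P, s => if s ≤ 1 then K.pt (.edge d (clamp s)) else walk (K.tgt d) P (s - 1)

theorem walk_nonpos {x y : K.V} {P : List K.D} (h : K.IsPath x P y) {s : ℝ} (hs : s ≤ 0) :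
    K.walk x P s = K.pt (.vert x) := by
  cases P with
  | nil => rfl
  | cons d P =>
    rw [walk, if_pos (by linarith), clamp_of_nonpos hs, pt_edge_zero, h.1]

theorem walk_ge {x y : K.V} {P : List K.D} (h : K.IsPath x P y) {s : ℝ} (hs : P.length ≤ s) :
    K.walk x P s = K.pt (.vert y) := by
  induction P generalizing x s with
  | nil => rw [walk, show x = y from h]
  | cons d P ih =>
    simp only [List.length_cons, Nat.cast_add, Nat.cast_one] at hs
    rw [walk]
    split_ifs with h1
    · have h2 : (P.length : ℝ) = 0 := le_antisymm (by linarith) (Nat.cast_nonneg _)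
      rw [clamp_of_one_le (by linarith), pt_edge_one]
      have h3 : P = [] := List.eq_nil_of_length_eq_zero (by exact_mod_cast h2)
      rw [show K.tgt d = y by simpa [h3, IsPath] using h.2]
    · exact ih h.2 (by linarith)

theorem continuous_walk {x y : K.V} {P : List K.D} (h : K.IsPath x P y) :
    Continuous (K.walk x P) := by
  induction P generalizing x with
  | nil => exact continuous_const
  | cons d P ih =>
    show Continuous fun s : ℝ => if s ≤ 1 then K.pt (.edge d (clamp s)) else K.walk (K.tgt d) P (s - 1)
    refine Continuous.if_le ((continuous_edge d).comp continuous_clamp)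
      ((ih h.2).comp (continuous_id.sub continuous_const)) continuous_id continuous_const ?_
    intro s hs
    rw [show s = 1 from hs, clamp_of_one_le le_rfl, pt_edge_one]
    exact (walk_nonpos h.2 (by simp)).symm

theorem CellMap.onSpace_walk (m : CellMap K L) (x : K.V) (P : List K.D) (s : ℝ) :
    m.onSpace (K.walk x P s) = L.walk (m.onV x) (P.map m.onD) s := by
  induction P generalizing x s with
  | nil => rfl
  | cons d P ih =>
    rw [List.map_cons, walk, walk, m.map_tgt, ← ih]
    split_ifs <;> rfl

theorem walk_concat {x y : K.V} {P : List K.D} {d : K.D} (h : K.IsPath x (P ++ [d]) y) (s : ℝ) :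
    K.walk x (P ++ [d]) s =
      if s ≤ P.length then K.walk x P s else K.pt (.edge d (clamp (s - P.length))) := by
  induction P generalizing x s with
  | nil =>
    simp only [List.nil_append, List.length_nil, Nat.cast_zero, sub_zero, walk]
    split_ifs with h1 h2 h2
    · rw [clamp_of_nonpos h2, pt_edge_zero, h.1]
    · rfl
    · linarith
    · rw [clamp_of_one_le (by linarith), pt_edge_one]
  | cons e P ih =>
    rw [List.cons_append, walk, walk, ih h.2]
    simp only [List.length_cons, Nat.cast_add, Nat.cast_one]
    have : (0 : ℝ) ≤ P.length := Nat.cast_nonneg _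
    by_cases h1 : s ≤ 1
    · rw [if_pos h1, if_pos (by linarith), if_pos h1]
    · rw [if_neg h1, if_neg h1]
      by_cases h2 : s - 1 ≤ P.length
      · rw [if_pos h2, if_pos (by linarith)]
      · rw [if_neg h2, if_neg (by linarith)]
        congr 3; ring_nf

theorem walk_mem_oneSkeleton (x : K.V) (P : List K.D) (s : ℝ) : K.walk x P s ∈ K.oneSkeleton := by
  induction P generalizing x s with
  | nil => exact Or.inl ⟨x, rfl⟩
  | cons d P ih =>
    rw [walk]
    split_ifs
    · exact Or.inr ⟨_, _, rfl⟩
    · exact ih _ _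

/-- At any time a walk has run through an initial part of the path, up to a vertex at which it is, or
which is the end of the edge on which it is. -/
theorem walk_locate {x y : K.V} {P : List K.D} (h : K.IsPath x P y) (s : ℝ) :
    ∃ Q z, Q <+: P ∧ K.IsPath x Q z ∧
      (K.walk x P s = K.pt (.vert z) ∨
        ∃ d t, t ≠ 0 ∧ t ≠ 1 ∧ K.walk x P s = K.pt (.edge d t) ∧ K.tgt d = z) ∧
      ∀ s' ≤ s, K.walk x P s' = K.pt (.vert x) ∨ ∃ d ∈ Q, ∃ t, K.walk x P s' = K.pt (.edge d t) := by
  induction P generalizing x s with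
  | nil => exact ⟨[], x, List.prefix_rfl, rfl, Or.inl rfl, fun _ _ => Or.inl rfl⟩
  | cons d P ih =>
    rcases le_or_gt s 0 with h0 | h0
    · exact ⟨[], x, List.nil_prefix, rfl, Or.inl (walk_nonpos h h0),
        fun s' hs' => Or.inl (walk_nonpos h (hs'.trans h0))⟩
    rcases le_or_gt s 1 with h1 | h1
    · refine ⟨[d], K.tgt d, by simp, ⟨h.1, rfl⟩, ?_, fun s' hs' => Or.inr ⟨d, by simp, clamp s', ?_⟩⟩
      · rcases h1.lt_or_eq with h2 | rfl
        · obtain ⟨h3, h4⟩ := clamp_ne h0 h2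
          exact Or.inr ⟨d, clamp s, h3, h4, by rw [walk, if_pos h1], rfl⟩
        · exact Or.inl (by rw [walk, if_pos h1, clamp_of_one_le le_rfl, pt_edge_one])
      · rw [walk, if_pos (hs'.trans h1)]
    · obtain ⟨Q, z, h2, h3, h4, h5⟩ := ih h.2 (s - 1)
      refine ⟨d :: Q, z, List.cons_prefix_cons.2 ⟨rfl, h2⟩, ⟨h.1, h3⟩, ?_, fun s' hs' => Or.inr ?_⟩
      · rwa [walk, if_neg (by linarith)]
      · rw [walk]
        split_ifs with h6
        · exact ⟨d, by simp, _, rfl⟩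
        · rcases h5 (s' - 1) (by linarith) with h7 | ⟨e, he, t, h7⟩
          · exact ⟨d, by simp, 1, by rw [h7, pt_edge_one]⟩
          · exact ⟨e, by simp [he], t, h7⟩

end Topology

end TwoComplex

namespace TwoComplex

/-! ### Gluing homotopies -/

section Glue

variable {n : ℕ}

/-- The index of the part that contains `u`, if the interval is divided into `n` parts. -/
noncomputable def partIdx (hn : 0 < n) (u : I) : Fin n := ⟨min ⌊(n : ℝ) * u⌋₊ (n - 1), by omega⟩

/-- The parameter of `u` within its part. -/
noncomputable def partPar (hn : 0 < n) (u : I) : I := clamp (n * u - (partIdx hn u : ℕ))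

theorem partIdx_zero (hn : 0 < n) : partIdx hn 0 = ⟨0, hn⟩ := by
  simp [partIdx]

theorem partPar_zero (hn : 0 < n) : partPar hn 0 = 0 := by
  rw [partPar, partIdx_zero]
  exact clamp_of_nonpos (by simp)

theorem partIdx_one (hn : 0 < n) : partIdx hn 1 = ⟨n - 1, by omega⟩ := by
  simp [partIdx]

theorem partPar_one (hn : 0 < n) : partPar hn 1 = 1 := by
  rw [partPar, partIdx_one]
  refine clamp_of_one_le ?_
  simp only [Nat.cast_sub (show 1 ≤ n from hn)]
  simp

/-- The closed strips over the parts form a finite cover, and on strip $i$ the map is `f i` after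
rescaling. On the edge shared by two strips `partIdx` selects the later one, and `hc` compares the
two values. -/
theorem continuous_glue {X Y : Type*} [TopologicalSpace X] [TopologicalSpace Y] (hn : 0 < n)
    (f : Fin n → I × X → Y) (hf : ∀ i, Continuous (f i))
    (hc : ∀ (i : ℕ) (h : i + 1 < n) x, f ⟨i, by omega⟩ (1, x) = f ⟨i + 1, h⟩ (0, x)) :
    Continuous fun p : I × X => f (partIdx hn p.1) (partPar hn p.1, p.2) := by
  have hcu : Continuous fun p : I × X => (n : ℝ) * (p.1 : ℝ) := by fun_prop
  refine LocallyFinite.continuous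
    (f := fun i : Fin n => {p : I × X | (i : ℝ) ≤ n * p.1 ∧ (n : ℝ) * p.1 ≤ i + 1})
    (locallyFinite_of_finite _) ?_ ?_ ?_
  · refine eq_univ_of_forall fun p => mem_iUnion.2 ⟨partIdx hn p.1, ?_, ?_⟩
    · have h1 : (0 : ℝ) ≤ n * p.1 := mul_nonneg (Nat.cast_nonneg _) p.1.2.1
      refine le_trans ?_ (Nat.floor_le h1)
      exact_mod_cast min_le_left _ _
    · rcases le_total ⌊(n : ℝ) * p.1⌋₊ (n - 1) with h | h
      · simp only [partIdx, min_eq_left h]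
        exact (Nat.lt_floor_add_one _).le
      · simp only [partIdx, min_eq_right h]
        rw [Nat.cast_sub (show 1 ≤ n from hn)]
        have := mul_le_mul_of_nonneg_left p.1.2.2 (Nat.cast_nonneg n : (0 : ℝ) ≤ n)
        simpa using this
  · intro i
    exact (isClosed_le continuous_const hcu).inter (isClosed_le hcu continuous_const)
  · intro i
    have hg : Continuous fun p : I × X => f i (clamp (n * p.1 - (i : ℕ)), p.2) :=
      (hf i).comp ((continuous_clamp.comp (hcu.sub continuous_const)).prodMk continuous_snd)
    refine hg.continuousOn.congr ?_
    rintro ⟨u, x⟩ ⟨h1, h2⟩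
    simp only at h1 h2 ⊢
    have h3 : i.1 ≤ ⌊(n : ℝ) * u⌋₊ := Nat.le_floor h1
    have h4 : ⌊(n : ℝ) * u⌋₊ ≤ i.1 + 1 := by
      have h5 := Nat.floor_le_floor h2
      rwa [show (i : ℝ) + 1 = ((i.1 + 1 : ℕ) : ℝ) by push_cast; rfl, Nat.floor_natCast] at h5
    have hi := i.2
    by_cases h6 : partIdx hn u = i
    · rw [partPar, h6]
    · have h7 : ⌊(n : ℝ) * u⌋₊ = i.1 + 1 := by
        by_contra h8
        refine h6 (Fin.ext ?_)
        simp only [partIdx]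
        omega
      have h8 : i.1 + 1 < n := by
        by_contra h9
        refine h6 (Fin.ext ?_)
        simp only [partIdx]
        omega
      have h9 : partIdx hn u = ⟨i.1 + 1, h8⟩ := Fin.ext (by simp only [partIdx]; omega)
      have h10 : (n : ℝ) * u = i + 1 := by
        refine le_antisymm h2 ?_
        have := Nat.floor_le (mul_nonneg (Nat.cast_nonneg n) u.2.1 : (0 : ℝ) ≤ n * u)
        rw [h7] at this
        exact_mod_cast this
      rw [partPar, h9, h10, clamp_of_nonpos (by simp), clamp_of_one_le (by simp)]
      exact (hc i.1 h8 x).symm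

variable {Y : Type*}

/-- Half of the homotopy `crossing`. -/
noncomputable def halfCrossing (F F' : I × I → Y) (p : I × ℝ) : Y :=
  -- The point at parameter $t$ first moves inwards to radius $1-2t$, then around to the ray at
  -- parameter $0$, which both sectors share; in the second sector it does the same backwards. Each
  -- of the four moves takes one unit of time. For $t=0$ nothing moves, for $t=\frac12$ the path
  -- runs through the centre.
  if p.2 ≤ 2 then F (p.1 * clamp (2 - p.2), max (clamp (1 - 2 * p.1)) (clamp (1 - p.2)))
  else F' (p.1 * clamp (p.2 - 2), max (clamp (1 - 2 * p.1)) (clamp (p.2 - 3)))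

/-- A homotopy across a disc, which is given in polar coordinates on two sectors. -/
noncomputable def crossing (F F' : I × I → Y) (p : I × ℝ) : Y :=
  if (p.1 : ℝ) ≤ 1 / 2 then halfCrossing F F' p
  else halfCrossing (fun q => F (σ q.1, q.2)) (fun q => F' (σ q.1, q.2)) (σ p.1, p.2)

variable {F F' : I × I → Y}

theorem continuous_halfCrossing [TopologicalSpace Y] (hF : Continuous F) (hF' : Continuous F')
    (h0 : ∀ r, F (0, r) = F' (0, r)) : Continuous (halfCrossing F F') := by
  refine Continuous.if_le (hF.comp ?_) (hF'.comp ?_) continuous_snd continuous_const ?_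
  · fun_prop
  · fun_prop
  · rintro ⟨t, s⟩ hs
    simp only at hs
    subst hs
    rw [clamp_of_nonpos (s := 2 - 2) (by norm_num), clamp_of_nonpos (s := 1 - 2) (by norm_num),
      clamp_of_nonpos (s := 2 - 3) (by norm_num), mul_zero, h0]

/-- The halves meet at $t=\frac12$. There they disagree about the angle only while the radius is
$0$, and by `hz` and `hz'` the angle is then irrelevant. -/
theorem continuous_crossing [TopologicalSpace Y] (hF : Continuous F) (hF' : Continuous F')
    (h0 : ∀ r, F (0, r) = F' (0, r)) (h1 : ∀ r, F (1, r) = F' (1, r))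
    (hz : ∀ u u', F (u, 0) = F (u', 0)) (hz' : ∀ u u', F' (u, 0) = F' (u', 0)) :
    Continuous (crossing F F') := by
  refine Continuous.if_le (continuous_halfCrossing hF hF' h0)
    ((continuous_halfCrossing (hF.comp (by fun_prop)) (hF'.comp (by fun_prop)) ?_).comp
      (by fun_prop)) (by fun_prop) continuous_const ?_
  · intro r; simp [h1]
  · rintro ⟨t, s⟩ ht
    simp only at ht
    have hσ : σ t = t := Subtype.ext (by rw [coe_symm_eq, ht]; norm_num)
    simp only [halfCrossing, hσ]
    rw [ht, clamp_of_nonpos (s := 1 - 2 * (1 / 2)) (by norm_num)]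
    split_ifs with hs
    · rcases le_or_gt s 1 with hs1 | hs1
      · rw [clamp_of_one_le (s := 2 - s) (by linarith), mul_one, hσ]
      · rw [clamp_of_nonpos (s := 1 - s) (by linarith), max_self]
        exact hz _ _
    · rcases le_or_gt s 3 with hs1 | hs1
      · rw [clamp_of_nonpos (s := s - 3) (by linarith), max_self]
        exact hz' _ _
      · rw [clamp_of_one_le (s := s - 2) (by linarith), mul_one, hσ]

theorem halfCrossing_nonpos {t : I} {s : ℝ} (hs : s ≤ 0) : halfCrossing F F' (t, s) = F (t, 1) := by
  rw [halfCrossing, if_pos (show s ≤ 2 by linarith)]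
  simp only
  rw [clamp_of_one_le (s := 2 - s) (by linarith), clamp_of_one_le (s := 1 - s) (by linarith), mul_one,
    max_eq_right le_one']

theorem halfCrossing_ge {t : I} {s : ℝ} (hs : 4 ≤ s) : halfCrossing F F' (t, s) = F' (t, 1) := by
  rw [halfCrossing, if_neg (show ¬ s ≤ 2 by linarith)]
  simp only
  rw [clamp_of_one_le (s := s - 2) (by linarith), clamp_of_one_le (s := s - 3) (by linarith), mul_one,
    max_eq_right le_one']

/-- The radius is a maximum of two numbers less than $1$. Hence a crossing point stays in the open
2-cell strictly between its start and its arrival, which makes it `Near` the vertices of that cell.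
-/
theorem halfCrossing_mid {t : I} {s : ℝ} (ht : t ≠ 0) (hs : 0 < s) (hs' : s < 4) :
    ∃ u r, r ≠ 1 ∧ (halfCrossing F F' (t, s) = F (u, r) ∨ halfCrossing F F' (t, s) = F' (u, r)) := by
  have h1 : clamp (1 - 2 * t) ≠ 1 := fun h => by
    have h2 := coe_pos_of_ne_zero ht
    rcases le_or_gt (1 - 2 * (t : ℝ)) 0 with h3 | h3
    · rw [clamp_of_nonpos h3] at h; exact zero_ne_one h
    · exact (clamp_ne h3 (by linarith)).2 h
  have h2 : ∀ s : ℝ, s < 1 → clamp s ≠ 1 := fun s hs h => by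
    rcases le_or_gt s 0 with h3 | h3
    · rw [clamp_of_nonpos h3] at h; exact zero_ne_one h
    · exact (clamp_ne h3 hs).2 h
  have h3 : ∀ a b : I, a ≠ 1 → b ≠ 1 → max a b ≠ 1 := fun a b ha hb h => by
    rcases max_choice a b with h4 | h4
    · exact ha (h4 ▸ h)
    · exact hb (h4 ▸ h)
  unfold halfCrossing
  split_ifs
  · exact ⟨_, _, h3 _ _ h1 (h2 (1 - s) (by linarith)), Or.inl rfl⟩
  · exact ⟨_, _, h3 _ _ h1 (h2 (s - 3) (by linarith)), Or.inr rfl⟩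

theorem crossing_nonpos {t : I} {s : ℝ} (hs : s ≤ 0) : crossing F F' (t, s) = F (t, 1) := by
  unfold crossing
  split_ifs
  · exact halfCrossing_nonpos hs
  · rw [halfCrossing_nonpos hs, symm_symm]

theorem crossing_ge {t : I} {s : ℝ} (hs : 4 ≤ s) : crossing F F' (t, s) = F' (t, 1) := by
  unfold crossing
  split_ifs
  · exact halfCrossing_ge hs
  · rw [halfCrossing_ge hs, symm_symm]

theorem crossing_mid {t : I} {s : ℝ} (ht : t ≠ 0) (ht' : t ≠ 1) (hs : 0 < s) (hs' : s < 4) :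
    ∃ u r, r ≠ 1 ∧ (crossing F F' (t, s) = F (u, r) ∨ crossing F F' (t, s) = F' (u, r)) := by
  unfold crossing
  split_ifs
  · exact halfCrossing_mid ht hs hs'
  · obtain ⟨u, r, hr, h⟩ := halfCrossing_mid (F := fun q => F (σ q.1, q.2))
      (F' := fun q => F' (σ q.1, q.2)) (t := σ t)
      (fun h => ht' (by rw [← symm_symm t, h, symm_zero])) hs hs'
    exact ⟨σ u, r, hr, h⟩

theorem halfCrossing_zero (h0 : ∀ r, F (0, r) = F' (0, r)) (s : ℝ) :
    halfCrossing F F' (0, s) = F (0, 1) := by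
  unfold halfCrossing
  simp only [zero_mul, Set.Icc.coe_zero, mul_zero, sub_zero]
  rw [clamp_of_one_le le_rfl, max_eq_left le_one', max_eq_left le_one', ← h0, ite_self]

theorem crossing_zero (h0 : ∀ r, F (0, r) = F' (0, r)) (s : ℝ) : crossing F F' (0, s) = F (0, 1) := by
  rw [crossing, if_pos (by simp), halfCrossing_zero h0]

theorem crossing_one (h1 : ∀ r, F (1, r) = F' (1, r)) (s : ℝ) : crossing F F' (1, s) = F (1, 1) := by
  rw [crossing, if_neg (by simp; norm_num)]
  simp only [symm_one]
  rw [halfCrossing_zero (fun r => by simp [h1])]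
  simp

end Glue

end TwoComplex

/-! ### Combings of edges and of the boundary -/

namespace TwoComplex

variable {K : TwoComplex.{u, v, w}} {L : TwoComplex.{u', v', w'}}

/-- `p` is an interior point of an edge that starts at `x`, or of a 2-cell that has such an edge in its
boundary. -/
def Near (p : K.Space) (x : K.V) : Prop :=
  (∃ d t, t ≠ 0 ∧ t ≠ 1 ∧ p = K.pt (.edge d t) ∧ K.src d = x) ∨
    ∃ f k t r, r ≠ 1 ∧ p = K.pt (.face f k t r) ∧ ∃ d ∈ K.bdry f, K.src d = x

theorem Near.map (m : CellMap K L) {p : K.Space} {x : K.V} (h : Near p x) :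
    Near (m.onSpace p) (m.onV x) := by
  rcases h with ⟨d, t, h0, h1, rfl, rfl⟩ | ⟨f, k, t, r, hr, rfl, d, hd, rfl⟩
  · exact Or.inl ⟨m.onD d, t, h0, h1, rfl, m.map_src d⟩
  · refine Or.inr ⟨m.onF f, _, t, r, hr, rfl, m.onD d, ?_, m.map_src d⟩
    rw [m.map_bdry]
    exact List.mem_map_of_mem hd

/-- The composition of cellular maps. -/
def CellMap.comp {J : TwoComplex} (g : CellMap L J) (f : CellMap K L) : CellMap K J where
  onV x := g.onV (f.onV x)
  onD d := g.onD (f.onD d)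
  onF c := g.onF (f.onF c)
  map_src d := by rw [g.map_src, f.map_src]
  map_rev d := by rw [g.map_rev, f.map_rev]
  map_bdry c := by rw [g.map_bdry, f.map_bdry]; simp

theorem CellMap.onSpace_comp {J : TwoComplex} (g : CellMap L J) (f : CellMap K L) (p : K.Space) :
    (g.comp f).onSpace p = g.onSpace (f.onSpace p) := by
  induction p using Space.cases <;> rfl

theorem CellMap.onSpace_id (p : K.Space) : (CellMap.id K).onSpace p = p := by
  induction p using Space.cases <;> rfl

end TwoComplex

namespace SymGens

open TwoComplex

variable {G : Type u} [Group G] {A : Type v} {S : SymGens G A} {R : Set (List A)} {T : Set (G × A)}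

/-- The walk along the tree path to `x`. -/
noncomputable def Dgm.treeWalk (Δ : S.Dgm R T) (x : Δ.V) (s : ℝ) : Δ.Space :=
  Δ.walk Δ.base (Δ.tp x) s

theorem LMap.onSpace_treeWalk {Δ Δ' : S.Dgm R T} (m : LMap Δ Δ') (x : Δ.V) (s : ℝ) :
    m.onSpace (Δ.treeWalk x s) = Δ'.treeWalk (m.onV x) s := by
  rw [Dgm.treeWalk, CellMap.onSpace_walk, m.map_base, ← m.map_tp]; rfl

/-- `p` precedes `p'` on a path of the combing: both points are on the walk along a tree path, or `p`
is in the diagram of an edge, and `p'` is close to the initial vertex of that edge. -/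
def Precedes (B : ∀ e, Brick S R T e) {Δ : S.Dgm R T} (p p' : Δ.Space) : Prop :=
  (∃ x s s', s ≤ s' ∧ p = Δ.treeWalk x s ∧ p' = Δ.treeWalk x s') ∨
    ∃ e ∉ T, ∃ m : LMap (B e).st.dgm Δ, p ∈ range m.onSpace ∧ Near p' (m.onV (B e).bot)

variable {B : ∀ e, Brick S R T e}

theorem Precedes.map {Δ Δ' : S.Dgm R T} (m : LMap Δ Δ') {p p' : Δ.Space} (h : Precedes B p p') :
    Precedes B (m.onSpace p) (m.onSpace p') := by
  rcases h with ⟨x, s, s', hs, rfl, rfl⟩ | ⟨e, he, m', ⟨p, rfl⟩, hp⟩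
  · exact Or.inl ⟨m.onV x, s, s', hs, m.onSpace_treeWalk x s, m.onSpace_treeWalk x s'⟩
  · exact Or.inr ⟨e, he, m.comp m', ⟨p, CellMap.onSpace_comp _ _ _⟩, hp.map m.toCellMap⟩

/-- `Ψ` combs the edge `d`: at the ends of the edge it is given by the tree paths, and from the time
`N` on it has arrived. -/
structure IsCombing (B : ∀ e, Brick S R T e) {Δ : S.Dgm R T} (d : Δ.D) (Ψ : I × ℝ → Δ.Space)
    (N : ℕ) : Prop where
  continuous : Continuous Ψ
  nonpos : ∀ t s, s ≤ 0 → Ψ (t, s) = Δ.pt (.vert Δ.base)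
  ge : ∀ t s, (N : ℝ) ≤ s → Ψ (t, s) = Δ.pt (.edge d t)
  zero : ∀ s, Ψ (0, s) = Δ.treeWalk (Δ.src d) s
  one : ∀ s, Ψ (1, s) = Δ.treeWalk (Δ.tgt d) s
  precedes : ∀ t s s', s ≤ s' → Precedes B (Ψ (t, s)) (Ψ (t, s'))

theorem IsCombing.map {Δ Δ' : S.Dgm R T} (m : LMap Δ Δ') {d : Δ.D} {Ψ : I × ℝ → Δ.Space} {N : ℕ}
    (h : IsCombing B d Ψ N) : IsCombing B (m.onD d) (m.onSpace ∘ Ψ) N where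
  continuous := m.continuous_onSpace.comp h.continuous
  nonpos t s hs := by
    rw [Function.comp_apply, h.nonpos t s hs, CellMap.onSpace_vert, m.map_base]
  ge t s hs := by rw [Function.comp_apply, h.ge t s hs, CellMap.onSpace_edge]
  zero s := by rw [Function.comp_apply, h.zero, m.onSpace_treeWalk, m.map_src]
  one s := by rw [Function.comp_apply, h.one, m.onSpace_treeWalk, CellMap.map_tgt]
  precedes t s s' hs := (h.precedes t s s' hs).map m

theorem IsCombing.rev {Δ : S.Dgm R T} {d : Δ.D} {Ψ : I × ℝ → Δ.Space} {N : ℕ}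
    (h : IsCombing B d Ψ N) : IsCombing B (Δ.rev d) (fun p => Ψ (σ p.1, p.2)) N where
  continuous := h.continuous.comp (by fun_prop)
  nonpos t s hs := h.nonpos _ _ hs
  ge t s hs := by rw [h.ge _ _ hs, pt_edge_rev']
  zero s := by simp only [symm_zero]; exact h.one s
  one s := by simp only [symm_one, tgt_rev]; exact h.zero s
  precedes t s s' hs := h.precedes _ _ _ hs

theorem IsCombing.mono {Δ : S.Dgm R T} {d : Δ.D} {Ψ : I × ℝ → Δ.Space} {N M : ℕ}
    (h : IsCombing B d Ψ N) (hNM : N ≤ M) : IsCombing B d Ψ M :=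
  { h with ge := fun t s hs => h.ge t s (le_trans (by exact_mod_cast hNM) hs) }

/-- A tree edge is combed by walking along the tree. -/
theorem isCombing_tree (B : ∀ e, Brick S R T e) {Δ : S.Dgm R T} {d : Δ.D}
    (h : Δ.tp (Δ.tgt d) = Δ.tp (Δ.src d) ++ [d]) : ∃ Ψ N, IsCombing B d Ψ N := by
  set P := Δ.tp (Δ.src d) with hP
  have hpath : Δ.IsPath Δ.base (P ++ [d]) (Δ.tgt d) := h ▸ Δ.tp_path (Δ.tgt d)
  have hpath' : Δ.IsPath Δ.base P (Δ.src d) := Δ.tp_path (Δ.src d)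
  have hlen : (0 : ℝ) ≤ P.length := Nat.cast_nonneg _
  have hw : ∀ s : ℝ, (P.length : ℝ) ≤ s →
      Δ.treeWalk (Δ.tgt d) s = Δ.pt (.edge d (clamp (s - P.length))) := by
    intro s hs
    rw [Dgm.treeWalk, h, walk_concat hpath]
    split_ifs with h1
    · rw [le_antisymm h1 hs, sub_self, clamp_of_nonpos le_rfl, pt_edge_zero, walk_ge hpath' le_rfl]
    · rfl
  -- The walk to the far end is stopped when it has covered the fraction $t$ of its last edge; $t=0$
  -- gives the walk to the near end.
  refine ⟨fun p => Δ.treeWalk (Δ.tgt d) (min p.2 (P.length + p.1)), P.length + 1, ?_, ?_, ?_, ?_, ?_,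
    ?_⟩
  · exact (continuous_walk (Δ.tp_path _)).comp (by fun_prop)
  · intro t s hs
    exact walk_nonpos (Δ.tp_path _) ((min_le_left _ _).trans hs)
  · intro t s hs
    push_cast at hs
    have ht := t.2.2
    simp only
    rw [min_eq_right (by linarith), hw _ (by linarith [t.2.1]), add_sub_cancel_left, clamp_coe]
  · intro s
    simp only [Set.Icc.coe_zero, add_zero]
    rcases le_total s P.length with hs | hs
    · rw [min_eq_left hs, Dgm.treeWalk, h, walk_concat hpath, if_pos hs]; rfl
    · rw [min_eq_right hs, hw _ le_rfl, sub_self, clamp_of_nonpos le_rfl, pt_edge_zero]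
      exact (walk_ge hpath' hs).symm
  · intro s
    simp only [Set.Icc.coe_one]
    rcases le_total s (P.length + 1) with hs | hs
    · rw [min_eq_left hs]
    · rw [min_eq_right hs, hw _ (by linarith), hw _ (by linarith), clamp_of_one_le (by linarith),
        clamp_of_one_le (by linarith)]
  · intro t s s' hs
    exact Or.inl ⟨Δ.tgt d, _, _, min_le_min_right _ hs, rfl, rfl⟩

/-- If the edges of a path are combed, so is the new edge of a 2-cell that is attached along it. -/
theorem isCombing_cell {Δ : S.Dgm R T} {α : Δ.D} {n : ℕ} (hn : 0 < n)
    {ζ : Fin n → Δ.D} {q : ℕ → Δ.V} {c : Δ.F}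
    (hsrc : ∀ i, Δ.src (ζ i) = q i) (htgt : ∀ i, Δ.tgt (ζ i) = q (i + 1))
    (hα0 : Δ.src α = q 0) (hα1 : Δ.tgt α = q n)
    (hc : Δ.bdry c = List.ofFn ζ ++ [Δ.rev α])
    (hnear : ∀ p p' : Δ.Space, Near p' (q 0) → Precedes B p p')
    (hζ : ∀ i, ∃ Ψ N, IsCombing B (ζ i) Ψ N) : ∃ Ψ N, IsCombing B α Ψ N := by
  choose Ψ N' hΨ' using hζ
  obtain ⟨N, hN⟩ : ∃ N, ∀ i, N' i ≤ N :=
    ⟨Finset.univ.sup N', fun i => Finset.le_sup (Finset.mem_univ i)⟩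
  have hΨ : ∀ i, IsCombing B (ζ i) (Ψ i) N := fun i => (hΨ' i).mono (hN i)
  clear hΨ' hN
  have hlen : (Δ.bdry c).length = n + 1 := by rw [hc]; simp
  let κ : ∀ i : ℕ, i < n + 1 → Fin (Δ.bdry c).length := fun i hi => ⟨i, by rw [hlen]; exact hi⟩
  have hget : ∀ i : Fin n, (Δ.bdry c).get (κ i (by omega)) = ζ i := by
    intro i
    simp only [List.get_eq_getElem, hc, κ]
    rw [List.getElem_append_left (by simp)]
    simp
  have hgetn : (Δ.bdry c).get (κ n (by omega)) = Δ.rev α := by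
    simp only [List.get_eq_getElem, hc, κ]
    rw [List.getElem_append_right (by simp)]
    simp
  have hnext : ∀ i (hi : i < n), cyclicNext (κ i (by omega)) = κ (i + 1) (by omega) := by
    intro i hi
    refine Fin.ext ?_
    simp only [cyclicNext, κ, hlen]
    exact Nat.mod_eq_of_lt (by omega)
  have hnextn : cyclicNext (κ n (by omega)) = κ 0 (by omega) := by
    refine Fin.ext ?_
    simp only [cyclicNext, κ, hlen, Nat.mod_self]
  have hstep : ∀ (i : ℕ) (h : i + 1 < n) (s : ℝ),
      Ψ ⟨i, by omega⟩ (1, s) = Ψ ⟨i + 1, h⟩ (0, s) := by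
    intro i h s
    rw [(hΨ _).one, (hΨ _).zero, htgt, hsrc]
  -- The combings of successive edges of the path join, because both restrict to the tree walk at
  -- the common vertex.
  let Ω : I × ℝ → Δ.Space := fun p => Ψ (partIdx hn p.1) (partPar hn p.1, p.2)
  have hΩ : Continuous Ω := continuous_glue hn Ψ (fun i => (hΨ i).continuous) hstep
  -- `F` and `F'` are polar coordinates on the sectors of the cell over the path and over `α`. The
  -- boundary of the cell contains `α` reversed, hence the `σ` in `F'`.
  let F : I × I → Δ.Space := fun p =>
    Δ.pt (.face c (κ (partIdx hn p.1) (by omega)) (partPar hn p.1) p.2)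
  have hF : Continuous F := by
    refine continuous_glue hn (fun i p => Δ.pt (.face c (κ i (by omega)) p.1 p.2))
      (fun i => continuous_face c _) fun i h r => ?_
    simp only
    rw [pt_face_side, hnext i (by omega)]
  let F' : I × I → Δ.Space := fun p => Δ.pt (.face c (κ n (by omega)) (σ p.1) p.2)
  have hF' : Continuous F' := (continuous_face c (κ n (by omega))).comp
    (f := fun p : I × I => (σ p.1, p.2)) (by fun_prop)
  have h0 : ∀ r, F (0, r) = F' (0, r) := by
    intro r
    simp only [F, F', symm_zero, partPar_zero, partIdx_zero]
    rw [pt_face_side, hnextn]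
  have h1 : ∀ r, F (1, r) = F' (1, r) := by
    intro r
    simp only [F, F', symm_one, partPar_one, partIdx_one]
    rw [pt_face_side, hnext _ (by omega)]
    congr 3
    all_goals omega
  have hΓ : Continuous (crossing F F') :=
    continuous_crossing hF hF' h0 h1 (fun _ _ => pt_face_zero _ _ _ _ _)
      (fun _ _ => pt_face_zero _ _ _ _ _)
  have hF1 : ∀ t s, (N : ℝ) ≤ s → F (t, 1) = Ω (t, s) := by
    intro t s hs
    simp only [F, Ω]
    rw [pt_face_one, hget, (hΨ _).ge _ _ hs]
  have hF'1 : ∀ t, F' (t, 1) = Δ.pt (.edge α t) := by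
    intro t
    simp only [F']
    rw [pt_face_one, hgetn, pt_edge_rev]
  have hΩ0 : ∀ s, Ω (0, s) = Δ.treeWalk (Δ.src α) s := by
    intro s
    simp only [Ω, partIdx_zero, partPar_zero]
    rw [(hΨ _).zero, hsrc, hα0]
  have hΩ1 : ∀ s, Ω (1, s) = Δ.treeWalk (Δ.tgt α) s := by
    intro s
    simp only [Ω, partIdx_one, partPar_one]
    rw [(hΨ _).one, htgt, hα1]
    congr 2
    exact Nat.sub_add_cancel hn
  -- By time `N` all points have arrived on the path; the crossing of the cell takes four more units
  -- of time.
  let Θ : I × ℝ → Δ.Space := fun p =>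
    if p.2 ≤ (N : ℝ) then Ω p else crossing F F' (p.1, p.2 - N)
  have hΘ0 : ∀ s, Θ (0, s) = Δ.treeWalk (Δ.src α) s := by
    intro s
    simp only [Θ]
    split_ifs with hs
    · exact hΩ0 s
    · rw [crossing_zero h0, hF1 0 s (by linarith), hΩ0]
  have hΘ1 : ∀ s, Θ (1, s) = Δ.treeWalk (Δ.tgt α) s := by
    intro s
    simp only [Θ]
    split_ifs with hs
    · exact hΩ1 s
    · rw [crossing_one h1, hF1 1 s (by linarith), hΩ1]
  refine ⟨Θ, N + 4, ?_, ?_, ?_, hΘ0, hΘ1, ?_⟩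
  · refine Continuous.if_le hΩ (hΓ.comp (by fun_prop)) continuous_snd continuous_const ?_
    rintro ⟨t, s⟩ hs
    simp only at hs ⊢
    subst hs
    rw [crossing_nonpos (by simp), hF1 t _ le_rfl]
  · intro t s hs
    simp only [Θ]
    rw [if_pos (hs.trans (Nat.cast_nonneg _))]
    exact (hΨ _).nonpos _ _ hs
  · intro t s hs
    push_cast at hs
    simp only [Θ]
    rw [if_neg (by linarith), crossing_ge (by linarith), hF'1]
  · intro t s s' hs
    by_cases ht0 : t = 0
    · subst ht0
      exact Or.inl ⟨_, s, s', hs, hΘ0 s, hΘ0 s'⟩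
    by_cases ht1 : t = 1
    · subst ht1
      exact Or.inl ⟨_, s, s', hs, hΘ1 s, hΘ1 s'⟩
    -- Up to time `N` the claim is inherited from the edges of the path. After that the later point
    -- is interior to the cell or to `α`, both of which touch the vertex `q 0`, and nothing has to
    -- be known about the earlier point.
    by_cases hs' : s' ≤ N
    · simp only [Θ]
      rw [if_pos hs', if_pos (hs.trans hs')]
      exact (hΨ _).precedes _ s s' hs
    · refine hnear _ _ ?_
      simp only [Θ]
      rw [if_neg hs']
      push Not at hs'
      rcases le_or_gt 4 (s' - N) with h4 | h4
      · refine Or.inl ⟨α, t, ht0, ht1, ?_, hα0⟩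
        rw [crossing_ge h4, hF'1]
      · obtain ⟨u, r, hr, h⟩ := crossing_mid (F := F) (F' := F') ht0 ht1
          (show 0 < s' - N by linarith) h4
        have hd : ∃ d ∈ Δ.bdry c, Δ.src d = q 0 := by
          refine ⟨ζ ⟨0, hn⟩, ?_, hsrc _⟩
          rw [← hget ⟨0, hn⟩]
          exact List.get_mem _ _
        rcases h with h | h
        · exact Or.inr ⟨c, _, _, r, hr, h, hd⟩
        · exact Or.inr ⟨c, _, _, r, hr, h, hd⟩

variable {Φ : G × A → List A}

/-- The edge of every brick can be combed. -/
theorem exists_isCombing (hT : S.IsMaximalTree T) (hΦ : S.IsBoundedFlow T Φ)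
    (B : ∀ e, Brick S (S.flowRelators Φ) T e)
    (hB : ∀ e, (e ∈ T → (B e).IsFlat) ∧
      (e ∉ T → (B e).IsBuiltFrom fun i => B (S.stepEdge (S.val (S.nf T e.1)) (Φ e) i)))
    (e : G × A) : ∃ Ψ N, IsCombing B (B e).edge Ψ N := by
  induction e using (wellFounded_flow hΦ).induction with
  | _ e ih =>
    obtain ⟨h0, h1⟩ := (B e).src_tgt
    by_cases he : e ∈ T
    · rcases ((hB e).1 he).2 with h | h
      · exact isCombing_tree B (by rw [h0, h1, h])
      · obtain ⟨Ψ, N, hΨ⟩ := isCombing_tree B (d := (B e).st.dgm.rev (B e).edge)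
          (by rw [tgt_rev, h0, h, ← h1]; rfl)
        have := hΨ.rev
        rw [(B e).st.dgm.rev_rev] at this
        exact ⟨_, _, this⟩
    · obtain ⟨κ, q, c, h2, h3, h4, h5, h6, h7, -, -⟩ := (hB e).2 he
      refine isCombing_cell (List.length_pos_of_ne_nil (flow_ne_nil hΦ e)) (q := q) ?_ ?_
        (by rw [h0, h2]) (by rw [h1, h3]) h7 ?_ ?_
      · intro i
        rw [(κ i).map_src, (B _).src_tgt.1, h5]
      · intro i
        rw [CellMap.map_tgt, (B _).src_tgt.2, h6]
      · intro p p' hp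
        -- Within the brick of `e` itself every point lies in the range of the identity map.
        refine Or.inr ⟨e, he, LMap.id _, ⟨p, CellMap.onSpace_id _⟩, ?_⟩
        rw [h2] at hp
        exact hp
      · intro i
        obtain ⟨Ψ, N, hΨ⟩ := ih _ ⟨stepEdge_mem hT e i, he⟩
        exact ⟨_, _, hΨ.map (κ i)⟩

/-- Symmetric choice of combings of edges. -/
theorem exists_symmetric_combing {Δ : S.Dgm R T} :
    ∃ (Ψ : Δ.D → I × ℝ → Δ.Space) (N : ℕ), (∀ d t s, Ψ (Δ.rev d) (t, s) = Ψ d (σ t, s)) ∧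
      ∀ d, (∃ Ψ N, IsCombing B d Ψ N) → IsCombing B d (Ψ d) N := by
  classical
  let Ψ₀ : Δ.D → I × ℝ → Δ.Space := fun d =>
    if h : ∃ Ψ N, IsCombing B d Ψ N then h.choose else fun _ => Δ.pt (.vert Δ.base)
  let N₀ : Δ.D → ℕ := fun d => if h : ∃ Ψ N, IsCombing B d Ψ N then h.choose_spec.choose else 0
  have h₀ : ∀ d, (∃ Ψ N, IsCombing B d Ψ N) → IsCombing B d (Ψ₀ d) (N₀ d) := by
    intro d h
    simp only [Ψ₀, N₀, dif_pos h]
    exact h.choose_spec.choose_spec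
  have := Δ.finite_D
  have := Fintype.ofFinite Δ.D
  let r : Δ.D → Δ.D → Prop := fun d d' => d' = Δ.rev d
  -- A representative of the pair of directions, which depends on the pair only; the other direction
  -- gets the mirror image. An edge may occur in the boundary circuit in both directions, and then
  -- both must give the same paths.
  let o : Δ.D → Δ.D := fun d => (Quot.mk r d).out
  have ho : ∀ d, o (Δ.rev d) = o d := fun d => congrArg Quot.out (Quot.sound (r := r) rfl).symm
  have ho' : ∀ d, o d = d ∨ o d = Δ.rev d := by
    intro d
    have h : Quot.mk r (o d) = Quot.mk r d := Quot.out_eq _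
    have h2 : ∀ a b, Relation.EqvGen r a b → a = b ∨ a = Δ.rev b := by
      intro a b hab
      induction hab with
      | rel a b h => right; rw [show b = Δ.rev a from h, Δ.rev_rev]
      | refl => exact Or.inl rfl
      | symm a b _ ih =>
        rcases ih with rfl | rfl
        · exact Or.inl rfl
        · right; rw [Δ.rev_rev]
      | trans a b c _ _ ih ih' =>
        rcases ih with rfl | rfl
        · exact ih'
        · rcases ih' with rfl | rfl
          · exact Or.inr rfl
          · left; rw [Δ.rev_rev]
    exact h2 _ _ (Quot.eqvGen_exact h)
  refine ⟨fun d => if o d = d then Ψ₀ d else fun p => Ψ₀ (Δ.rev d) (σ p.1, p.2),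
    Finset.univ.sup N₀, ?_, ?_⟩
  · intro d t s
    simp only [ho]
    rcases ho' d with h | h
    · rw [if_pos h, if_neg (by rw [h]; exact (Δ.rev_ne d).symm), Δ.rev_rev]
    · rw [if_pos h, if_neg (by rw [h]; exact Δ.rev_ne d)]
      simp
  · intro d hd
    have hd' : ∃ Ψ N, IsCombing B (Δ.rev d) Ψ N := by
      obtain ⟨Ψ, N, h⟩ := hd
      exact ⟨_, _, h.rev⟩
    simp only
    split_ifs
    · exact (h₀ d hd).mono (Finset.le_sup (Finset.mem_univ d))
    · have := (h₀ _ hd').rev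
      rw [Δ.rev_rev] at this
      exact this.mono (Finset.le_sup (Finset.mem_univ (Δ.rev d)))

/-- Combings of the boundary edges give a 1-combing of the boundary. -/
theorem exists_oneCombing (hT : S.IsMaximalTree T) {Δ : S.Dgm R T} (outer : List Δ.D)
    (h : ∀ d ∈ outer, ∃ Ψ N, IsCombing B d Ψ N) :
    ∃ ψ : OneCombing Δ.toTwoComplex {p | p = Δ.pt (.vert Δ.base) ∨ ∃ d ∈ outer, ∃ t,
      p = Δ.pt (.edge d t)} Δ.base,
      ∀ p s t, s ≤ t → Precedes B (ψ.toFun (p, s)) (ψ.toFun (p, t)) := by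
  obtain ⟨Ψ, N, hsymm, hΨ⟩ := exists_symmetric_combing (B := B) (Δ := Δ)
  replace hΨ : ∀ d ∈ outer, IsCombing B d (Ψ d) N := fun d hd => hΨ d (h d hd)
  set Z : Set Δ.Space := {p | p = Δ.pt (.vert Δ.base) ∨ ∃ d ∈ outer, ∃ t, p = Δ.pt (.edge d t)} with hZ
  have hZ1 : Z ⊆ Δ.oneSkeleton := by
    rintro p (rfl | ⟨d, -, t, rfl⟩)
    exacts [Or.inl ⟨_, rfl⟩, Or.inr ⟨_, _, rfl⟩]
  have hbase : ∀ s, Δ.treeWalk Δ.base s = Δ.pt (.vert Δ.base) := by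
    intro s
    rw [Dgm.treeWalk, Δ.tp_base hT]; rfl
  -- The additional index `0` is the base vertex, which is the entire boundary if the circuit is
  -- empty.
  let π : Fin (outer.length + 1) × I → Z := fun x => Fin.cases
    ⟨Δ.pt (.vert Δ.base), Or.inl rfl⟩
    (fun i => ⟨Δ.pt (.edge (outer.get i) x.2), Or.inr ⟨_, List.get_mem _ _, _, rfl⟩⟩) x.1
  -- A common arrival time `N` allows all combings to be rescaled to unit time by the same factor,
  -- so they still agree at vertices.
  let F : Fin (outer.length + 1) × I → I → Δ.Space := fun x s => Fin.cases
    (Δ.pt (.vert Δ.base)) (fun i => Ψ (outer.get i) (x.2, N * s)) x.1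
  have hvert : ∀ x y s, (π x : Δ.Space) = Δ.pt (.vert y) → F x s = Δ.treeWalk y (N * s) := by
    rintro ⟨i, t⟩ y s hx
    induction i using Fin.cases with
    | zero => rw [← vert_injective hx, hbase]; rfl
    | succ i =>
      have hx' : Δ.pt (.edge (outer.get i) t) = Δ.pt (.vert y) := hx
      show Ψ (outer.get i) (t, N * s) = _
      by_cases h0 : t = 0
      · rw [h0, pt_edge_zero] at hx'
        rw [h0, (hΨ _ (List.get_mem _ _)).zero, vert_injective hx']
      · by_cases h1 : t = 1
        · rw [h1, pt_edge_one] at hx'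
          rw [h1, (hΨ _ (List.get_mem _ _)).one, vert_injective hx']
        · exact absurd hx' (edge_ne_vert h0 h1 y)
  have hcompat : ∀ x x', π x = π x' → F x = F x' := by
    intro x x' hx
    funext s
    rcases oneSkeleton_cases (hZ1 (π x).2) with ⟨y, hy⟩ | ⟨d, t, h0, h1, hd⟩
    · rw [hvert x y s hy, hvert x' y s (by rw [← hx, hy])]
    · have key : ∀ x, (π x : Δ.Space) = Δ.pt (.edge d t) → F x s = Ψ d (t, N * s) := by
        rintro ⟨i, u⟩ hx
        induction i using Fin.cases with
        | zero => exact absurd hx.symm (edge_ne_vert h0 h1 _)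
        | succ i =>
          show Ψ (outer.get i) (u, N * s) = _
          rcases edge_eq_edge h0 h1 (show _ = Δ.pt (.edge (outer.get i) u) from hx.symm) with
            ⟨h2, h3⟩ | ⟨h2, h3⟩
          · rw [h2, h3]
          · rw [h2, h3, hsymm, symm_symm]
      rw [key x hd, key x' (by rw [← hx, hd])]
  have hsurj : Function.Surjective π := by
    rintro ⟨p, rfl | ⟨d, hd, t, rfl⟩⟩
    · exact ⟨(0, 0), rfl⟩
    · obtain ⟨i, rfl⟩ := List.get_of_mem hd
      exact ⟨(i.succ, t), rfl⟩
  obtain ⟨g, hg⟩ := hsurj.hasRightInverse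
  let ψ : Z × I → Δ.Space := fun q => F (g q.1) q.2
  have hψ : ∀ x s, ψ (π x, s) = F x s := fun x s => congrFun (hcompat _ _ (hg (π x))) s
  let q : Fin (outer.length + 1) × (I × I) → Z × I := fun x => (π (x.1, x.2.1), x.2.2)
  have hq : Continuous q := by
    refine continuous_prod_of_discrete_left.2 fun i => ?_
    refine Continuous.prodMk ?_ (by fun_prop)
    refine Continuous.subtype_mk (p := (· ∈ Z)) ?_ _ |>.congr fun _ => rfl
    induction i using Fin.cases with
    | zero => exact continuous_const
    | succ i => exact (continuous_edge _).comp (by fun_prop)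
  have := t2Space_of_subset hZ1
  -- A continuous surjection from a compact space to a Hausdorff space is a quotient map, so
  -- continuity may be checked on each edge separately.
  have hqm : Topology.IsQuotientMap q := hq.isClosedMap.isQuotientMap hq (by
    rintro ⟨p, s⟩
    obtain ⟨⟨i, t⟩, rfl⟩ := hsurj p
    exact ⟨(i, t, s), rfl⟩)
  refine ⟨⟨ψ, ?_, ?_, ?_, ?_, ?_⟩, ?_⟩
  · rw [hqm.continuous_iff]
    refine continuous_prod_of_discrete_left.2 fun i => ?_
    have : (fun x : I × I => (ψ ∘ q) (i, x)) = fun x => F (i, x.1) x.2 := funext fun x => hψ _ _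
    rw [this]
    induction i using Fin.cases with
    | zero => exact continuous_const
    | succ i => exact (hΨ _ (List.get_mem _ _)).continuous.comp (by fun_prop)
  · intro p
    obtain ⟨⟨i, t⟩, rfl⟩ := hsurj p
    rw [hψ]
    induction i using Fin.cases with
    | zero => rfl
    | succ i => exact (hΨ _ (List.get_mem _ _)).nonpos _ _ (by simp)
  · intro p
    obtain ⟨⟨i, t⟩, rfl⟩ := hsurj p
    rw [hψ]
    induction i using Fin.cases with
    | zero => rfl
    | succ i => exact (hΨ _ (List.get_mem _ _)).ge _ _ (by simp)
  · intro p hp t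
    obtain ⟨x, rfl⟩ := hsurj p
    rw [hψ, hvert x _ t hp, hbase]
  · rintro p ⟨y, hy⟩ t
    obtain ⟨x, rfl⟩ := hsurj p
    rw [hψ, hvert x y t hy]
    exact walk_mem_oneSkeleton _ _ _
  · intro p s t hst
    obtain ⟨⟨i, u⟩, rfl⟩ := hsurj p
    show Precedes B (ψ _) (ψ _)
    rw [hψ, hψ]
    induction i using Fin.cases with
    | zero => exact Or.inl ⟨Δ.base, 0, 0, le_rfl, (hbase 0).symm, (hbase 0).symm⟩
    | succ i =>
      exact (hΨ _ (List.get_mem _ _)).precedes _ _ _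
        (mul_le_mul_of_nonneg_left hst (Nat.cast_nonneg _))

end SymGens

namespace TwoComplex

variable {K : TwoComplex.{u, v, w}} {L : TwoComplex.{u', v', w'}}

/-! ### Coarse distances -/

theorem dist_le {x z : K.V} {P : List K.D} (h : K.IsPath x P z) : K.dist x z ≤ P.length :=
  Nat.sInf_le ⟨P, h, rfl⟩

theorem exists_dist {x z : K.V} (h : ∃ P, K.IsPath x P z) :
    ∃ P, K.IsPath x P z ∧ P.length = K.dist x z := by
  obtain ⟨P, hP⟩ := h
  exact Nat.sInf_mem (s := {n | ∃ P, K.IsPath x P z ∧ P.length = n}) ⟨_, P, hP, rfl⟩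

theorem dist_self (x : K.V) : K.dist x x = 0 := Nat.le_zero.1 (dist_le (P := []) rfl)

theorem dist_map_le (m : CellMap K L) {x z : K.V} (h : ∃ P, K.IsPath x P z) :
    L.dist (m.onV x) (m.onV z) ≤ K.dist x z := by
  obtain ⟨P, hP, hl⟩ := exists_dist h
  rw [← hl, ← List.length_map (f := m.onD)]
  exact dist_le (hP.map m)

theorem dist_src_le {y : K.V} {d : K.D} (h : ∃ P, K.IsPath y P (K.tgt d)) :
    K.dist y (K.src d) ≤ K.dist y (K.tgt d) + 1 := by
  obtain ⟨P, hP, hl⟩ := exists_dist h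
  rw [← hl]
  refine (dist_le (P := P ++ [K.rev d]) ?_).trans (by simp)
  exact isPath_append.2 ⟨_, hP, rfl, tgt_rev d⟩

theorem dist_src_le_edgeMin {y : K.V} {d : K.D} (h : ∃ P, K.IsPath y P (K.tgt d)) :
    K.dist y (K.src d) ≤ edgeMin y d + 1 := by
  have := dist_src_le h
  unfold edgeMin
  omega

theorem coarseDist_vert (y x : K.V) : coarseDist y (K.pt (.vert x)) = K.dist y x := rfl

theorem coarseDist_edge {y : K.V} {d : K.D} {t : I} (h0 : t ≠ 0) (h1 : t ≠ 1) :
    coarseDist y (K.pt (.edge d t)) = edgeMin y d + 1 / 2 := by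
  show edgeCoarse y d t = _
  rw [edgeCoarse, if_neg h0, if_neg h1]

theorem coarseDist_face {y : K.V} {f : K.F} {k : Fin (K.bdry f).length} {t r : I} (hr : r ≠ 1) :
    coarseDist y (K.pt (.face f k t r)) = faceCoarse y f := by
  show preCoarse y (.face f k t r) = _
  rw [preCoarse, if_neg hr]

theorem coarseDist_edge_le {y : K.V} {d : K.D} {b : ℕ} (h0 : K.dist y (K.src d) ≤ b)
    (h1 : K.dist y (K.tgt d) ≤ b) (t : I) : coarseDist y (K.pt (.edge d t)) ≤ b + 1 / 2 := by
  have h0' : (K.dist y (K.src d) : ℚ) ≤ b := by exact_mod_cast h0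
  have h1' : (K.dist y (K.tgt d) : ℚ) ≤ b := by exact_mod_cast h1
  by_cases ht0 : t = 0
  · rw [ht0, pt_edge_zero, coarseDist_vert]; linarith
  by_cases ht1 : t = 1
  · rw [ht1, pt_edge_one, coarseDist_vert]; linarith
  have : (edgeMin y d : ℚ) ≤ b := by exact_mod_cast (min_le_left _ _).trans h0
  rw [coarseDist_edge ht0 ht1]
  linarith

theorem foldr_max_le {l : List ℕ} {b : ℕ} (h : ∀ x ∈ l, x ≤ b) : l.foldr max 0 ≤ b := by
  induction l with
  | nil => exact Nat.zero_le b
  | cons x l ih =>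
    exact max_le (h x (by simp)) (ih fun y hy => h y (List.mem_cons_of_mem _ hy))

theorem le_foldr_max {l : List ℕ} {x : ℕ} (h : x ∈ l) : x ≤ l.foldr max 0 := by
  induction l with
  | nil => cases h
  | cons y l ih =>
    rcases List.mem_cons.1 h with rfl | h
    exacts [le_max_left _ _, (ih h).trans (le_max_right _ _)]

/-- The coarse distance on the image of a complex is controlled by the distances of vertices. -/
theorem coarseDist_onSpace_le (m : CellMap K L) {y : L.V} {b : ℕ}
    (h : ∀ x, L.dist y (m.onV x) ≤ b) (p : K.Space) : coarseDist y (m.onSpace p) ≤ b + 1 / 2 := by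
  have hs : ∀ d, L.dist y (L.src (m.onD d)) ≤ b := fun d => by rw [m.map_src]; exact h _
  have ht : ∀ d, L.dist y (L.tgt (m.onD d)) ≤ b := fun d => by rw [m.map_tgt]; exact h _
  induction p using Space.cases with
  | hv x =>
    have : (L.dist y (m.onV x) : ℚ) ≤ b := by exact_mod_cast h x
    rw [m.onSpace_vert, coarseDist_vert]
    linarith
  | he d t => rw [m.onSpace_edge]; exact coarseDist_edge_le (hs d) (ht d) t
  | hf f k t r =>
    by_cases hr : r = 1
    · rw [hr, pt_face_one, m.onSpace_edge]
      exact coarseDist_edge_le (hs _) (ht _) t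
    · rw [m.onSpace_face, coarseDist_face hr, faceCoarse, m.map_bdry]
      have : ((((K.bdry f).map m.onD).map (edgeMin y)).foldr max 0 : ℕ) ≤ b := by
        refine foldr_max_le fun x hx => ?_
        simp only [List.map_map, List.mem_map, Function.comp_apply] at hx
        obtain ⟨d, -, rfl⟩ := hx
        exact (min_le_left _ _).trans (hs d)
      have : (((((K.bdry f).map m.onD).map (edgeMin y)).foldr max 0 : ℕ) : ℚ) ≤ b := by
        exact_mod_cast this
      linarith

/-- The start of an edge is at most one step farther than the nearer end. The coarse distance
exceeds the distance of the nearer end by $\frac12$ on the edge and by at least $\frac14$ on a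
2-cell, whose value comes from a maximum over its boundary; rounding up pays for the step. -/
theorem Near.dist_le {y : K.V} (hy : ∀ x, ∃ P, K.IsPath y P x) {p : K.Space} {x : K.V}
    (h : Near p x) : K.dist y x ≤ ⌈coarseDist y p⌉₊ := by
  have key : ∀ (a : ℕ) (c : ℚ), (a : ℚ) < c → a + 1 ≤ ⌈c⌉₊ := fun a c h => Nat.lt_ceil.2 h
  rcases h with ⟨d, t, h0, h1, rfl, rfl⟩ | ⟨f, k, t, r, hr, rfl, d, hd, rfl⟩
  · refine (dist_src_le_edgeMin (hy _)).trans (key _ _ ?_)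
    rw [coarseDist_edge h0 h1]
    linarith
  · refine (dist_src_le_edgeMin (hy _)).trans (key _ _ ?_)
    rw [coarseDist_face hr, faceCoarse]
    have : edgeMin y d ≤ (((K.bdry f).map (edgeMin y)).foldr max 0 : ℕ) :=
      le_foldr_max (List.mem_map_of_mem hd)
    have : (edgeMin y d : ℚ) ≤ ((((K.bdry f).map (edgeMin y)).foldr max 0 : ℕ) : ℚ) := by
      exact_mod_cast this
    linarith

theorem near_tgt {d : K.D} {t : I} (h0 : t ≠ 0) (h1 : t ≠ 1) :
    Near (K.pt (.edge d t)) (K.tgt d) := by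
  refine Or.inl ⟨K.rev d, σ t, ?_, ?_, (pt_edge_rev d t).symm, rfl⟩
  · rwa [Ne, symm_eq_zero]
  · rwa [Ne, symm_eq_one]

theorem IsPath.of_mem {x z : K.V} {P : List K.D} (h : K.IsPath x P z) {d : K.D} (hd : d ∈ P) :
    (∃ P', P' <+: P ∧ K.IsPath x P' (K.src d)) ∧ ∃ P', P' <+: P ∧ K.IsPath x P' (K.tgt d) := by
  obtain ⟨P₁, P₂, rfl⟩ := List.append_of_mem hd
  obtain ⟨x', h1, h2, -⟩ := isPath_append.1 h
  subst h2
  exact ⟨⟨P₁, by simp, h1⟩, P₁ ++ [d], by simp, isPath_append.2 ⟨_, h1, rfl, rfl⟩⟩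

end TwoComplex

namespace SymGens

open TwoComplex

variable {G : Type u} [Group G] {A : Type v} {S : SymGens G A} {R : Set (List A)} {T : Set (G × A)}
  {Φ : G × A → List A}

/-! ### Tameness -/

/-- Coarse distances along a combing path, measured in a complex `K` to which the diagram is mapped. -/
theorem Precedes.coarseDist_le (hT : S.IsMaximalTree T) {B : ∀ e, Brick S R T e} {Δ : S.Dgm R T}
    {K : TwoComplex.{u', v', w'}}
    (M : CellMap Δ.toTwoComplex K) {y : K.V} (hy : ∀ x, ∃ P, K.IsPath y P x)
    (hbase : M.onV Δ.base = y) {ν : G → ℕ} (hν : ∀ x, ν (Δ.pr x) ≤ K.dist y (M.onV x))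
    {N D : ℕ → ℕ}
    (hN : ∀ n Q z, Δ.IsPath Δ.base Q z → Q.map Δ.label = S.nf T (Δ.pr z) → ν (Δ.pr z) ≤ n →
      ∀ Q' z', Q' <+: Q → Δ.IsPath Δ.base Q' z' → K.dist y (M.onV z') ≤ N n)
    (hD : ∀ n, ∀ e ∉ T, ν e.1 ≤ n → ∀ (m : LMap (B e).st.dgm Δ) x,
      K.dist y (M.onV (m.onV x)) ≤ D n)
    {p p' : Δ.Space} (h : Precedes B p p') :
    coarseDist y (M.onSpace p) ≤ max ((N ⌈coarseDist y (M.onSpace p')⌉₊ : ℚ) + 1)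
      ((D ⌈coarseDist y (M.onSpace p')⌉₊ : ℚ) + 1) := by
  -- In the applications `ν` is the norm on $G$, while `N` and `D` are the maxima for normal forms
  -- and for the diagrams of non-tree edges.
  rcases h with ⟨x, s, s', hs, rfl, rfl⟩ | ⟨e, he, m, ⟨p, rfl⟩, hp⟩
  · refine le_max_of_le_left ?_
    -- The initial part `Q` contains all earlier positions. By prefix closure its label is the
    -- normal form of its end `z`, and `z` is the later point or the end of the edge being
    -- traversed.
    obtain ⟨Q, z, hQ, hQz, h1, h2⟩ := walk_locate (Δ.tp_path x) s'
    have hz : K.dist y (M.onV z) ≤ ⌈coarseDist y (M.onSpace (Δ.treeWalk x s'))⌉₊ := by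
      rcases h1 with h1 | ⟨d, t, h3, h4, h1, rfl⟩
      · rw [Dgm.treeWalk, h1, M.onSpace_vert, coarseDist_vert, Nat.ceil_natCast]
      · rw [Dgm.treeWalk, h1]
        exact ((near_tgt h3 h4).map M).dist_le hy
    have hlab : Q.map Δ.label = S.nf T (Δ.pr z) := by
      have hv := (Δ.path_label hQz).2
      rw [Δ.pr_base, one_mul] at hv
      rw [hv]
      refine (nf_prefix hT (g := Δ.pr x) ?_).symm
      rw [← Δ.tp_label]
      exact hQ.map _
    have h3 := hN _ Q z hQz hlab ((hν z).trans hz)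
    set n := ⌈coarseDist y (M.onSpace (Δ.treeWalk x s'))⌉₊
    rcases h2 s hs with h4 | ⟨d, hd, t, h4⟩
    · rw [Dgm.treeWalk, h4, M.onSpace_vert, coarseDist_vert, hbase, dist_self]
      positivity
    · rw [Dgm.treeWalk, h4, M.onSpace_edge]
      obtain ⟨⟨P₁, h5, h6⟩, P₂, h7, h8⟩ := hQz.of_mem hd
      have := coarseDist_edge_le (y := y) (d := M.onD d) (b := N n)
        (by rw [M.map_src]; exact h3 _ _ h5 h6) (by rw [M.map_tgt]; exact h3 _ _ h7 h8) t
      linarith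
  · refine le_max_of_le_right ?_
    -- The later point bounds the norm of the initial vertex of `e`, and this bounds the copy of the
    -- diagram in which the earlier point lies.
    have h1 := (hp.map M).dist_le hy
    have h2 := hν (m.onV (B e).bot)
    rw [m.map_pr, Brick.pr_bot] at h2
    have h3 := coarseDist_onSpace_le (M.comp m.toCellMap) (hD _ e he (h2.trans h1) m) p
    rw [CellMap.onSpace_comp] at h3
    linarith

/-! ### Finiteness and monotonicity of the bounds -/

theorem isPath_cayley (S : SymGens G A) (R : Set (List A)) (g : G) (x : List A) :
    (S.cayley R).IsPath g (S.pathEdges g x) (g * S.val x) := by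
  induction x generalizing g with
  | nil => show g = _; simp
  | cons a x ih =>
    refine ⟨rfl, ?_⟩
    have := ih (g * S.rep a)
    rwa [mul_assoc, ← val_cons] at this

theorem cayley_connected (hT : S.IsMaximalTree T) (R : Set (List A)) (g : G) :
    ∃ P, (S.cayley R).IsPath (1 : G) P g := by
  have := isPath_cayley S R 1 (S.nf T g)
  rw [one_mul, val_nf hT] at this
  exact ⟨_, this⟩

theorem normX_val_le (Φ : G × A → List A) (x : List A) : S.normX Φ (S.val x) ≤ x.length := by
  have := TwoComplex.dist_le (isPath_cayley S (S.flowRelators Φ) 1 x)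
  rw [one_mul] at this
  exact this.trans_eq (S.length_pathEdges 1 x)

theorem exists_word_of_isPath {R : Set (List A)} {P : List (G × A)} {g h : G}
    (hP : (S.cayley R).IsPath g P h) : h = g * S.val (P.map Prod.snd) := by
  induction P generalizing g with
  | nil => simpa using (show g = h from hP).symm
  | cons d P ih =>
    obtain ⟨rfl, hP⟩ := hP
    rw [ih hP, List.map_cons, val_cons]
    exact mul_assoc d.1 (S.rep d.2) _

theorem finite_ball [Finite A] (hT : S.IsMaximalTree T) (Φ : G × A → List A) (n : ℕ) :
    {g | S.normX Φ g ≤ n}.Finite := by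
  refine ((finite_words_le n).image S.val).subset fun g hg => ?_
  obtain ⟨P, hP, hl⟩ := exists_dist (cayley_connected hT (S.flowRelators Φ) g)
  refine ⟨P.map Prod.snd, ?_, by rw [exists_word_of_isPath hP, one_mul]⟩
  exact (List.length_map (as := P) Prod.snd).trans hl |>.trans_le hg

theorem bddAbove_nfLengths [Finite A] (hT : S.IsMaximalTree T) (Φ : G × A → List A) (n : ℕ) :
    BddAbove (S.nfLengths T Φ n) := by
  refine (((finite_ball hT Φ n).image fun g => (S.nf T g).length).subset ?_).bddAbove
  rintro _ ⟨g, hg, rfl⟩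
  exact ⟨g, hg, rfl⟩

theorem bddAbove_nfDists [Finite A] (hT : S.IsMaximalTree T) (Φ : G × A → List A) (n : ℕ) :
    BddAbove (S.nfDists T Φ n) := by
  obtain ⟨b, hb⟩ := bddAbove_nfLengths hT Φ n
  refine ⟨b, ?_⟩
  rintro _ ⟨g, x, hg, hx, rfl⟩
  exact (normX_val_le Φ x).trans (hx.length_le.trans (hb ⟨g, hg, rfl⟩))

theorem bddAbove_edges [Finite A] (hT : S.IsMaximalTree T) (Φ : G × A → List A) (f : G × A → ℕ)
    (n : ℕ) : BddAbove {m | ∃ e ∉ T, S.normX Φ e.1 ≤ n ∧ m = f e} := by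
  refine ((((finite_ball hT Φ n).prod (Set.finite_univ (α := A))).image f).subset ?_).bddAbove
  rintro _ ⟨e, -, he, rfl⟩
  exact ⟨e, ⟨he, mem_univ _⟩, rfl⟩

theorem natCast_mem_quarterNat (n : ℕ) : (n : ℚ) + 1 ∈ quarterNat :=
  ⟨4 * (n + 1), by push_cast; ring⟩

theorem max_mem_quarterNat {p q : ℚ} (hp : p ∈ quarterNat) (hq : q ∈ quarterNat) :
    max p q ∈ quarterNat := by
  rcases max_choice p q with h | h <;> rwa [h]

/-- The functions built like the explicit tame filling functions are monotone maps of `ℕ[1/4]`. -/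
theorem mapsTo_monotone_mu {s t : ℕ → Set ℕ} (hs : ∀ n, BddAbove (s n)) (ht : ∀ n, BddAbove (t n))
    (hs' : Monotone s) (ht' : Monotone t) (k : ℕ) :
    MapsTo (fun n : ℚ => max (max (((sSup (s (⌈n⌉₊ + 1)) : ℕ) : ℚ) + 1) (n + 1))
      (((sSup (t (⌈n⌉₊ + k + 1)) : ℕ) : ℚ) + 1)) quarterNat quarterNat ∧
    Monotone (fun n : ℚ => max (max (((sSup (s (⌈n⌉₊ + 1)) : ℕ) : ℚ) + 1) (n + 1))
      (((sSup (t (⌈n⌉₊ + k + 1)) : ℕ) : ℚ) + 1)) := by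
  constructor
  · rintro _ ⟨m, rfl⟩
    refine max_mem_quarterNat (max_mem_quarterNat (natCast_mem_quarterNat _) ⟨m + 4, ?_⟩)
      (natCast_mem_quarterNat _)
    push_cast; ring
  · intro a b hab
    have hc := Nat.ceil_mono hab
    have h1 : sSup (s (⌈a⌉₊ + 1)) ≤ sSup (s (⌈b⌉₊ + 1)) :=
      csSup_le_csSup' (hs _) (hs' (by omega))
    have h2 : sSup (t (⌈a⌉₊ + k + 1)) ≤ sSup (t (⌈b⌉₊ + k + 1)) :=
      csSup_le_csSup' (ht _) (ht' (by omega))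
    exact max_le_max (max_le_max (add_le_add_left (Nat.cast_le.2 h1) 1) (add_le_add_left hab 1))
      (add_le_add_left (Nat.cast_le.2 h2) 1)

/-- The estimate along the combings requires neither the enlarged radii nor the term $n+1$;
monotonicity absorbs them. -/
theorem le_mu {s t : ℕ → Set ℕ} (hs : ∀ n, BddAbove (s n)) (ht : ∀ n, BddAbove (t n))
    (hs' : Monotone s) (ht' : Monotone t) (k : ℕ) {c n : ℚ}
    (h : c ≤ max (((sSup (s ⌈n⌉₊) : ℕ) : ℚ) + 1) (((sSup (t ⌈n⌉₊) : ℕ) : ℚ) + 1)) :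
    c ≤ max (max (((sSup (s (⌈n⌉₊ + 1)) : ℕ) : ℚ) + 1) (n + 1))
      (((sSup (t (⌈n⌉₊ + k + 1)) : ℕ) : ℚ) + 1) := by
  have h1 : sSup (s ⌈n⌉₊) ≤ sSup (s (⌈n⌉₊ + 1)) := csSup_le_csSup' (hs _) (hs' (by omega))
  have h2 : sSup (t ⌈n⌉₊) ≤ sSup (t (⌈n⌉₊ + k + 1)) := csSup_le_csSup' (ht _) (ht' (by omega))
  exact h.trans (max_le_max (le_max_of_le_left (add_le_add_left (Nat.cast_le.2 h1) 1))
    (add_le_add_left (Nat.cast_le.2 h2) 1))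

/-- Every word that represents `1` has a diagram with a 1-combing that is controlled by bricks. -/
theorem exists_filling (hT : S.IsMaximalTree T) (hΦ : S.IsBoundedFlow T Φ)
    (B : ∀ e, Brick S (S.flowRelators Φ) T e)
    (hB : ∀ e, (e ∈ T → (B e).IsFlat) ∧
      (e ∉ T → (B e).IsBuiltFrom fun i => B (S.stepEdge (S.val (S.nf T e.1)) (Φ e) i)))
    {x : List A} (hx : S.val x = 1) :
    ∃ (Δ : S.Dgm (S.flowRelators Φ) T) (outer : List Δ.D) (_ : Δ.IsOuter outer)
      (_ : outer.map Δ.label = x)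
      (ψ : OneCombing Δ.toTwoComplex {p | p = Δ.pt (.vert Δ.base) ∨ ∃ d ∈ outer, ∃ t,
        p = Δ.pt (.edge d t)} Δ.base),
      ∀ p s t, s ≤ t → Precedes B (ψ.toFun (p, s)) (ψ.toFun (p, t)) := by
  obtain ⟨L, hL⟩ := exists_line hT (S.flowRelators Φ) 1
  obtain ⟨X, j, κ, q, h⟩ := exists_chain 1 x (fun i => B (S.stepEdge 1 x i)) hL x.length le_rfl
  -- The row of bricks begins and ends over $1$, where normal forms are empty; so its circuit
  -- consists of the edges labelled by $x$ alone.
  have htp : ∀ y, X.dgm.pr y = 1 → X.dgm.tp y = [] := by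
    intro y hy
    have := X.dgm.tp_label y
    rw [hy, nf_one hT] at this
    simpa using this
  have hpre : X.pre = [] := by
    rw [h.pre_eq hL]
    exact htp _ (by rw [h.pr 0 (Nat.zero_le _)]; simp)
  have htop : X.dgm.tp X.top = [] := by
    refine htp _ ?_
    rw [← h.top, h.pr _ le_rfl, List.take_length, hx, one_mul]
  have ho := X.outer
  rw [hpre, htop, revPath_nil, List.append_nil, List.nil_append] at ho
  refine ⟨X.dgm, X.done, ho, h.label_done, exists_oneCombing hT _ fun d hd => ?_⟩
  rw [h.done_eq, List.mem_ofFn] at hd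
  obtain ⟨i, rfl⟩ := hd
  obtain ⟨Ψ, N, hΨ⟩ := exists_isCombing hT hΦ B hB (S.stepEdge 1 x i)
  exact ⟨_, _, hΨ.map (κ i i.2)⟩

/-- Distances are measured in the filling diagram itself. Cellular maps do not increase distances:
the norm in $X$ is at most the intrinsic distance, and a copy of $\Delta_e$ reaches no farther from
the base vertex than $\Delta_e$ does. Along a normal form, distances are at most its length. -/
theorem isIntrinsicTameFilling [Finite A] (hT : S.IsMaximalTree T) (hΦ : S.IsBoundedFlow T Φ)
    (B : ∀ e, Brick S (S.flowRelators Φ) T e)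
    (hB : ∀ e, (e ∈ T → (B e).IsFlat) ∧
      (e ∉ T → (B e).IsBuiltFrom fun i => B (S.stepEdge (S.val (S.nf T e.1)) (Φ e) i))) :
    S.IsIntrinsicTameFilling (S.flowRelators Φ) (S.muInt fun e => (B e).diagram) := by
  have hs := bddAbove_nfLengths hT Φ
  have ht : ∀ n, BddAbove (S.intDiams (fun e => (B e).diagram) n) := bddAbove_edges hT Φ _
  have hs' : Monotone (S.nfLengths T Φ) := by
    rintro a b hab _ ⟨g, hg, rfl⟩
    exact ⟨g, hg.trans hab, rfl⟩
  have ht' : Monotone (S.intDiams fun e => (B e).diagram) := by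
    rintro a b hab _ ⟨e, he, hg, rfl⟩
    exact ⟨e, he, hg.trans hab, rfl⟩
  obtain ⟨h1, h2⟩ := mapsTo_monotone_mu hs ht hs' ht' (S.maxRel Φ)
  refine ⟨h1, h2.monotoneOn _, fun x hx => ?_⟩
  obtain ⟨Δ, outer, ho, hox, ψ, hψ⟩ := exists_filling hT hΦ B hB hx
  refine ⟨Δ.toVanKampen ho hox, ψ, fun p s t hst => ?_⟩
  have hp := (hψ p s t hst.le).coarseDist_le hT (CellMap.id Δ.toTwoComplex)
    (fun x => ⟨_, Δ.tp_path x⟩) rfl (ν := S.normX Φ) ?_ (N := fun n => sSup (S.nfLengths T Φ n))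
    (D := fun n => sSup (S.intDiams (fun e => (B e).diagram) n)) ?_ ?_
  · rw [CellMap.onSpace_id, CellMap.onSpace_id] at hp
    exact le_mu hs ht hs' ht' _ hp
  · intro x
    have := dist_map_le Δ.proj ⟨_, Δ.tp_path x⟩
    rwa [show Δ.proj.onV Δ.base = (1 : G) from Δ.pr_base] at this
  · intro n Q z hQ hlab hz Q' z' hQ' hz'
    refine (TwoComplex.dist_le hz').trans (hQ'.length_le.trans ?_)
    rw [← List.length_map (f := Δ.label), hlab]
    exact le_csSup (hs n) ⟨_, hz, rfl⟩
  · intro n e he hen m x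
    have h3 := dist_map_le m.toCellMap ⟨_, (B e).st.dgm.tp_path x⟩
    rw [m.map_base] at h3
    have := (B e).st.dgm.finite_V
    have h4 : (B e).st.dgm.dist (B e).st.dgm.base x ≤ (B e).diagram.intDiam := by
      refine le_csSup ((Set.finite_range fun y =>
        (B e).st.dgm.dist (B e).st.dgm.base y).subset ?_).bddAbove ⟨x, rfl⟩
      rintro _ ⟨y, rfl⟩
      exact ⟨y, rfl⟩
    exact h3.trans (h4.trans (le_csSup (ht n) ⟨e, he, hen, rfl⟩))

/-- Distances are measured after projection, where they depend only on the group element of a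
vertex. Maps between diagrams preserve that element, so the bounds for $\Delta_e$ hold for each of
its copies. -/
theorem isExtrinsicTameFilling [Finite A] (hT : S.IsMaximalTree T) (hΦ : S.IsBoundedFlow T Φ)
    (B : ∀ e, Brick S (S.flowRelators Φ) T e)
    (hB : ∀ e, (e ∈ T → (B e).IsFlat) ∧
      (e ∉ T → (B e).IsBuiltFrom fun i => B (S.stepEdge (S.val (S.nf T e.1)) (Φ e) i))) :
    S.IsExtrinsicTameFilling (S.flowRelators Φ) (S.muExt fun e => (B e).diagram) := by
  have hs := bddAbove_nfDists hT Φ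
  have ht : ∀ n, BddAbove (S.extDiams (fun e => (B e).diagram) n) := bddAbove_edges hT Φ _
  have hs' : Monotone (S.nfDists T Φ) := by
    rintro a b hab _ ⟨g, x, hg, hx, rfl⟩
    exact ⟨g, x, hg.trans hab, hx, rfl⟩
  have ht' : Monotone (S.extDiams fun e => (B e).diagram) := by
    rintro a b hab _ ⟨e, he, hg, rfl⟩
    exact ⟨e, he, hg.trans hab, rfl⟩
  obtain ⟨h1, h2⟩ := mapsTo_monotone_mu hs ht hs' ht' (S.maxRel Φ)
  refine ⟨h1, h2.monotoneOn _, fun x hx => ?_⟩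
  obtain ⟨Δ, outer, ho, hox, ψ, hψ⟩ := exists_filling hT hΦ B hB hx
  refine ⟨Δ.toVanKampen ho hox, ψ, fun p s t hst => ?_⟩
  have hp := (hψ p s t hst.le).coarseDist_le hT Δ.proj (y := (1 : G))
    (cayley_connected hT _) Δ.pr_base (ν := S.normX Φ) (fun _ => le_rfl)
    (N := fun n => sSup (S.nfDists T Φ n))
    (D := fun n => sSup (S.extDiams (fun e => (B e).diagram) n)) ?_ ?_
  · exact le_mu hs ht hs' ht' _ hp
  · intro n Q z hQ hlab hz Q' z' hQ' hz'
    have hv := (Δ.path_label hz').2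
    rw [Δ.pr_base, one_mul] at hv
    refine le_csSup (hs n) ⟨_, Q'.map Δ.label, hz, hlab ▸ hQ'.map _, ?_⟩
    rw [← hv]; rfl
  · intro n e he hen m x
    have := (B e).st.dgm.finite_V
    have h4 : S.normX Φ ((B e).st.dgm.pr x) ≤ (B e).diagram.extDiam := by
      refine le_csSup ((Set.finite_range fun y =>
        S.normX Φ ((B e).st.dgm.pr y)).subset ?_).bddAbove ⟨x, rfl⟩
      rintro _ ⟨y, rfl⟩
      exact ⟨y, rfl⟩
    rw [show Δ.proj.onV (m.onV x) = (B e).st.dgm.pr x from m.map_pr x]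
    exact h4.trans (le_csSup (ht n) ⟨e, he, hen, rfl⟩)

end SymGens

theorem mainTheorem3 {G : Type u} [Group G] {A : Type v} [Finite A] (S : SymGens G A)
    (T : Set (G × A)) (hT : S.IsMaximalTree T)
    (Φ : G × A → List A) (hΦ : S.IsBoundedFlow T Φ) :
    S.IsFinitePresentation (S.flowRelators Φ) ∧
    ∃ E : S.NDiagrams T Φ, S.IsRecursivelyBuilt E ∧
      (∀ n, BddAbove (S.nfLengths T Φ n) ∧ BddAbove (S.nfDists T Φ n) ∧
        BddAbove (S.intDiams E n) ∧ BddAbove (S.extDiams E n)) ∧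
      S.IsIntrinsicTameFilling (S.flowRelators Φ) (S.muInt E) ∧
      S.IsExtrinsicTameFilling (S.flowRelators Φ) (S.muExt E) := by
  obtain ⟨B, hB⟩ := SymGens.exists_bricks hT hΦ
  exact ⟨SymGens.isFinitePresentation hT hΦ, fun e => (B e).diagram,
    SymGens.isRecursivelyBuilt hΦ B hB,
    fun n => ⟨SymGens.bddAbove_nfLengths hT Φ n, SymGens.bddAbove_nfDists hT Φ n,
      SymGens.bddAbove_edges hT Φ _ n, SymGens.bddAbove_edges hT Φ _ n⟩,
    SymGens.isIntrinsicTameFilling hT hΦ B hB, SymGens.isExtrinsicTameFilling hT hΦ B hB⟩
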